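/- **System.** A source reaches a destination through one of $N\ge 1$ relays. Let $\hat h_1,\dots,\hat h_N,\omega\sim\mathcal{CN}(0,\sigma_h^2)$, $I_x\sim\mathcal{GG}(\alpha_1,m_1,\Omega_1)$, $I_y\sim\mathcal{GG}(\alpha_2,m_2,\Omega_2)$ and $R\sim\mathrm{Rayleigh}(\sigma_s)$ be jointly independent, where $\mathcal{GG}(\alpha,m,\Omega)$ has density $\frac{\alpha (m/\Omega)^m}{\Gamma(m)}x^{\alpha m-1}e^{-(m/\Omega)x^{\alpha}}$ on $x>0$. Let $1\le m\le N$, $0\le\rho\le1$, and let $\hat h_{(m)}$ be the $m$-th smallest in modulus of $\hat h_1,\dots,\hat h_N$. Put $$h=\sqrt{\rho}\,\hat h_{(m)}+\sqrt{1-\rho}\,\omega,\qquad \gamma_1=\frac{|h|^2P_1}{\sigma_0^2},\qquad \overline\gamma_1=\frac{P_1\sigma_h^2}{\sigma_0^2},$$ $$I=I_xI_yI_lI_p,\quad I_l=e^{-\sigma L},\quad I_p=A_0e^{-2R^2/\omega_{z_{eq}}^2},\quad \gamma_2=\frac{(\eta I)^r}{\sigma_0^2},\quad \mu_r=\frac{\eta^r\,\mathbb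 E[I]^r}{\sigma_0^2},\quad \xi=\frac{\omega_{z_{eq}}}{2\sigma_s},$$ with $r\in\{1,2\}$ ($r=1$ heterodyne, $r=2$ IM/DD). The fixed gain is $G=\sqrt{\sigma_r^2/(\mathbb E|h|^2P_1+\sigma_0^2)}$, the amplifier has linear scale $\Omega\ne0$ and distortion variance $\sigma_\varsigma^2\ge0$, and $$\kappa=1+\frac{\sigma_\varsigma^2}{\Omega^2G^2\sigma_0^2},\qquad c=\mathbb E[\gamma_1]+\kappa,\qquad \gamma_{\rm e2e}=\frac{\gamma_1\gamma_2}{\kappa\gamma_2+\mathbb E[\gamma_1]+\kappa}.$$ The quantities $\sigma_h^2,P_1,\sigma_0^2,\sigma_r^2,\eta,A_0,\omega_{z_{eq}},\sigma_s,\alpha_i,m_i,\Omega_i$ are positive and $\sigma,L$ are real; $p,q$ are positive integers with $p/q=\alpha_1/\alpha_2$, and $\alpha_2p$ is an integer. **Modulation.** Let $\delta\in\mathbb R$, $\tau>0$, $v\in\mathbb N$ and $q_1,\dots,q_v>0$ (for example $\delta=1,\tau=\frac12,v=1$, with $q_1=\frac12$ for OOK and $q_1=1$ for BPSK; M-PSK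 and M-QAM are covered by other values of these parameters). With $\Gamma(\tau,x)=\int_x^\infty t^{\tau-1}e^{-t}\,dt$, the average bit error probability is $$\overline{P_e}=\frac{\delta}{2\Gamma(\tau)}\sum_{k=1}^v\mathbb E\big[\Gamma(\tau,q_k\gamma_{\rm e2e})\big].$$ **Notation.** $\Delta(j:x)$ is the list $\frac xj,\frac{x+1}j,\dots,\frac{x+j-1}j$, and $\Delta(r:j:x)$ is the concatenation of $\Delta(r:\frac{x}{j}),\dots,\Delta(r:\frac{x+j-1}{j})$. Put $$\kappa_1=\Delta(\alpha_2p:1-\xi^2),\ \Delta(q:1-m_1),\ \Delta(p:1-m_2),\qquad \kappa_2=\Delta(\alpha_2p:-\xi^2),$$ $$\kappa_5=\Delta(\alpha_2p:1),\ \Delta(r:\alpha_2p:1-\xi^2),\ \Delta(r:q:1-m_1),\ \Delta(r:p:1-m_2),\qquad \kappa_6=\Delta(r:\alpha_2p:-\xi^2),$$ $$\mu=\sum_j\kappa_{2,j}-\sum_j\kappa_{1,j}+\frac{p+q}2+1,\qquad \beta=\beta_n=\frac{N-m+n+1}{[(N-m+n)(1-\rho)+1]\,\overline\gamma_1},$$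 $$\zeta=\Big(\frac{p\,\Omega_2}{m_2}\Big)^p\Big(\frac{q\,\Omega_1}{m_1}\Big)^q\Big(\frac{A_0I_l}{\mathbb E[I]}\Big)^{\alpha_2p}\mu_r^{\alpha_2p/r}.$$ The Meijer G-function is the Mellin–Barnes integral $$G^{M,K}_{P,Q}\Big(z\,\Big|\,{a\atop b}\Big)=\frac1{2\pi i}\int\frac{\prod_{j\le M}\Gamma(b_j+s)\prod_{j\le K}\Gamma(1-a_j-s)}{\prod_{j>K}\Gamma(a_j+s)\prod_{j>M}\Gamma(1-b_j-s)}z^{-s}\,ds$$ along a vertical line that separates the poles of the $\Gamma(b_j+s)$ from those of the $\Gamma(1-a_j-s)$. **Claim.** In terms of the CDF $F_{\gamma_{\rm e2e}}$ of $\gamma_{\rm e2e}$, with integrable integrands, $$\overline{P_e}=\frac{\delta}{2\Gamma(\tau)}\sum_{k=1}^vq_k^\tau\int_0^\infty\gamma^{\tau-1}e^{-q_k\gamma}F_{\gamma_{\rm e2e}}(\gamma)\,d\gamma,$$ and in closed form $$\overline{P_e}=\frac{\delta v}2-\frac{m\,\delta\,\xi^2\,p^{\tau+m_2-\frac32}\,q^{m_1-\frac12}\,\alpha_2^{\tau-1}\,r^{\mu-1}}{2(2\pi)^{\frac{2\alpha_2p+r(p+q)-4}2}\Gamma(m_1)\Gamma(m_2)\Gamma(\tau)}\binom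 Nm\sum_{n=0}^{m-1}\sum_{k=1}^v\binom{m-1}n\frac{(-1)^n}{N-m+n+1}\Big(\frac{q_k}{\beta\kappa+q_k}\Big)^{\tau}$$ $$\times\ G^{\,r(p+q+\alpha_2p)+\alpha_2p,\ \alpha_2p}_{\,(r+1)\alpha_2p,\ r(p+q+\alpha_2p)+\alpha_2p}\left(\Big(\frac{\beta c}{\beta\kappa+q_k}\Big)^{\alpha_2p}(\zeta r^{p+q})^{-r}\ \Big|\ {\Delta(\alpha_2p:1-\tau),\ 1-\kappa_6\atop 1-\kappa_5}\right).$$ For all the Meijer G-functions that occur here a separating vertical line exists, the integral converges absolutely along every such line, and its value does not depend on the line. -/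

import Mathlib

open MeasureTheory ProbabilityTheory

noncomputable section

namespace Relay

/-! ### Special functions -/

/-- The upper incomplete Gamma function `Γ(a, x) = ∫_x^∞ t^(a-1) e^(-t) dt`. -/
def upperGamma (a x : ℝ) : ℝ := ∫ t in Set.Ioi x, t ^ (a - 1) * Real.exp (-t)

/-- The Mellin–Barnes integrand of the Meijer G-function with upper parameters `a`
and lower parameters `b`:
`∏_{j ≤ m} Γ(b_j + s) ∏_{j ≤ n} Γ(1 - a_j - s)
  / (∏_{j > n} Γ(a_j + s) ∏_{j > m} Γ(1 - b_j - s)) * z^(-s)`.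
(Mathlib's `Complex.Gamma` is `0` at its poles, so `1 / Γ` has its correct value `0` there.) -/
def meijerIntegrand (m n : ℕ) (a b : List ℝ) (z : ℝ) (s : ℂ) : ℂ :=
  ((b.take m).map fun x : ℝ => Complex.Gamma ((x : ℂ) + s)).prod *
    ((a.take n).map fun x : ℝ => Complex.Gamma (1 - (x : ℂ) - s)).prod /
  (((a.drop n).map fun x : ℝ => Complex.Gamma ((x : ℂ) + s)).prod *
    ((b.drop m).map fun x : ℝ => Complex.Gamma (1 - (x : ℂ) - s)).prod) *
  (z : ℂ) ^ (-s)

/-- The vertical line `Re s = c` separates the poles of `Γ(b_j + s)`, `j ≤ m` (on its left)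
from the poles of `Γ(1 - a_j - s)`, `j ≤ n` (on its right). -/
def MeijerSeparates (m n : ℕ) (a b : List ℝ) (c : ℝ) : Prop :=
  (∀ x ∈ b.take m, -x < c) ∧ (∀ x ∈ a.take n, c < 1 - x)

/-- The Mellin–Barnes integral along the upward vertical line `Re s = c`,
`(1 / 2πi) ∫ … ds` with `s = c + i t`. -/
def meijerLineIntegral (m n : ℕ) (a b : List ℝ) (z c : ℝ) : ℂ :=
  (1 / (2 * (Real.pi : ℂ))) *
    ∫ t : ℝ, meijerIntegrand m n a b z ((c : ℂ) + (t : ℂ) * Complex.I)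

/-- The Mellin–Barnes integral that defines the Meijer G-function makes sense: a separating
vertical contour exists, and the integral converges absolutely along every such contour, with
a value that does not depend on the contour. -/
def MeijerConverges (m n : ℕ) (a b : List ℝ) (z : ℝ) : Prop :=
  (∃ c : ℝ, MeijerSeparates m n a b c) ∧
  (∀ c : ℝ, MeijerSeparates m n a b c →
    Integrable fun t : ℝ => meijerIntegrand m n a b z ((c : ℂ) + (t : ℂ) * Complex.I)) ∧
  (∀ c c' : ℝ, MeijerSeparates m n a b c → MeijerSeparates m n a b c' →
    meijerLineIntegral m n a b z c = meijerLineIntegral m n a b z c')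

open Classical in
/-- The Meijer G-function `G^{m,n}_{p,q}(z | a ; b)`, `p` and `q` being the lengths of `a` and `b`,
for real parameters whose poles can be separated by a vertical line: the Mellin–Barnes integral
along such a line. -/
def meijerG (m n : ℕ) (a b : List ℝ) (z : ℝ) : ℂ :=
  if h : ∃ c : ℝ, MeijerSeparates m n a b c then meijerLineIntegral m n a b z h.choose else 0

/-- `Δ(j : x) = x / j, (x + 1) / j, …, (x + j - 1) / j`. -/
def delta (j : ℕ) (x : ℝ) : List ℝ := (List.range j).map fun i : ℕ => (x + i) / j

/-- `Δ(r : j : x) = Δ(r : x / j), …, Δ(r : (x + j - 1) / j)`. -/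
def delta₃ (r j : ℕ) (x : ℝ) : List ℝ := (delta j x).flatMap (delta r)

/-! ### Probability laws -/

/-- The circularly symmetric complex Gaussian law `CN(0, s)`, with `E|h|² = s`. -/
def complexGaussian (s : ℝ) : Measure ℂ :=
  ((gaussianReal 0 (s / 2).toNNReal).prod (gaussianReal 0 (s / 2).toNNReal)).map
    fun x : ℝ × ℝ => (⟨x.1, x.2⟩ : ℂ)

/-- The generalized Gamma law `GG(α, m, Ω)`, with density
`α (m/Ω)^m / Γ(m) * x^(α m - 1) * exp(-(m/Ω) x^α)` on `x > 0`. -/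
def genGamma (α m Ω : ℝ) : Measure ℝ :=
  volume.withDensity fun x => ENNReal.ofReal <|
    if 0 < x then
      α * (m / Ω) ^ m / Real.Gamma m * x ^ (α * m - 1) * Real.exp (-(m / Ω) * x ^ α)
    else 0

/-- The Rayleigh law with scale `σ`, with density `x / σ² * exp(-x² / (2σ²))` on `x > 0`. -/
def rayleigh (σ : ℝ) : Measure ℝ :=
  volume.withDensity fun x => ENNReal.ofReal <|
    if 0 < x then x / σ ^ 2 * Real.exp (-x ^ 2 / (2 * σ ^ 2)) else 0

/-! ### The system -/

/-- The deterministic parameters of the mixed RF/FSO fixed-gain relaying system. -/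
structure Params where
  /-- number of relays -/
  N : ℕ
  /-- rank of the selected relay, in increasing order of the outdated RF channel gains -/
  m : ℕ
  one_le_m : 1 ≤ m
  m_le_N : m ≤ N
  /-- correlation coefficient of the outdated and the current channel state information -/
  ρ : ℝ
  ρ_nonneg : 0 ≤ ρ
  ρ_le_one : ρ ≤ 1
  /-- variance of the RF channel coefficients -/
  σh2 : ℝ
  σh2_pos : 0 < σh2
  /-- average power transmitted by the source -/
  P₁ : ℝ
  P₁_pos : 0 < P₁
  /-- noise variance `σ₀²` -/
  σ02 : ℝ
  σ02_pos : 0 < σ02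
  /-- mean power `σ_r²` of the signal at the output of the gain block -/
  σr2 : ℝ
  σr2_pos : 0 < σr2
  /-- linear scale `Ω` of the (Bussgang-linearized) power amplifier -/
  ΩHPA : ℝ
  ΩHPA_ne : ΩHPA ≠ 0
  /-- variance `σ_ς²` of the non-linear distortion of the power amplifier -/
  σς2 : ℝ
  σς2_nonneg : 0 ≤ σς2
  /-- detection: `r = 1` heterodyne, `r = 2` IM/DD -/
  r : ℕ
  r_eq : r = 1 ∨ r = 2
  /-- electrical-to-optical conversion coefficient -/
  η : ℝ
  η_pos : 0 < η
  /-- weather attenuation -/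
  σatt : ℝ
  /-- length of the optical link -/
  L : ℝ
  /-- fraction of the collected power -/
  A₀ : ℝ
  A₀_pos : 0 < A₀
  /-- equivalent beam waist -/
  ωzeq : ℝ
  ωzeq_pos : 0 < ωzeq
  /-- jitter standard deviation -/
  σs : ℝ
  σs_pos : 0 < σs
  /-- parameters of the large-scale fluctuations `GG(α₁, m₁, Ω₁)` -/
  α₁ : ℝ
  m₁ : ℝ
  Ω₁ : ℝ
  α₁_pos : 0 < α₁
  m₁_pos : 0 < m₁
  Ω₁_pos : 0 < Ω₁
  /-- parameters of the small-scale fluctuations `GG(α₂, m₂, Ω₂)` -/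
  α₂ : ℝ
  m₂ : ℝ
  Ω₂ : ℝ
  α₂_pos : 0 < α₂
  m₂_pos : 0 < m₂
  Ω₂_pos : 0 < Ω₂
  /-- positive integers with `p / q = α₁ / α₂` -/
  p : ℕ
  q : ℕ
  p_pos : 0 < p
  q_pos : 0 < q
  p_div_q : (p : ℝ) / q = α₁ / α₂
  /-- the integer `α₂ p`, which occurs as the length of parameter lists -/
  l : ℕ
  l_eq : (l : ℝ) = α₂ * p

/-- The parameters `δ, τ, v, q_k` of a modulation. -/
structure Modulation where
  δ : ℝ
  τ : ℝ
  τ_pos : 0 < τ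
  v : ℕ
  qk : ℕ → ℝ
  qk_pos : ∀ k ∈ Finset.Icc 1 v, 0 < qk k

variable (S : Params)

/-- Path loss `I_l = exp(-σ L)`. -/
def Params.Il : ℝ := Real.exp (-S.σatt * S.L)

/-- Pointing error coefficient `ξ = ω_zeq / (2 σ_s)`. -/
def Params.ξ : ℝ := S.ωzeq / (2 * S.σs)

/-- Average SNR of an RF link. -/
def Params.γbar₁ : ℝ := S.P₁ * S.σh2 / S.σ02

/-- The coefficient of rank `m` among `h 0, …, h (N - 1)`, arranged in increasing order
of amplitude. -/
def Params.select (h : Fin S.N → ℂ) : ℂ :=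
  h (Tuple.sort (fun i => ‖h i‖)
    ⟨S.m - 1, lt_of_lt_of_le (Nat.sub_lt S.one_le_m Nat.one_pos) S.m_le_N⟩)

/-- The random quantities of the system on a probability space: the outdated RF channel
coefficients `hhat i` and the innovation `w` (all `CN(0, σ_h²)`), the two factors `Ix`, `Iy` of the
optical turbulence (generalized Gamma) and the radial displacement `R` (Rayleigh).
They are jointly independent. -/
structure Channel {Ω : Type*} [MeasurableSpace Ω] (P : Measure Ω) where
  hhat : Ω → Fin S.N → ℂ
  w : Ω → ℂ
  Ix : Ω → ℝ
  Iy : Ω → ℝ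
  R : Ω → ℝ
  hasLaw : HasLaw (fun ω => (hhat ω, w ω, Ix ω, Iy ω, R ω))
    ((Measure.pi fun _ : Fin S.N => complexGaussian S.σh2).prod <|
      (complexGaussian S.σh2).prod <| (genGamma S.α₁ S.m₁ S.Ω₁).prod <|
        (genGamma S.α₂ S.m₂ S.Ω₂).prod (rayleigh S.σs)) P

namespace Channel

variable {S} {Ω : Type*} [MeasurableSpace Ω] {P : Measure Ω} (C : Channel S P)

/-- Current coefficient of the selected RF link, `h = √ρ ĥ_(m) + √(1 - ρ) w`. -/
def h (ω : Ω) : ℂ := (√S.ρ : ℂ) * S.select (C.hhat ω) + (√(1 - S.ρ) : ℂ) * C.w ω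

/-- Instantaneous SNR of the selected RF link. -/
def γ₁ (ω : Ω) : ℝ := ‖C.h ω‖ ^ 2 * S.P₁ / S.σ02

/-- Pointing error `I_p = A₀ exp(-2 R² / ω_zeq²)`. -/
def Ip (ω : Ω) : ℝ := S.A₀ * Real.exp (-2 * C.R ω ^ 2 / S.ωzeq ^ 2)

/-- Optical channel gain `I = I_a I_l I_p`, with `I_a = I_x I_y`. -/
def I (ω : Ω) : ℝ := C.Ix ω * C.Iy ω * S.Il * C.Ip ω

/-- Instantaneous SNR of the optical link, `(η I)^r / σ₀²`. -/
def γ₂ (ω : Ω) : ℝ := (S.η * C.I ω) ^ S.r / S.σ02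

/-- Average electrical SNR `μ_r = η^r E[I]^r / σ₀²`. -/
def μr : ℝ := S.η ^ S.r * (∫ ω, C.I ω ∂P) ^ S.r / S.σ02

/-- The fixed gain `G = √(σ_r² / (E|h|² P₁ + σ₀²))`. -/
def gain : ℝ := √(S.σr2 / ((∫ ω, ‖C.h ω‖ ^ 2 ∂P) * S.P₁ + S.σ02))

/-- The non-linearity factor `κ = 1 + σ_ς² / (Ω² G² σ₀²)`. -/
def κ : ℝ := 1 + S.σς2 / (S.ΩHPA ^ 2 * C.gain ^ 2 * S.σ02)

/-- The constant `c = E[γ₁] + κ`. -/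
def c : ℝ := (∫ ω, C.γ₁ ω ∂P) + C.κ

/-- End-to-end SNDR `γ₁ γ₂ / (κ γ₂ + E[γ₁] + κ)`. -/
def γe2e (ω : Ω) : ℝ := C.γ₁ ω * C.γ₂ ω / (C.κ * C.γ₂ ω + (∫ ω', C.γ₁ ω' ∂P) + C.κ)

/-- The average bit error probability
`δ / (2 Γ(τ)) * ∑_k ∫ Γ(τ, q_k γ) dF(γ)`, `F` being the law of the end-to-end SNDR. -/
def averageBEP (M : Modulation) : ℝ :=
  M.δ / (2 * Real.Gamma M.τ) *
    ∑ k ∈ Finset.Icc 1 M.v, ∫ γ, upperGamma M.τ (M.qk k * γ) ∂(P.map C.γe2e)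

/-- `ζ = (p Ω₂ / m₂)^p (q Ω₁ / m₁)^q (A₀ I_l / E[I])^(α₂ p) μ_r^(α₂ p / r)`. -/
def ζ : ℝ :=
  (S.p * S.Ω₂ / S.m₂) ^ S.p * (S.q * S.Ω₁ / S.m₁) ^ S.q *
    (S.A₀ * S.Il / ∫ ω, C.I ω ∂P) ^ S.l * C.μr ^ ((S.l : ℝ) / S.r)

end Channel

/-! ### The parameters of the closed form -/

namespace Params

def κ₁ : List ℝ := delta S.l (1 - S.ξ ^ 2) ++ delta S.q (1 - S.m₁) ++ delta S.p (1 - S.m₂)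

def κ₂ : List ℝ := delta S.l (-S.ξ ^ 2)

def κ₅ : List ℝ :=
  delta S.l 1 ++ delta₃ S.r S.l (1 - S.ξ ^ 2) ++ delta₃ S.r S.q (1 - S.m₁) ++
    delta₃ S.r S.p (1 - S.m₂)

def κ₆ : List ℝ := delta₃ S.r S.l (-S.ξ ^ 2)

def μ : ℝ := S.κ₂.sum - S.κ₁.sum + ((S.p : ℝ) + S.q) / 2 + 1

/-- `β = (N - m + n + 1) / ([(N - m + n)(1 - ρ) + 1] γ̄₁)`. -/
def β (n : ℕ) : ℝ :=
  ((S.N : ℝ) - S.m + n + 1) / ((((S.N : ℝ) - S.m + n) * (1 - S.ρ) + 1) * S.γbar₁)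

/-- Upper parameters of the Meijer G-function: `Δ(α₂ p : 1 - τ), 1 - κ₆`. -/
def upperList (M : Modulation) : List ℝ := delta S.l (1 - M.τ) ++ S.κ₆.map (fun x => 1 - x)

/-- Lower parameters of the Meijer G-function: `1 - κ₅`. -/
def lowerList : List ℝ := S.κ₅.map (fun x => 1 - x)

end Params

/-- Argument of the Meijer G-function. -/
def Channel.arg {S : Params} {Ω : Type*} [MeasurableSpace Ω] {P : Measure Ω} (C : Channel S P)
    (M : Modulation) (n k : ℕ) : ℝ :=
  (S.β n * C.c / (S.β n * C.κ + M.qk k)) ^ S.l *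
    ((C.ζ * (S.r : ℝ) ^ (S.p + S.q)) ^ S.r)⁻¹

end Relay

end

noncomputable section

namespace Relay

/-! ### Gauss' multiplication formula -/

/-! Condition on the optical SNR $Y$. Almost surely $Y>0$, and then $\gamma_{\rm e2e}>\gamma$ means
$\gamma_1>\gamma(\kappa+c/Y)$, so the tail of $\gamma_1$ is all that is needed from the radio side.

That tail is a finite signed sum of exponentials. Ties have probability zero, so the selected
estimate has density proportional to $(1-e)^{m-1}e^{N-m}$ with respect to
$\mathcal{CN}(0,\sigma_h^2)$, where $e=\exp(-|z|^2/\sigma_h^2)$. After binomial expansion each power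
$e^a$ tilts the Gaussian into another one, of variance $\sigma_h^2/(1+a)$
(`lintegral_exp_mul_complexGaussian`). Adding the independent innovation keeps it Gaussian, and the
squared modulus of a complex Gaussian is exponential. This gives the rates $\beta_n$
(`prod_tail_comp_sort`).

By Fubini, the mean of $\Gamma(\tau,q\gamma_{\rm e2e})$ is an integral of the CDF against
$\gamma^{\tau-1}e^{-q\gamma}$. Integrating an exponential there leaves $\mathbb E[(1+B/Y)^{-\tau}]$
up to a factor, with $B=\beta c/(\beta\kappa+q)$.

The Mellin–Barnes formula $\Gamma(\tau)(1+x)^{-\tau}=\frac1{2\pi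
i}\int\Gamma(s)\Gamma(\tau-s)x^{-s}\,ds$, averaged at $x=B/Y$, brings in the moments $\mathbb
E[Y^s]$. These are explicit: one Gamma quotient for each turbulence factor and the rational factor
$\xi^2/(\xi^2+rs)$ for the pointing error (`integral_Gamma_mul_moment`, `integral_cpow_fsoGain`).

With $\alpha_2p\,s$ in place of $s$, every Gamma argument is an integer multiple of $s$ plus a
constant. Gauss' multiplication formula matches these Gammas with the products over the lists
$\Delta$ (`gammaProd_ratio`), which identifies the integrand with that of the Meijer function up to
a constant (`meijerIntegrand_arg`). Each separating line thus gives the same expectation, which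
settles convergence and independence of the contour as well (`meijerLine`). -/

open Filter Topology Nat in
theorem tendsto_factorial_pow_div (d : ℕ) :
    Tendsto (fun n : ℕ => (n ! : ℝ) ^ (d + 1) * ((d : ℝ) + 1) ^ ((d + 1) * n + 1) /
      ((((d + 1) * n)! : ℕ) * (n : ℝ) ^ ((d : ℝ) / 2))) atTop
      (𝓝 ((2 * Real.pi) ^ ((d : ℝ) / 2) * √((d : ℝ) + 1))) := by
  -- Stirling's sequence tends to $\sqrt\pi$. Its $(d+1)$-st power at $n$ over its value at $(d+1)n$
  -- is the wanted ratio, up to the constant restored in `h3`; the powers of $n/e$ cancel.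
  have h1 := Stirling.tendsto_stirlingSeq_sqrt_pi
  have h2 : Tendsto (fun n : ℕ => Stirling.stirlingSeq ((d + 1) * n)) atTop (𝓝 √Real.pi) :=
    h1.comp (tendsto_id.const_mul_atTop' (Nat.succ_pos d))
  have hpi : √Real.pi ≠ 0 := by positivity
  have h3 := ((h1.pow (d + 1)).div h2 hpi).mul_const ((2 : ℝ) ^ ((d : ℝ) / 2) * √((d : ℝ) + 1))
  have hsq : ∀ x : ℝ, 0 ≤ x → √x ^ d = x ^ ((d : ℝ) / 2) := fun x hx => by
    rw [Real.sqrt_eq_rpow, ← Real.rpow_natCast, ← Real.rpow_mul hx]; ring_nf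
  have e : √Real.pi ^ (d + 1) / √Real.pi * ((2 : ℝ) ^ ((d : ℝ) / 2) * √((d : ℝ) + 1)) =
      (2 * Real.pi) ^ ((d : ℝ) / 2) * √((d : ℝ) + 1) := by
    rw [pow_succ, mul_div_assoc, div_self hpi, hsq _ Real.pi_pos.le,
      Real.mul_rpow two_pos.le Real.pi_pos.le]
    ring
  rw [e] at h3
  refine h3.congr' ?_
  filter_upwards [eventually_gt_atTop 0] with n hn
  have hn' : (0 : ℝ) < n := by exact_mod_cast hn
  simp only [Pi.div_apply, Stirling.stirlingSeq]
  have hA : √(2 * (((d + 1) * n : ℕ) : ℝ)) = √((d : ℝ) + 1) * √(2 * n) := by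
    rw [← Real.sqrt_mul (by positivity)]; push_cast; ring_nf
  have hB : ((((d + 1) * n : ℕ) : ℝ) / Real.exp 1) ^ ((d + 1) * n) =
      ((d : ℝ) + 1) ^ ((d + 1) * n) * (((n : ℝ) / Real.exp 1) ^ n) ^ (d + 1) := by
    rw [← pow_mul, mul_comm n, ← mul_pow]; push_cast; ring_nf
  have hC : √(2 * (n : ℝ)) ^ d = 2 ^ ((d : ℝ) / 2) * (n : ℝ) ^ ((d : ℝ) / 2) := by
    rw [hsq _ (by positivity), Real.mul_rpow two_pos.le hn'.le]
  have hD : √((d : ℝ) + 1) * √((d : ℝ) + 1) = d + 1 := Real.mul_self_sqrt (by positivity)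
  rw [hA, hB, div_pow, mul_pow, pow_succ (√(2 * (n : ℝ))), hC]
  have q1 : √((d : ℝ) + 1) ≠ 0 := by positivity
  have q2 : √(2 * (n : ℝ)) ≠ 0 := by positivity
  have q3 : ((n : ℝ) / Real.exp 1) ^ n ≠ 0 := by positivity
  have q4 : ((d : ℝ) + 1) ^ ((d + 1) * n) ≠ 0 := by positivity
  have q5 : (n : ℝ) ^ ((d : ℝ) / 2) ≠ 0 := by positivity
  have q6 : (2 : ℝ) ^ ((d : ℝ) / 2) ≠ 0 := by positivity
  have q7 : ((((d + 1) * n)! : ℕ) : ℝ) ≠ 0 := by positivity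
  rw [pow_succ ((d : ℝ) + 1)]
  generalize ((n : ℝ) / Real.exp 1) ^ n = u at *
  generalize ((d : ℝ) + 1) ^ ((d + 1) * n) = w at *
  generalize √((d : ℝ) + 1) = y at *
  rw [← hD]
  field_simp

/-- Division with remainder: each $t<kn$ is $i+kj$ for exactly one pair $i<k$, $j<n$. -/
theorem prod_range_mul_eq (F : ℕ → ℂ) (k n : ℕ) :
    ∏ i ∈ Finset.range k, ∏ j ∈ Finset.range n, F (i + k * j) =
      ∏ t ∈ Finset.range (k * n), F t := by
  rw [Finset.prod_comm]
  induction n with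
  | zero => simp
  | succ n ih =>
    rw [Finset.prod_range_succ, ih, Nat.mul_succ, Finset.prod_range_add]
    simp only [add_comm]

theorem sum_range_div (d : ℕ) :
    ∑ i ∈ Finset.range (d + 1), (i : ℂ) / ((d : ℂ) + 1) = d / 2 := by
  have h : ∀ k : ℕ, ∑ i ∈ Finset.range (k + 1), (i : ℂ) = k * (k + 1) / 2 := fun k => by
    induction k with
    | zero => simp
    | succ k ih => rw [Finset.sum_range_succ, ih]; push_cast; ring
  rw [← Finset.sum_div, h]
  have : (d : ℂ) + 1 ≠ 0 := by exact_mod_cast d.succ_ne_zero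
  field_simp

-- Compare Euler's limits. The factors $s+\frac i{d+1}+j$ with $i\le d$, $j\le n$ are the numbers
-- $((d+1)s+t)/(d+1)$ with $t<(d+1)(n+1)$. Euler's sequence of $(d+1)s$ at $(d+1)n$ uses all of them
-- except the last $d$, and those, once normalized, tend to $1$. The remaining factorials and powers
-- form the ratio in `tendsto_factorial_pow_div`.
open Filter Topology Nat in
theorem prod_Gamma_add_div_aux (d : ℕ) {s : ℂ} (hs : 0 < s.re) :
    ∏ i ∈ Finset.range (d + 1), Complex.Gamma (s + i / ((d : ℂ) + 1)) =
      ((2 * Real.pi) ^ ((d : ℝ) / 2) * √((d : ℝ) + 1) : ℝ) *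
        ((d : ℂ) + 1) ^ (-((d + 1) * s)) * Complex.Gamma ((d + 1) * s) := by
  have hd : (d : ℂ) + 1 ≠ 0 := by exact_mod_cast d.succ_ne_zero
  have hL : Tendsto (fun n => ∏ i ∈ Finset.range (d + 1),
      Complex.GammaSeq (s + i / ((d : ℂ) + 1)) n) atTop
      (𝓝 (∏ i ∈ Finset.range (d + 1), Complex.Gamma (s + i / ((d : ℂ) + 1)))) :=
    tendsto_finsetProd _ fun i _ => Complex.GammaSeq_tendsto_Gamma _
  have hG : Tendsto (fun n : ℕ => Complex.GammaSeq ((d + 1) * s) ((d + 1) * n)) atTop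
      (𝓝 (Complex.Gamma ((d + 1) * s))) :=
    (Complex.GammaSeq_tendsto_Gamma _).comp (tendsto_id.const_mul_atTop' (Nat.succ_pos d))
  have hD := (Complex.continuous_ofReal.tendsto _).comp (tendsto_factorial_pow_div d)
  have hF : ∀ t : ℕ, ((d : ℂ) + 1) * s + t ≠ 0 := fun t h => by
    have := congrArg Complex.re h
    have h1 : (((d : ℂ) + 1) * s + t).re = ((d : ℝ) + 1) * s.re + t := by simp
    rw [h1, Complex.zero_re] at this
    have : 0 < ((d : ℝ) + 1) * s.re := by positivity
    have : (0 : ℝ) ≤ t := t.cast_nonneg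
    linarith
  have hT' : ∀ t ∈ Finset.range d, Tendsto (fun n : ℕ =>
      ((d + 1) * (n : ℂ)) / ((d + 1) * s + ((d + 1) * n + 1 + t : ℕ))) atTop (𝓝 1) := fun t _ => by
    have h0 : Tendsto (fun n : ℕ => 1 + (((d + 1) * s + 1 + t) / (d + 1)) * ((n : ℂ))⁻¹) atTop
        (𝓝 (1 + (((d + 1) * s + 1 + t) / (d + 1)) * 0)) :=
      (tendsto_inv_atTop_nhds_zero_nat.const_mul _).const_add _
    have h0 := h0.inv₀ (by simp)
    simp only [mul_zero, add_zero, inv_one] at h0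
    refine h0.congr' ?_
    filter_upwards [eventually_gt_atTop 0] with n hn
    have hn' : (n : ℂ) ≠ 0 := by exact_mod_cast hn.ne'
    have h1 := hF ((d + 1) * n + 1 + t)
    have h2 : 1 + (((d : ℂ) + 1) * s + 1 + t) / (d + 1) * ((n : ℂ))⁻¹ =
        ((d + 1) * s + ((d + 1) * n + 1 + t : ℕ)) / ((d + 1) * (n : ℂ)) := by
      push_cast; field_simp; ring
    rw [h2, inv_div]
  have hT := tendsto_finsetProd _ hT'
  rw [Finset.prod_const_one] at hT
  have hR := ((hG.mul hD).mul hT).mul_const (((d : ℂ) + 1) ^ (-((d + 1) * s)))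
  refine (tendsto_nhds_unique hL (hR.congr' ?_)).trans (by ring)
  filter_upwards [eventually_gt_atTop 0] with n hn
  have hn' : (n : ℂ) ≠ 0 := by exact_mod_cast hn.ne'
  have e1 : ∏ i ∈ Finset.range (d + 1), (n : ℂ) ^ (s + i / ((d : ℂ) + 1)) =
      (n : ℂ) ^ ((d + 1) * s) * (n : ℂ) ^ ((d : ℂ) / 2) := by
    simp_rw [Complex.cpow_def_of_ne_zero hn', ← Complex.exp_sum, ← Complex.exp_add,
      ← Finset.mul_sum, Finset.sum_add_distrib, sum_range_div]
    simp [mul_add]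
  have e2 : ∏ i ∈ Finset.range (d + 1), ∏ j ∈ Finset.range (n + 1),
      (s + i / ((d : ℂ) + 1) + j) =
      ((∏ t ∈ Finset.range ((d + 1) * n + 1), (((d : ℂ) + 1) * s + t)) *
        ∏ t ∈ Finset.range d, (((d : ℂ) + 1) * s + ((d + 1) * n + 1 + t : ℕ))) /
        ((d : ℂ) + 1) ^ ((d + 1) * (n + 1)) := by
    have : ∀ i j : ℕ, s + i / ((d : ℂ) + 1) + j =
        (fun t : ℕ => (((d : ℂ) + 1) * s + t) / (d + 1)) (i + (d + 1) * j) := fun i j => by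
      push_cast; field_simp; ring
    rw [Finset.prod_congr rfl fun i _ => Finset.prod_congr rfl fun j _ => this i j,
      prod_range_mul_eq (fun t : ℕ => (((d : ℂ) + 1) * s + t) / (d + 1)), Finset.prod_div_distrib,
      ← Finset.prod_range_add (fun t : ℕ => ((d : ℂ) + 1) * s + t)]
    simp only [Finset.prod_const, Finset.card_range]
    rw [show (d + 1) * n + 1 + d = (d + 1) * (n + 1) by ring]
  have e3 : (((d + 1) * n : ℕ) : ℂ) ^ (((d : ℂ) + 1) * s) =
      ((d : ℂ) + 1) ^ (((d : ℂ) + 1) * s) * (n : ℂ) ^ (((d : ℂ) + 1) * s) := by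
    rw [Nat.cast_mul, Complex.natCast_mul_natCast_cpow]; push_cast; rfl
  have e4 : (((n : ℝ) ^ ((d : ℝ) / 2) : ℝ) : ℂ) = (n : ℂ) ^ ((d : ℂ) / 2) := by
    rw [Complex.ofReal_cpow n.cast_nonneg]; push_cast; rfl
  have e5 : (n : ℂ) ^ ((d : ℂ) / 2) * (n : ℂ) ^ ((d : ℂ) / 2) = (n : ℂ) ^ d := by
    rw [← Complex.cpow_add _ _ hn', add_halves, Complex.cpow_natCast]
  have q1 : ∏ t ∈ Finset.range ((d + 1) * n + 1), (((d : ℂ) + 1) * s + t) ≠ 0 :=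
    Finset.prod_ne_zero_iff.mpr fun t _ => hF t
  have q2 : ∏ t ∈ Finset.range d, (((d : ℂ) + 1) * s + ((d + 1) * n + 1 + t : ℕ)) ≠ 0 :=
    Finset.prod_ne_zero_iff.mpr fun t _ => hF _
  have q3 : (n : ℂ) ^ ((d : ℂ) / 2) ≠ 0 := by simp [Complex.cpow_eq_zero_iff, hn']
  have q4 : ((d : ℂ) + 1) ^ (((d : ℂ) + 1) * s) ≠ 0 := by simp [Complex.cpow_eq_zero_iff, hd]
  have q5 : ((((d + 1) * n)! : ℕ) : ℂ) ≠ 0 := by exact_mod_cast (Nat.factorial_pos _).ne'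
  simp only [Complex.GammaSeq, Function.comp, Finset.prod_div_distrib, Finset.prod_mul_distrib,
    Finset.prod_const, Finset.card_range, e1, e2, e3, Complex.cpow_neg]
  push_cast [e4]
  rw [← e5]
  push_cast at q2
  field_simp
  ring

/-- Gauss' multiplication formula for the Gamma function. -/
theorem prod_Gamma_add_div {k : ℕ} (hk : 0 < k) {s : ℂ} (hs : 0 < s.re) :
    ∏ i ∈ Finset.range k, Complex.Gamma (s + i / k) =
      ((2 * Real.pi) ^ (((k : ℝ) - 1) / 2) : ℝ) * (k : ℂ) ^ (1 / 2 - k * s) *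
        Complex.Gamma (k * s) := by
  obtain ⟨d, rfl⟩ := Nat.exists_eq_succ_of_ne_zero hk.ne'
  have hd : (d : ℂ) + 1 ≠ 0 := by exact_mod_cast d.succ_ne_zero
  have h := prod_Gamma_add_div_aux d hs
  have e : ((√((d : ℝ) + 1) : ℝ) : ℂ) = ((d : ℂ) + 1) ^ (1 / 2 : ℂ) := by
    rw [Real.sqrt_eq_rpow, Complex.ofReal_cpow (by positivity)]; push_cast; rfl
  push_cast [e] at h ⊢
  rw [h, sub_eq_add_neg (1 / 2 : ℂ), Complex.cpow_add _ _ hd]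
  simp only [add_sub_cancel_right]
  ring

/-! ### Products over parameter lists -/

/-- `∏_j Γ(1 - a_j + s)` over a parameter list. -/
def gammaProd (L : List ℝ) (s : ℂ) : ℂ :=
  (L.map fun x : ℝ => Complex.Gamma (((1 - x : ℝ) : ℂ) + s)).prod

theorem gammaProd_append (L L' : List ℝ) (s : ℂ) :
    gammaProd (L ++ L') s = gammaProd L s * gammaProd L' s := by
  simp [gammaProd]

theorem prod_map_delta {A : Type*} [CommMonoid A] (f : ℝ → A) (j : ℕ) (x : ℝ) :
    ((delta j x).map f).prod = ∏ i ∈ Finset.range j, f ((x + i) / j) := by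
  rw [delta, List.map_map]; rfl

/-- Since $1-\frac{1-y+i}j=\frac{y+(j-1-i)}j$, the map $x\mapsto1-x$ turns $\Delta(j:1-y)$ into
$\Delta(j:y)$ in reverse order. -/
theorem prod_map_delta_one_sub {A : Type*} [CommMonoid A] (f : ℝ → A) {j : ℕ} (hj : 0 < j)
    (y : ℝ) :
    ((delta j (1 - y)).map fun x => f (1 - x)).prod = ∏ i ∈ Finset.range j, f ((y + i) / j) := by
  rw [prod_map_delta, ← Finset.prod_range_reflect (fun i : ℕ => f ((y + i) / j))]
  refine Finset.prod_congr rfl fun i hi => ?_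
  have hi := Finset.mem_range.mp hi
  have hj' : (j : ℝ) ≠ 0 := by exact_mod_cast hj.ne'
  rw [Nat.cast_sub (by omega), Nat.cast_sub (by omega)]
  congr 1
  field_simp
  push_cast
  ring

/-- This is Gauss' formula at the point $y/j+s$. -/
theorem gammaProd_delta {j : ℕ} (hj : 0 < j) (y : ℝ) {s : ℂ} (hs : 0 < y + j * s.re) :
    gammaProd (delta j (1 - y)) s =
      ((2 * Real.pi) ^ (((j : ℝ) - 1) / 2) : ℝ) * (j : ℂ) ^ (1 / 2 - (y + j * s)) *
        Complex.Gamma (y + j * s) := by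
  have hj' : (j : ℂ) ≠ 0 := by exact_mod_cast hj.ne'
  have hj'' : (0 : ℝ) < j := by exact_mod_cast hj
  rw [gammaProd, prod_map_delta_one_sub (fun x : ℝ => Complex.Gamma ((x : ℂ) + s)) hj]
  have e : (y : ℂ) + j * s = j * (y / j + s) := by field_simp
  rw [e, ← prod_Gamma_add_div hj]
  · refine Finset.prod_congr rfl fun i _ => ?_
    push_cast
    ring_nf
  · have : ((y : ℂ) / j + s).re = (y + j * s.re) / j := by
      have h1 : ((y : ℂ) / j) = ((y / j : ℝ) : ℂ) := by push_cast; rfl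
      rw [h1, Complex.add_re, Complex.ofReal_re]
      field_simp
    rw [this]
    positivity

/-- Gauss' formula twice: with $r$ on each inner list, which leaves Gammas at $\frac{y+i}j+rs$, and
then with $j$ on these. -/
theorem gammaProd_delta₃ {r j : ℕ} (hr : 0 < r) (hj : 0 < j) (y : ℝ) {s : ℂ} (hy : 0 ≤ y)
    (hs : 0 < s.re) :
    gammaProd (delta₃ r j (1 - y)) s =
      ((2 * Real.pi) ^ (((r : ℝ) * j - 1) / 2) : ℝ) * (r : ℂ) ^ (1 / 2 - (y + j * (r * s))) *
        (j : ℂ) ^ (1 / 2 - (y + j * (r * s))) * Complex.Gamma (y + j * (r * s)) := by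
  have hr' : (r : ℂ) ≠ 0 := by exact_mod_cast hr.ne'
  have hj' : (j : ℂ) ≠ 0 := by exact_mod_cast hj.ne'
  have hr'' : (0 : ℝ) < r := by exact_mod_cast hr
  have hj'' : (0 : ℝ) < j := by exact_mod_cast hj
  have h1 : gammaProd (delta₃ r j (1 - y)) s =
      ((delta j (1 - y)).map fun x => gammaProd (delta r (1 - (1 - x))) s).prod := by
    simp only [gammaProd, delta₃, List.map_flatMap, sub_sub_cancel]
    rw [List.flatMap_def, List.prod_flatten, List.map_map]
    rfl
  have h2 := gammaProd_delta hj y (s := r * s) (by simp; positivity)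
  rw [gammaProd, prod_map_delta_one_sub (fun x : ℝ => Complex.Gamma ((x : ℂ) + r * s)) hj] at h2
  rw [h1, prod_map_delta_one_sub (fun x : ℝ => gammaProd (delta r (1 - x)) s) hj]
  have h3 : ∀ i ∈ Finset.range j, gammaProd (delta r (1 - (y + i) / j)) s =
      ((2 * Real.pi) ^ (((r : ℝ) - 1) / 2) : ℝ) * (r : ℂ) ^ (1 / 2 - (((y + i) / j : ℝ) + r * s)) *
        Complex.Gamma (((y + i) / j : ℝ) + r * s) := fun i _ => gammaProd_delta hr _ (by positivity)
  rw [Finset.prod_congr rfl h3, Finset.prod_mul_distrib, h2, Finset.prod_mul_distrib]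
  -- The exponents add up to $\frac j2-y-\frac{j-1}2-jrs=\frac12-y-jrs$.
  have h4 : ∏ i ∈ Finset.range j, (r : ℂ) ^ (1 / 2 - (((y + i) / j : ℝ) + r * s)) =
      (r : ℂ) ^ (1 / 2 - (y + j * (r * s))) := by
    simp_rw [Complex.cpow_def_of_ne_zero hr', ← Complex.exp_sum, ← Finset.mul_sum]
    congr 2
    obtain ⟨d, rfl⟩ := Nat.exists_eq_succ_of_ne_zero hj.ne'
    have h5 := sum_range_div d
    simp only [Finset.sum_sub_distrib, Finset.sum_add_distrib, Finset.sum_const,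
      Finset.card_range, Complex.ofReal_div, Complex.ofReal_add, add_div, nsmul_eq_mul]
    push_cast at hj' ⊢
    rw [h5]
    field_simp
    ring
  rw [h4, Finset.prod_const, Finset.card_range]
  have h6 : (((2 * Real.pi) ^ (((r : ℝ) * j - 1) / 2) : ℝ) : ℂ) =
      ((2 * Real.pi) ^ (((r : ℝ) - 1) / 2) : ℝ) ^ j * ((2 * Real.pi) ^ (((j : ℝ) - 1) / 2) : ℝ) := by
    rw [← Complex.ofReal_pow, ← Complex.ofReal_mul, ← Real.rpow_natCast, ← Real.rpow_mul
      (by positivity), ← Real.rpow_add (by positivity)]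
    congr 2
    ring
  rw [h6]
  ring

theorem length_delta (j : ℕ) (x : ℝ) : (delta j x).length = j := by simp [delta]

theorem length_delta₃ (r j : ℕ) (x : ℝ) : (delta₃ r j x).length = r * j := by
  simp [delta₃, List.length_flatMap, length_delta, mul_comm]

theorem sum_delta {j : ℕ} (hj : 0 < j) (x : ℝ) : (delta j x).sum = x + ((j : ℝ) - 1) / 2 := by
  obtain ⟨d, rfl⟩ := Nat.exists_eq_succ_of_ne_zero hj.ne'
  have h := sum_range_div d
  have h' : ∑ i ∈ Finset.range (d + 1), (i : ℝ) / ((d : ℝ) + 1) = d / 2 := by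
    apply Complex.ofReal_injective; push_cast; exact h
  have h1 : (delta (d + 1) x).sum = ∑ i ∈ Finset.range (d + 1), (x + i) / ((d + 1 : ℕ) : ℝ) := rfl
  have : (d : ℝ) + 1 ≠ 0 := by positivity
  simp only [Nat.succ_eq_add_one, h1, add_div, Finset.sum_add_distrib, Finset.sum_const,
    Finset.card_range, nsmul_eq_mul]
  push_cast
  rw [h']
  field_simp
  ring

/-! ### A Mellin–Barnes integral -/

theorem norm_Gamma_le {s : ℂ} (hs : 0 < s.re) : ‖Complex.Gamma s‖ ≤ Real.Gamma s.re := by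
  rw [Complex.Gamma_eq_integral hs, Complex.GammaIntegral, Real.Gamma_eq_integral hs]
  refine (norm_integral_le_integral_norm _).trans_eq ?_
  refine setIntegral_congr_fun measurableSet_Ioi fun x hx => ?_
  simp only [norm_mul, Complex.norm_real, Real.norm_eq_abs, Real.abs_exp]
  rw [Complex.norm_cpow_eq_rpow_re_of_pos hx]
  simp

/-- Two steps of the functional equation are enough:
$|\Gamma(s)|=|\Gamma(s+2)|/|s(s+1)|\le\Gamma(\sigma+2)/|s|^2$ decays like $1/(1+t^2)$, and the other
Gamma is bounded by its value on the real axis. -/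
theorem integrable_Gamma_mul_Gamma {τ σ : ℝ} (h0 : 0 < σ) (h1 : σ < τ) :
    Integrable fun t : ℝ => Complex.Gamma ((σ : ℂ) + t * Complex.I) *
      Complex.Gamma (τ - ((σ : ℂ) + t * Complex.I)) := by
  have hint : Integrable fun t : ℝ => (Real.Gamma (σ + 2) * Real.Gamma (τ - σ)) *
      (max 1 (σ ^ 2)⁻¹ * (1 + t ^ 2)⁻¹) :=
    (integrable_inv_one_add_sq.const_mul _).const_mul _
  refine hint.mono' ?_ (Filter.Eventually.of_forall fun t => ?_)
  · refine Continuous.aestronglyMeasurable (continuous_iff_continuousAt.mpr fun t => ?_)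
    refine ContinuousAt.mul ?_ ?_
    · refine ContinuousAt.comp (f := fun t : ℝ => (σ : ℂ) + t * Complex.I) (g := Complex.Gamma)
        (Complex.differentiableAt_Gamma _ fun m h => ?_).continuousAt (by fun_prop)
      have := congrArg Complex.re h
      simp at this
      have : (0 : ℝ) ≤ m := m.cast_nonneg
      linarith
    · refine ContinuousAt.comp (f := fun t : ℝ => (τ : ℂ) - ((σ : ℂ) + t * Complex.I))
        (g := Complex.Gamma)
        (Complex.differentiableAt_Gamma _ fun m h => ?_).continuousAt (by fun_prop)
      have := congrArg Complex.re h
      simp at this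
      have : (0 : ℝ) ≤ m := m.cast_nonneg
      linarith
  · set s : ℂ := (σ : ℂ) + t * Complex.I with hs
    have hre : s.re = σ := by simp [hs]
    have him : s.im = t := by simp [hs]
    have hs0 : s ≠ 0 := fun h => by rw [h] at hre; simp at hre; linarith
    have hs1 : s + 1 ≠ 0 := fun h => by
      have := congrArg Complex.re h
      simp [hre] at this
      linarith
    have e : Complex.Gamma (s + 2) = (s + 1) * (s * Complex.Gamma s) := by
      rw [show s + 2 = (s + 1) + 1 by ring, Complex.Gamma_add_one _ hs1, Complex.Gamma_add_one _ hs0]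
    have b1 : ‖Complex.Gamma (s + 2)‖ ≤ Real.Gamma (σ + 2) := by
      simpa [hre] using norm_Gamma_le (s := s + 2) (by simp [hre]; linarith)
    have b2 : ‖Complex.Gamma (τ - s)‖ ≤ Real.Gamma (τ - σ) := by
      simpa [hre] using norm_Gamma_le (s := τ - s) (by simp [hre]; linarith)
    rw [e, norm_mul, norm_mul] at b1
    have c1 : ‖s‖ ≤ ‖s + 1‖ := by
      rw [← sq_le_sq₀ (norm_nonneg _) (norm_nonneg _), Complex.sq_norm, Complex.sq_norm,
        Complex.normSq_apply, Complex.normSq_apply]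
      simp [hre]
      nlinarith
    -- Here $|s|^2=\sigma^2+t^2$; the two arguments of the maximum take care of $t^2$ and of $1$.
    have c2 : 1 + t ^ 2 ≤ max 1 (σ ^ 2)⁻¹ * ‖s‖ ^ 2 := by
      rw [Complex.sq_norm, Complex.normSq_apply, hre, him]
      have m1 := le_max_left 1 (σ ^ 2)⁻¹
      have m2 := le_max_right 1 (σ ^ 2)⁻¹
      have : 1 ≤ max 1 (σ ^ 2)⁻¹ * σ ^ 2 := by
        calc 1 = (σ ^ 2)⁻¹ * σ ^ 2 := (inv_mul_cancel₀ (by positivity)).symm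
          _ ≤ _ := by gcongr
      nlinarith [sq_nonneg t]
    have c3 : ‖Complex.Gamma s‖ ≤ Real.Gamma (σ + 2) * (max 1 (σ ^ 2)⁻¹ * (1 + t ^ 2)⁻¹) := by
      have hG := norm_nonneg (Complex.Gamma s)
      have hm : 0 ≤ max 1 (σ ^ 2)⁻¹ := le_trans zero_le_one (le_max_left _ _)
      rw [← mul_assoc, ← div_eq_mul_inv, le_div_iff₀ (by positivity)]
      calc ‖Complex.Gamma s‖ * (1 + t ^ 2)
          ≤ ‖Complex.Gamma s‖ * (max 1 (σ ^ 2)⁻¹ * (‖s + 1‖ * ‖s‖)) := by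
            gcongr
            refine c2.trans (mul_le_mul_of_nonneg_left ?_ hm)
            rw [sq]
            gcongr
        _ = (‖s + 1‖ * (‖s‖ * ‖Complex.Gamma s‖)) * max 1 (σ ^ 2)⁻¹ := by ring
        _ ≤ _ := by gcongr
    have hg2 := Real.Gamma_pos_of_pos (show 0 < σ + 2 by linarith)
    have hm : 0 ≤ max 1 (σ ^ 2)⁻¹ := le_trans zero_le_one (le_max_left _ _)
    rw [norm_mul]
    calc _ ≤ (Real.Gamma (σ + 2) * (max 1 (σ ^ 2)⁻¹ * (1 + t ^ 2)⁻¹)) * Real.Gamma (τ - σ) := by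
          gcongr
      _ = _ := by ring

theorem integrableOn_rpow_mul_exp_neg_mul {a b : ℝ} (ha : 0 < a) (hb : 0 < b) :
    IntegrableOn (fun x : ℝ => x ^ (a - 1) * Real.exp (-(b * x))) (Set.Ioi 0) := by
  have := integrableOn_rpow_mul_exp_neg_mul_rpow (s := a - 1) (p := 1) (b := b) (by linarith)
    one_pos hb
  simpa using this

/-- Write $\Gamma(\tau)(1+x)^{-\tau}=\int_0^\infty u^{\tau-1}e^{-(1+x)u}\,du$ and exchange the
integrals: the one in $x$ gives $\Gamma(s)u^{-s}$, and the one in $u$ then gives $\Gamma(\tau-s)$.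
-/
theorem mellin_one_add_rpow {τ : ℝ} {s : ℂ} (h0 : 0 < s.re) (h1 : s.re < τ) :
    MellinConvergent (fun x : ℝ => ((Real.Gamma τ * (1 + x) ^ (-τ) : ℝ) : ℂ)) s ∧
    mellin (fun x : ℝ => ((Real.Gamma τ * (1 + x) ^ (-τ) : ℝ) : ℂ)) s =
      Complex.Gamma s * Complex.Gamma (τ - s) := by
  have hτ : 0 < τ := h0.trans h1
  set μ := (volume : Measure ℝ).restrict (Set.Ioi 0) with hμ
  let F : ℝ → ℝ → ℂ := fun x u =>
    (x : ℂ) ^ (s - 1) * ((u ^ (τ - 1) * Real.exp (-((1 + x) * u)) : ℝ) : ℂ)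
  have hx : ∀ᵐ x ∂μ, 0 < x := ae_restrict_mem measurableSet_Ioi
  have hF : ∀ x u : ℝ, F x u = ((u ^ (τ - 1) * Real.exp (-u) : ℝ) : ℂ) *
      ((x : ℂ) ^ (s - 1) * Complex.exp (-(u * x))) := fun x u => by
    simp only [F]
    rw [show -((1 + x) * u) = -u + -(u * x) by ring, Real.exp_add]
    push_cast
    ring
  have hmeas : AEStronglyMeasurable (Function.uncurry F) (μ.prod μ) := by
    apply Measurable.aestronglyMeasurable
    simp only [F, Function.uncurry_def]
    fun_prop
  have hnorm : ∀ u x : ℝ, 0 < u → 0 < x → ‖F x u‖ =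
      u ^ (τ - 1) * Real.exp (-u) * (x ^ (s.re - 1) * Real.exp (-(u * x))) := fun u x hu hx => by
    rw [hF, norm_mul, norm_mul, Complex.norm_cpow_eq_rpow_re_of_pos hx, Complex.norm_exp,
      Complex.norm_real, Real.norm_of_nonneg (by positivity)]
    simp
  have hint : Integrable (Function.uncurry F) (μ.prod μ) := by
    rw [integrable_prod_iff' hmeas]
    constructor
    · filter_upwards [hx] with u hu
      rw [← integrable_norm_iff (by
        apply Measurable.aestronglyMeasurable
        simp only [F, Function.uncurry_def]
        fun_prop)]
      refine (((integrableOn_rpow_mul_exp_neg_mul h0 hu).const_mul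
        (u ^ (τ - 1) * Real.exp (-u)))).congr ?_
      filter_upwards [hx] with x hx
      exact (hnorm u x hu hx).symm
    · refine ((integrableOn_rpow_mul_exp_neg_mul (a := τ - s.re) (b := 1) (by linarith)
        one_pos).const_mul (Real.Gamma s.re)).congr ?_
      filter_upwards [hx] with u hu
      have : ∫ x, ‖Function.uncurry F (x, u)‖ ∂μ =
          ∫ x, u ^ (τ - 1) * Real.exp (-u) * (x ^ (s.re - 1) * Real.exp (-(u * x))) ∂μ := by
        refine integral_congr_ae ?_
        filter_upwards [hx] with x hx
        exact hnorm u x hu hx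
      rw [this, integral_const_mul, hμ, Real.integral_rpow_mul_exp_neg_mul_Ioi h0 hu,
        show τ - s.re - 1 = (τ - 1) + -s.re by ring, Real.rpow_add hu, Real.rpow_neg hu.le,
        one_div, Real.inv_rpow hu.le, one_mul]
      ring
  have hin : ∀ x : ℝ, 0 < x → ∫ u, F x u ∂μ =
      (x : ℂ) ^ (s - 1) • ((Real.Gamma τ * (1 + x) ^ (-τ) : ℝ) : ℂ) := fun x hx => by
    have h2 : (0 : ℝ) < 1 + x := by linarith
    simp only [F]
    rw [integral_const_mul, integral_complex_ofReal, hμ,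
      Real.integral_rpow_mul_exp_neg_mul_Ioi hτ h2, one_div, Real.inv_rpow h2.le,
      ← Real.rpow_neg h2.le, mul_comm (Real.Gamma τ), smul_eq_mul]
  constructor
  · refine hint.integral_prod_left.congr ?_
    filter_upwards [hx] with x hx
    exact hin x hx
  · have e1 : mellin (fun x : ℝ => ((Real.Gamma τ * (1 + x) ^ (-τ) : ℝ) : ℂ)) s =
        ∫ x, ∫ u, F x u ∂μ ∂μ := by
      refine integral_congr_ae ?_
      filter_upwards [hx] with x hx
      exact (hin x hx).symm
    rw [e1, integral_integral_swap hint]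
    have e2 : ∀ u : ℝ, 0 < u → ∫ x, F x u ∂μ =
        Complex.Gamma s * ((u : ℂ) ^ (τ - s - 1) * Complex.exp (-((1 : ℝ) * u))) := fun u hu => by
      have hu' : (u : ℂ) ≠ 0 := by exact_mod_cast hu.ne'
      simp only [hF]
      rw [integral_const_mul, hμ, Complex.integral_cpow_mul_exp_neg_mul_Ioi h0 hu,
        show (τ : ℂ) - s - 1 = (τ - 1) + -s by ring, Complex.cpow_add _ _ hu', Complex.cpow_neg,
        one_div, Complex.inv_cpow _ _ (by rw [Complex.arg_ofReal_of_nonneg hu.le]; exact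
          Real.pi_pos.ne)]
      push_cast [Complex.ofReal_cpow hu.le]
      ring_nf
    have e3 : ∫ u, ∫ x, F x u ∂μ ∂μ = ∫ u, Complex.Gamma s *
        ((u : ℂ) ^ (τ - s - 1) * Complex.exp (-((1 : ℝ) * u))) ∂μ := by
      refine integral_congr_ae ?_
      filter_upwards [hx] with u hu
      exact e2 u hu
    rw [e3, integral_const_mul, hμ,
      Complex.integral_cpow_mul_exp_neg_mul_Ioi (by simpa using h1) one_pos]
    simp

/-- Mellin inversion of `mellin_one_add_rpow` on a line inside the strip $0<\mathrm{Re}\,s<\tau$. -/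
theorem integral_Gamma_mul_Gamma_mul_cpow {τ σ x : ℝ} (h0 : 0 < σ) (h1 : σ < τ) (hx : 0 < x) :
    (1 / (2 * (Real.pi : ℂ))) * ∫ t : ℝ, Complex.Gamma ((σ : ℂ) + t * Complex.I) *
      Complex.Gamma (τ - ((σ : ℂ) + t * Complex.I)) * (x : ℂ) ^ (-((σ : ℂ) + t * Complex.I)) =
    ((Real.Gamma τ * (1 + x) ^ (-τ) : ℝ) : ℂ) := by
  have hm : ∀ t : ℝ, mellin (fun x : ℝ => ((Real.Gamma τ * (1 + x) ^ (-τ) : ℝ) : ℂ))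
      ((σ : ℂ) + t * Complex.I) = _ := fun t =>
    (mellin_one_add_rpow (τ := τ) (s := (σ : ℂ) + t * Complex.I) (by simpa) (by simpa)).2
  have h := mellinInv_mellin_eq σ (fun x : ℝ => ((Real.Gamma τ * (1 + x) ^ (-τ) : ℝ) : ℂ)) hx
    (mellin_one_add_rpow (by simpa) (by simpa)).1 (by
      refine (integrable_Gamma_mul_Gamma h0 h1).congr (Filter.Eventually.of_forall fun t => ?_)
      exact (hm t).symm) (by
      refine Complex.continuous_ofReal.continuousAt.comp (continuousAt_const.mul ?_)
      exact (by fun_prop : ContinuousAt (fun x : ℝ => 1 + x) x).rpow_const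
        (Or.inl (by positivity)))
  rw [← h, mellinInv]
  simp only [hm, Complex.real_smul, smul_eq_mul]
  push_cast
  congr 1
  refine integral_congr_ae (Filter.Eventually.of_forall fun t => ?_)
  simp only
  ring

/-! ### The circularly symmetric complex Gaussian law -/

theorem measurable_mk : Measurable fun x : ℝ × ℝ => (⟨x.1, x.2⟩ : ℂ) :=
  Complex.measurableEquivRealProd.symm.measurable

instance isProbabilityMeasure_complexGaussian (s : ℝ) :
    IsProbabilityMeasure (complexGaussian s) :=
  Measure.isProbabilityMeasure_map measurable_mk.aemeasurable

theorem complexGaussian_eq_withDensity {s : ℝ} (hs : 0 < s) :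
    complexGaussian s = volume.withDensity fun z : ℂ =>
      ENNReal.ofReal ((Real.pi * s)⁻¹ * Real.exp (-(‖z‖ ^ 2 / s))) := by
  have hv : (s / 2).toNNReal ≠ 0 := by simpa using hs
  have hv' : (((s / 2).toNNReal : NNReal) : ℝ) = s / 2 := Real.coe_toNNReal _ (by positivity)
  have hm : Measurable fun z : ℂ =>
      ENNReal.ofReal ((Real.pi * s)⁻¹ * Real.exp (-(‖z‖ ^ 2 / s))) := by fun_prop
  have hmp := Complex.volume_preserving_equiv_real_prod.symm
  ext A hA
  rw [complexGaussian, gaussianReal_of_var_ne_zero _ hv,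
    prod_withDensity (measurable_gaussianPDF _ _) (measurable_gaussianPDF _ _),
    Measure.map_apply measurable_mk hA, withDensity_apply _ (measurable_mk hA),
    withDensity_apply _ hA, ← hmp.setLIntegral_comp_preimage hA hm]
  refine lintegral_congr fun x => ?_
  rw [gaussianPDF, gaussianPDF, ← ENNReal.ofReal_mul (gaussianPDFReal_nonneg _ _ _),
    Complex.measurableEquivRealProd_symm_apply, Complex.sq_norm, Complex.normSq_apply,
    gaussianPDFReal, gaussianPDFReal, hv']
  congr 1
  have e : 2 * Real.pi * (s / 2) = Real.pi * s := by ring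
  have h1 : (√(Real.pi * s))⁻¹ * (√(Real.pi * s))⁻¹ = (Real.pi * s)⁻¹ := by
    rw [← mul_inv, Real.mul_self_sqrt (by positivity)]
  rw [e, mul_mul_mul_comm, h1, ← Real.exp_add]
  congr 2
  field_simp
  ring

/-- Circles are Lebesgue null. This is what makes ties between moduli negligible in the order
statistics. -/
theorem complexGaussian_sphere {s : ℝ} (hs : 0 < s) (t : ℝ) :
    complexGaussian s {w | ‖w‖ = t} = 0 := by
  rw [complexGaussian_eq_withDensity hs]
  refine withDensity_absolutelyContinuous _ _ ?_
  have := Measure.addHaar_sphere (volume : Measure ℂ) 0 t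
  convert! this using 2
  ext w
  simp

theorem complexGaussian_norm_gt {s : ℝ} (hs : 0 < s) {t : ℝ} (ht : 0 ≤ t) :
    complexGaussian s {w | t < ‖w‖} = ENNReal.ofReal (Real.exp (-(t ^ 2 / s))) := by
  have hA : MeasurableSet {w : ℂ | t < ‖w‖} := measurableSet_lt measurable_const measurable_norm
  -- An antiderivative of the radial density in polar coordinates. Its factor $1/(2\pi)$ is
  -- cancelled at the end by the length of the angular interval.
  have hd : ∀ x ∈ Set.Ici t, HasDerivAt (fun x : ℝ => -((2 * Real.pi)⁻¹ * Real.exp (-(x ^ 2 / s))))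
      (x * ((Real.pi * s)⁻¹ * Real.exp (-(x ^ 2 / s)))) x := fun x _ => by
    have h1 : HasDerivAt (fun x : ℝ => -(x ^ 2 / s)) (-(2 * x / s)) x := by
      exact ((hasDerivAt_pow 2 x).div_const s).neg.congr_deriv (by simp)
    convert! (h1.exp.const_mul (2 * Real.pi)⁻¹).neg using 1
    field_simp
  have hlim : Filter.Tendsto (fun x : ℝ => -((2 * Real.pi)⁻¹ * Real.exp (-(x ^ 2 / s))))
      Filter.atTop (nhds (-((2 * Real.pi)⁻¹ * 0))) := by
    refine ((Real.tendsto_exp_neg_atTop_nhds_zero.comp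
      ((Filter.tendsto_pow_atTop two_ne_zero).atTop_div_const hs)).const_mul _).neg
  have hpos : ∀ x ∈ Set.Ioi t, 0 ≤ x * ((Real.pi * s)⁻¹ * Real.exp (-(x ^ 2 / s))) :=
    fun x hx => mul_nonneg (ht.trans (le_of_lt hx)) (by positivity)
  have hI := integral_Ioi_of_hasDerivAt_of_nonneg' hd hpos hlim
  have hInt := integrableOn_Ioi_deriv_of_nonneg' hd hpos hlim
  rw [complexGaussian_eq_withDensity hs, withDensity_apply _ hA, ← lintegral_indicator hA,
    ← Complex.lintegral_comp_polarCoord_symm]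
  let G : ℝ → ENNReal := (Set.Ioi t).indicator fun x : ℝ =>
    ENNReal.ofReal (x * ((Real.pi * s)⁻¹ * Real.exp (-(x ^ 2 / s))))
  have hG : Measurable G := Measurable.indicator (by fun_prop) measurableSet_Ioi
  have e1 : ∀ p ∈ polarCoord.target, ENNReal.ofReal p.1 • {w : ℂ | t < ‖w‖}.indicator
      (fun z => ENNReal.ofReal ((Real.pi * s)⁻¹ * Real.exp (-(‖z‖ ^ 2 / s))))
        (Complex.polarCoord.symm p) = G p.1 * 1 := fun p hp => by
    have hp0 : 0 < p.1 := hp.1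
    by_cases h : t < p.1
    · rw [Set.indicator_of_mem (by
        rw [Set.mem_ofPred_eq, Complex.norm_polarCoord_symm, abs_of_pos hp0]; exact h)]
      simp only [G]
      rw [Set.indicator_of_mem (by exact h), Complex.norm_polarCoord_symm, abs_of_pos hp0,
        ENNReal.ofReal_mul hp0.le, smul_eq_mul, mul_one]
    · rw [Set.indicator_of_notMem (by
        rw [Set.mem_ofPred_eq, Complex.norm_polarCoord_symm, abs_of_pos hp0]; exact h)]
      simp only [G]
      rw [Set.indicator_of_notMem (by exact h)]
      simp
  rw [setLIntegral_congr_fun polarCoord.open_target.measurableSet e1, polarCoord_target,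
    Measure.volume_eq_prod, ← Measure.prod_restrict,
    lintegral_prod_mul hG.aemeasurable aemeasurable_const]
  simp only [G]
  rw [lintegral_indicator measurableSet_Ioi, Measure.restrict_restrict measurableSet_Ioi,
    Set.inter_eq_left.mpr (Set.Ioi_subset_Ioi ht), ← ofReal_integral_eq_lintegral_ofReal hInt
    ((ae_restrict_iff' measurableSet_Ioi).mpr (Filter.Eventually.of_forall hpos)), hI]
  simp only [lintegral_const, Measure.restrict_apply MeasurableSet.univ, Set.univ_inter,
    Real.volume_Ioo, one_mul]
  rw [← ENNReal.ofReal_mul (by simp; positivity)]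
  congr 1
  field_simp
  ring

theorem complexGaussian_norm_ge {s : ℝ} (hs : 0 < s) {t : ℝ} (ht : 0 ≤ t) :
    complexGaussian s {w | t ≤ ‖w‖} = ENNReal.ofReal (Real.exp (-(t ^ 2 / s))) := by
  rw [← complexGaussian_norm_gt hs ht]
  refine measure_congr ?_
  have h0 : ∀ᵐ w ∂complexGaussian s, ‖w‖ ≠ t := by
    rw [ae_iff]; simpa using complexGaussian_sphere hs t
  filter_upwards [h0] with w hw
  exact propext ⟨fun h => lt_of_le_of_ne h (Ne.symm hw), le_of_lt⟩

/-- Exponential tilting of a complex Gaussian law. -/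
theorem lintegral_exp_mul_complexGaussian {s a : ℝ} (hs : 0 < s) (ha : 0 ≤ a) {f : ℂ → ENNReal}
    (hf : Measurable f) :
    ∫⁻ z, ENNReal.ofReal (Real.exp (-(a * (‖z‖ ^ 2 / s)))) * f z ∂complexGaussian s =
      ENNReal.ofReal (1 + a)⁻¹ * ∫⁻ z, f z ∂complexGaussian (s / (1 + a)) := by
  have ha' : 0 < 1 + a := by linarith
  rw [complexGaussian_eq_withDensity hs, complexGaussian_eq_withDensity (div_pos hs ha'),
    lintegral_withDensity_eq_lintegral_mul _ (by fun_prop) (by fun_prop),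
    lintegral_withDensity_eq_lintegral_mul _ (by fun_prop) hf, ← lintegral_const_mul _ (by fun_prop)]
  refine lintegral_congr fun z => ?_
  simp only [Pi.mul_apply]
  rw [← mul_assoc, ← mul_assoc, ← ENNReal.ofReal_mul (by positivity),
    ← ENNReal.ofReal_mul (by positivity), mul_assoc, ← Real.exp_add, ← mul_assoc]
  congr 3
  · field_simp
  · congr 1
    field_simp
    ring

theorem measurePreserving_prodProdProdComm {α β : Type*} [MeasurableSpace α] [MeasurableSpace β]
    (μ : Measure α) (ν : Measure β) [SFinite μ] [SFinite ν] :
    MeasurePreserving (fun p : (α × α) × (β × β) => ((p.1.1, p.2.1), (p.1.2, p.2.2)))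
      ((μ.prod μ).prod (ν.prod ν)) ((μ.prod ν).prod (μ.prod ν)) := by
  have h1 := measurePreserving_prodAssoc μ μ (ν.prod ν)
  have h2 := (measurePreserving_prodAssoc μ ν ν).symm
  have h3 := (Measure.measurePreserving_swap (μ := μ) (ν := ν)).prod (MeasurePreserving.id ν)
  have h4 := measurePreserving_prodAssoc ν μ ν
  have h5 := (measurePreserving_prodAssoc μ ν (μ.prod ν)).symm
  exact h5.comp (((MeasurePreserving.id μ).prod (h4.comp (h3.comp h2))).comp h1)

theorem map_linear_gaussianReal_prod (a b : ℝ) {v w : ℝ} (hv : 0 ≤ v) (hw : 0 ≤ w) :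
    ((gaussianReal 0 v.toNNReal).prod (gaussianReal 0 w.toNNReal)).map
      (fun p : ℝ × ℝ => a * p.1 + b * p.2) =
      gaussianReal 0 (a ^ 2 * v + b ^ 2 * w).toNNReal := by
  have h : (fun p : ℝ × ℝ => a * p.1 + b * p.2) =
      (fun p : ℝ × ℝ => p.1 + p.2) ∘ Prod.map (a * ·) (b * ·) := rfl
  rw [h, ← Measure.map_map (by fun_prop) (by fun_prop),
    ← Measure.map_prod_map _ _ (by fun_prop) (by fun_prop), gaussianReal_map_const_mul,
    gaussianReal_map_const_mul]
  have := gaussianReal_conv_gaussianReal (m₁ := a * 0) (m₂ := b * 0)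
    (v₁ := .mk (a ^ 2) (sq_nonneg _) * v.toNNReal) (v₂ := .mk (b ^ 2) (sq_nonneg _) * w.toNNReal)
  rw [Measure.conv] at this
  rw [this]
  congr 1
  · simp
  · apply NNReal.eq
    rw [Real.coe_toNNReal _ (by positivity)]
    simp [hv, hw]

/-- The coefficients are real, so the real and imaginary parts do not mix: after the four
coordinates are regrouped, each part is a linear combination of two independent real Gaussians. -/
theorem map_linear_complexGaussian_prod (a b : ℝ) {s t : ℝ} (hs : 0 ≤ s) (ht : 0 ≤ t) :
    ((complexGaussian s).prod (complexGaussian t)).map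
      (fun p : ℂ × ℂ => (a : ℂ) * p.1 + (b : ℂ) * p.2) =
      complexGaussian (a ^ 2 * s + b ^ 2 * t) := by
  have hL : Measurable fun p : ℝ × ℝ => a * p.1 + b * p.2 := by fun_prop
  have hv : (a ^ 2 * s + b ^ 2 * t) / 2 = a ^ 2 * (s / 2) + b ^ 2 * (t / 2) := by ring
  rw [complexGaussian, complexGaussian, Measure.map_prod_map _ _ measurable_mk measurable_mk,
    Measure.map_map (by fun_prop) (measurable_mk.prodMap measurable_mk), complexGaussian, hv,
    ← map_linear_gaussianReal_prod a b (by positivity) (by positivity),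
    Measure.map_prod_map _ _ hL hL, Measure.map_map measurable_mk (hL.prodMap hL),
    ← (measurePreserving_prodProdProdComm (gaussianReal 0 (s / 2).toNNReal)
      (gaussianReal 0 (t / 2).toNNReal)).map_eq,
    Measure.map_map (measurable_mk.comp (hL.prodMap hL))
      (measurePreserving_prodProdProdComm (gaussianReal 0 (s / 2).toNNReal)
        (gaussianReal 0 (t / 2).toNNReal)).measurable]
  congr 1
  ext p
  apply Complex.ext <;> simp

/-! ### Order statistics -/

/-- `Tuple.sort` is stable: it orders indices lexicographically by value and then by index. So the
zero-based position of $i$ is the number of indices that precede it in that order. -/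
theorem sort_apply_eq_iff {n : ℕ} (g : Fin n → ℝ) (k i : Fin n) :
    Tuple.sort g k = i ↔
      (Finset.univ.filter fun j => g j < g i ∨ g j = g i ∧ j < i).card = (k : ℕ) := by
  obtain ⟨hm, hl⟩ := Tuple.eq_sort_iff.mp (rfl : Tuple.sort g = Tuple.sort g)
  set σ := Tuple.sort g with hσ
  obtain ⟨b, rfl⟩ := σ.surjective i
  have h1 : ∀ a, (g (σ a) < g (σ b) ∨ g (σ a) = g (σ b) ∧ σ a < σ b) ↔ a < b := fun a => by
    constructor
    · intro h
      by_contra hab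
      have hba := not_lt.mp hab
      have h2 : g (σ b) ≤ g (σ a) := hm hba
      rcases h with h | ⟨h, h'⟩
      · exact absurd h2 (not_le.mpr h)
      · rcases hba.eq_or_lt with e | e
        · rw [e] at h'; exact lt_irrefl _ h'
        · exact lt_asymm h' (hl _ _ e h.symm)
    · intro hab
      have h2 : g (σ a) ≤ g (σ b) := hm hab.le
      rcases h2.eq_or_lt with e | e
      · exact Or.inr ⟨e, hl _ _ hab e⟩
      · exact Or.inl e
  have h2 : (Finset.univ.filter fun j => g j < g (σ b) ∨ g j = g (σ b) ∧ j < σ b) =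
      (Finset.Iio b).map σ.toEmbedding := by
    ext j
    obtain ⟨a, rfl⟩ := σ.surjective j
    simp [h1]
  rw [h2, Finset.card_map, Fin.card_Iio, σ.injective.eq_iff, Fin.ext_iff, eq_comm]

-- The binomial law, by splitting according to the set of successes. The sets `L j` may differ from
-- each other, since tie-breaking in a ranking depends on the index.
open Classical in
theorem pi_card_filter_mem_eq {ι X : Type*} [Fintype ι] [MeasurableSpace X] (μ : Measure X)
    [SigmaFinite μ] (L : ι → Set X) (hL : ∀ j, MeasurableSet (L j)) {x y : ENNReal}
    (hx : ∀ j, μ (L j) = x) (hy : ∀ j, μ (L j)ᶜ = y) (k : ℕ) :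
    Measure.pi (fun _ : ι => μ) {w | (Finset.univ.filter fun j => w j ∈ L j).card = k} =
      (Fintype.card ι).choose k * (x ^ k * y ^ (Fintype.card ι - k)) := by
  let E : Finset ι → Set (ι → X) := fun A => Set.univ.pi fun j => if j ∈ A then L j else (L j)ᶜ
  have hE : ∀ A w, w ∈ E A ↔ (Finset.univ.filter fun j => w j ∈ L j) = A := fun A w => by
    simp only [E, Set.mem_univ_pi, Finset.ext_iff, Finset.mem_filter, Finset.mem_univ, true_and]
    refine forall_congr' fun j => ?_
    by_cases hj : j ∈ A <;> simp [hj]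
  have h1 : {w : ι → X | (Finset.univ.filter fun j => w j ∈ L j).card = k} =
      ⋃ A ∈ Finset.powersetCard k (Finset.univ : Finset ι), E A := by
    ext w
    simp only [Set.mem_iUnion, hE, Finset.mem_powersetCard, Set.mem_ofPred_eq]
    constructor
    · intro h
      exact ⟨_, ⟨Finset.subset_univ _, h⟩, rfl⟩
    · rintro ⟨A, ⟨-, h⟩, rfl⟩
      exact h
  rw [h1, measure_biUnion_finset]
  · have h2 : ∀ A ∈ Finset.powersetCard k (Finset.univ : Finset ι),
        Measure.pi (fun _ : ι => μ) (E A) = x ^ k * y ^ (Fintype.card ι - k) := fun A hA => by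
      have hA := (Finset.mem_powersetCard.mp hA).2
      rw [Measure.pi_pi]
      have : ∀ j, μ (if j ∈ A then L j else (L j)ᶜ) = if j ∈ A then x else y := fun j => by
        split_ifs
        exacts [hx j, hy j]
      simp_rw [this]
      rw [Finset.prod_ite]
      simp only [Finset.prod_const]
      rw [Finset.filter_mem_eq_inter, Finset.univ_inter, hA, Finset.filter_not,
        Finset.filter_mem_eq_inter, Finset.univ_inter, ← Finset.compl_eq_univ_sdiff,
        Finset.card_compl, hA]
    rw [Finset.sum_congr rfl h2, Finset.sum_const, Finset.card_powersetCard, Finset.card_univ,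
      nsmul_eq_mul]
  · intro A _ B _ hAB
    refine Set.disjoint_left.mpr fun w hA hB => hAB ?_
    rw [← (hE A w).mp hA, ← (hE B w).mp hB]
  · intro A _
    refine MeasurableSet.univ_pi fun j => ?_
    split_ifs
    exacts [hL j, (hL j).compl]

/-- The set of tuples in which `i` has rank `k` in increasing order of amplitude. -/
def rankSet {n : ℕ} (k : ℕ) (i : Fin n) : Set (Fin n → ℂ) :=
  {h | (Finset.univ.filter fun j => ‖h j‖ < ‖h i‖ ∨ ‖h j‖ = ‖h i‖ ∧ j < i).card = k}

theorem measurableSet_rankSet {n : ℕ} (k : ℕ) (i : Fin n) : MeasurableSet (rankSet k i) := by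
  have : Measurable fun h : Fin n → ℂ =>
      (Finset.univ.filter fun j => ‖h j‖ < ‖h i‖ ∨ ‖h j‖ = ‖h i‖ ∧ j < i).card := by
    simp_rw [Finset.card_filter]
    refine Finset.measurable_sum _ fun j _ => Measurable.ite ?_ measurable_const measurable_const
    have h1 : MeasurableSet {h : Fin n → ℂ | ‖h j‖ < ‖h i‖} :=
      measurableSet_lt (by fun_prop) (by fun_prop)
    have h2 : MeasurableSet {h : Fin n → ℂ | ‖h j‖ = ‖h i‖} :=
      measurableSet_eq_fun (by fun_prop) (by fun_prop)
    exact h1.union (h2.inter (MeasurableSet.const _))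
  exact this (measurableSet_singleton k)

/-- Exactly one index has rank $k$, so one summand survives. This trades the random index for fixed
coordinates on the sets `rankSet`. -/
theorem comp_sort_eq_sum {n : ℕ} {A : Type*} [AddCommMonoid A] (f : ℂ → A) (k : Fin n)
    (h : Fin n → ℂ) :
    f (h (Tuple.sort (fun i => ‖h i‖) k)) =
      ∑ i, (rankSet (k : ℕ) i).indicator (fun h => f (h i)) h := by
  classical
  have : ∀ i, (rankSet (k : ℕ) i).indicator (fun h => f (h i)) h =
      if Tuple.sort (fun i => ‖h i‖) k = i then f (h i) else 0 := fun i => by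
    rw [Set.indicator_apply]
    exact if_congr (sort_apply_eq_iff (fun i => ‖h i‖) k i).symm rfl rfl
  simp_rw [this]
  simp

theorem measurable_comp_sort {n : ℕ} (k : Fin n) :
    Measurable fun h : Fin n → ℂ => h (Tuple.sort (fun i => ‖h i‖) k) := by
  have : (fun h : Fin n → ℂ => h (Tuple.sort (fun i => ‖h i‖) k)) = fun h =>
      ∑ i, (rankSet (k : ℕ) i).indicator (fun h => h i) h :=
    funext fun h => comp_sort_eq_sum id k h
  rw [this]
  exact Finset.measurable_sum _ fun i _ =>
    (measurable_pi_apply i).indicator (measurableSet_rankSet _ _)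

/-- The density of an order statistic. Every coordinate $i$ contributes equally: with its value $z$
fixed, exactly $k$ of the other $n$ independent coordinates must precede it, and up to a null set
these are the ones of modulus below $|z|$. -/
theorem lintegral_comp_sort {n : ℕ} (k : Fin (n + 1)) (μ : Measure ℂ) [IsProbabilityMeasure μ]
    (hμ : ∀ t : ℝ, μ {w | ‖w‖ = t} = 0) {f : ℂ → ENNReal} (hf : Measurable f) :
    ∫⁻ h, f (h (Tuple.sort (fun i => ‖h i‖) k)) ∂Measure.pi (fun _ : Fin (n + 1) => μ) =
      (n + 1 : ℕ) * (n.choose k * ∫⁻ z, f z *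
        (μ {w | ‖z‖ ≤ ‖w‖}ᶜ ^ (k : ℕ) * μ {w | ‖z‖ ≤ ‖w‖} ^ (n - k)) ∂μ) := by
  classical
  have hne : ∀ t : ℝ, ∀ᵐ w ∂μ, ‖w‖ ≠ t := fun t => by rw [ae_iff]; simpa using hμ t
  have key : ∀ i : Fin (n + 1), ∫⁻ h, (rankSet (k : ℕ) i).indicator (fun h => f (h i)) h
      ∂Measure.pi (fun _ : Fin (n + 1) => μ) = n.choose k * ∫⁻ z, f z *
        (μ {w | ‖z‖ ≤ ‖w‖}ᶜ ^ (k : ℕ) * μ {w | ‖z‖ ≤ ‖w‖} ^ (n - k)) ∂μ := fun i => by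
    have hmp := (measurePreserving_piFinSuccAbove (fun _ : Fin (n + 1) => μ) i).symm
    have hm : Measurable ((rankSet (k : ℕ) i).indicator (fun h : Fin (n + 1) → ℂ => f (h i))) :=
      (hf.comp (measurable_pi_apply i)).indicator (measurableSet_rankSet _ _)
    rw [← hmp.lintegral_comp hm,
      lintegral_prod _ (by exact (hm.comp hmp.measurable).aemeasurable),
      ← lintegral_const_mul' _ _ (ENNReal.natCast_ne_top _)]
    refine lintegral_congr fun z => ?_
    -- The values of coordinate $j$ that put it ahead of $i$. Only the tie clause depends on $j$,
    -- and ties are null.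
    let L : Fin n → Set ℂ := fun j => {w | ‖w‖ < ‖z‖ ∨ ‖w‖ = ‖z‖ ∧ i.succAbove j < i}
    have hLm : ∀ j, MeasurableSet (L j) := fun j => by
      have h1 : MeasurableSet {w : ℂ | ‖w‖ < ‖z‖} := measurableSet_lt (by fun_prop) (by fun_prop)
      have h2 : MeasurableSet {w : ℂ | ‖w‖ = ‖z‖} := measurableSet_eq_fun (by fun_prop) (by fun_prop)
      exact h1.union (h2.inter (MeasurableSet.const _))
    have hL : ∀ j, L j =ᵐ[μ] ({w | ‖z‖ ≤ ‖w‖}ᶜ : Set ℂ) := fun j => by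
      filter_upwards [hne ‖z‖] with w hw
      refine propext ?_
      change (‖w‖ < ‖z‖ ∨ ‖w‖ = ‖z‖ ∧ i.succAbove j < i) ↔ ¬ (‖z‖ ≤ ‖w‖)
      simp [hw]
    have hpt : ∀ w : Fin n → ℂ, (rankSet (k : ℕ) i).indicator (fun h => f (h i))
        ((MeasurableEquiv.piFinSuccAbove (fun _ => ℂ) i).symm (z, w)) =
        {w : Fin n → ℂ | (Finset.univ.filter fun j => w j ∈ L j).card = (k : ℕ)}.indicator
          (fun _ => f z) w := fun w => by
      have e1 : (MeasurableEquiv.piFinSuccAbove (fun _ : Fin (n + 1) => ℂ) i).symm (z, w) =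
        i.insertNth (α := fun _ => ℂ) z w := rfl
      rw [e1, Set.indicator_apply, Set.indicator_apply]
      refine if_congr ?_ (by simp) rfl
      simp only [rankSet, Set.mem_ofPred_eq, L]
      rw [Finset.card_filter, Finset.card_filter, Fin.sum_univ_succAbove _ i]
      simp
    have hset : MeasurableSet
        {w : Fin n → ℂ | (Finset.univ.filter fun j => w j ∈ L j).card = (k : ℕ)} := by
      have : Measurable fun w : Fin n → ℂ => (Finset.univ.filter fun j => w j ∈ L j).card := by
        simp_rw [Finset.card_filter]
        exact Finset.measurable_sum _ fun j _ => Measurable.ite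
          (measurable_pi_apply j (hLm j)) measurable_const measurable_const
      exact this (measurableSet_singleton _)
    have hpi : Measure.pi (fun _ : Fin n => μ)
        {w : Fin n → ℂ | (Finset.univ.filter fun j => w j ∈ L j).card = (k : ℕ)} =
        n.choose k * (μ {w | ‖z‖ ≤ ‖w‖}ᶜ ^ (k : ℕ) * μ {w | ‖z‖ ≤ ‖w‖} ^ (n - k)) := by
      convert! pi_card_filter_mem_eq μ L hLm (fun j => measure_congr (hL j))
        (fun j => by rw [measure_congr (hL j).compl, compl_compl]) k <;> simp
    rw [lintegral_congr hpt, lintegral_indicator_const hset, hpi]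
    ring
  rw [lintegral_congr fun h => comp_sort_eq_sum f k h, lintegral_finsetSum]
  · simp_rw [key]
    simp
  · exact fun i _ => (hf.comp (measurable_pi_apply i)).indicator (measurableSet_rankSet _ _)

/-! ### The signal-to-noise ratio of the selected radio link -/

/-- The combination is complex Gaussian of variance $\frac{\rho
s}{1+a}+(1-\rho)s=\frac{(a(1-\rho)+1)s}{1+a}$, and its squared modulus is exponential. -/
theorem lintegral_complexGaussian_tail {s ρ a t : ℝ} (hs : 0 < s) (hρ : 0 ≤ ρ) (hρ' : ρ ≤ 1)
    (ha : 0 ≤ a) (ht : 0 ≤ t) :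
    ∫⁻ z, complexGaussian s {w | t < ‖(√ρ : ℂ) * z + (√(1 - ρ) : ℂ) * w‖}
      ∂complexGaussian (s / (1 + a)) =
      ENNReal.ofReal (Real.exp (-(t ^ 2 * ((a + 1) / ((a * (1 - ρ) + 1) * s))))) := by
  have hA : MeasurableSet {p : ℂ × ℂ | t < ‖(√ρ : ℂ) * p.1 + (√(1 - ρ) : ℂ) * p.2‖} :=
    measurableSet_lt (by fun_prop) (by fun_prop)
  have hB : MeasurableSet {w : ℂ | t < ‖w‖} := measurableSet_lt (by fun_prop) (by fun_prop)
  have ha' : 0 < 1 + a := by linarith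
  have hρ1 : 0 ≤ 1 - ρ := by linarith
  have hd : 0 < a * (1 - ρ) + 1 := by positivity
  have hV : √ρ ^ 2 * (s / (1 + a)) + √(1 - ρ) ^ 2 * s = (a * (1 - ρ) + 1) * s / (1 + a) := by
    rw [Real.sq_sqrt hρ, Real.sq_sqrt hρ1]
    field_simp
    ring
  have h := Measure.prod_apply (μ := complexGaussian (s / (1 + a))) (ν := complexGaussian s) hA
  have h2 := congrArg (fun μ : Measure ℂ => μ {w : ℂ | t < ‖w‖})
    (map_linear_complexGaussian_prod (√ρ) (√(1 - ρ)) (div_pos hs ha').le hs.le)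
  rw [Measure.map_apply (by fun_prop) hB, hV, complexGaussian_norm_gt (by positivity) ht] at h2
  refine h.symm.trans (h2.trans ?_)
  congr 3
  field_simp
  ring

theorem integral_complexGaussian_tail {s ρ a t : ℝ} (hs : 0 < s) (hρ : 0 ≤ ρ) (hρ' : ρ ≤ 1)
    (ha : 0 ≤ a) (ht : 0 ≤ t) :
    ∫ z, (complexGaussian s).real {w | t < ‖(√ρ : ℂ) * z + (√(1 - ρ) : ℂ) * w‖} *
      Real.exp (-(a * (‖z‖ ^ 2 / s))) ∂complexGaussian s =
      (a + 1)⁻¹ * Real.exp (-(t ^ 2 * ((a + 1) / ((a * (1 - ρ) + 1) * s)))) := by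
  have hA : MeasurableSet {p : ℂ × ℂ | t < ‖(√ρ : ℂ) * p.1 + (√(1 - ρ) : ℂ) * p.2‖} :=
    measurableSet_lt (by fun_prop) (by fun_prop)
  have hf : Measurable fun z : ℂ =>
      complexGaussian s {w | t < ‖(√ρ : ℂ) * z + (√(1 - ρ) : ℂ) * w‖} :=
    measurable_measure_prodMk_left hA
  rw [integral_eq_lintegral_of_nonneg_ae]
  · have e : ∀ z : ℂ, ENNReal.ofReal
        ((complexGaussian s).real {w | t < ‖(√ρ : ℂ) * z + (√(1 - ρ) : ℂ) * w‖} *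
          Real.exp (-(a * (‖z‖ ^ 2 / s)))) = ENNReal.ofReal (Real.exp (-(a * (‖z‖ ^ 2 / s)))) *
          complexGaussian s {w | t < ‖(√ρ : ℂ) * z + (√(1 - ρ) : ℂ) * w‖} := fun z => by
      rw [ENNReal.ofReal_mul measureReal_nonneg, ofReal_measureReal, mul_comm]
    rw [lintegral_congr e, lintegral_exp_mul_complexGaussian hs ha hf,
      lintegral_complexGaussian_tail hs hρ hρ' ha ht, ← ENNReal.ofReal_mul (by positivity),
      ENNReal.toReal_ofReal (by positivity), add_comm 1 a]
  · exact Filter.Eventually.of_forall fun z => mul_nonneg measureReal_nonneg (by positivity)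
  · exact (hf.ennreal_toReal.mul (by fun_prop)).aestronglyMeasurable

/-- With $e=e^{-|z|^2/s}$ the order statistic has weight $(1-e)^ke^{n-k}$. Its binomial expansion
leaves powers $e^{n-k+j}$, each of which is an exponential tilt with $a=n-k+j$. -/
theorem prod_tail_comp_sort_succ {n k : ℕ} (hk : k ≤ n) {s ρ t : ℝ} (hs : 0 < s) (hρ : 0 ≤ ρ)
    (hρ' : ρ ≤ 1) (ht : 0 ≤ t) (i : Fin (n + 1)) (hi : (i : ℕ) = k) :
    ((Measure.pi fun _ : Fin (n + 1) => complexGaussian s).prod (complexGaussian s)).real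
      {p | t < ‖(√ρ : ℂ) * p.1 (Tuple.sort (fun i => ‖p.1 i‖) i) + (√(1 - ρ) : ℂ) * p.2‖} =
    (n + 1) * n.choose k * ∑ j ∈ Finset.range (k + 1), (k.choose j * (-1) ^ j) *
      ((((n : ℝ) - k + j) + 1)⁻¹ * Real.exp (-(t ^ 2 *
        ((((n : ℝ) - k + j) + 1) / ((((n : ℝ) - k + j) * (1 - ρ) + 1) * s))))) := by
  have hA : MeasurableSet {p : ℂ × ℂ | t < ‖(√ρ : ℂ) * p.1 + (√(1 - ρ) : ℂ) * p.2‖} :=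
    measurableSet_lt (by fun_prop) (by fun_prop)
  have hf : Measurable fun z : ℂ =>
      complexGaussian s {w | t < ‖(√ρ : ℂ) * z + (√(1 - ρ) : ℂ) * w‖} :=
    measurable_measure_prodMk_left hA
  have hsel : Measurable fun p : (Fin (n + 1) → ℂ) × ℂ =>
      (p.1 (Tuple.sort (fun i => ‖p.1 i‖) i), p.2) :=
    ((measurable_comp_sort i).comp measurable_fst).prodMk measurable_snd
  have h1 := Measure.prod_apply (μ := Measure.pi fun _ : Fin (n + 1) => complexGaussian s)
    (ν := complexGaussian s) (hsel hA)
  have h2 := lintegral_comp_sort i (complexGaussian s) (complexGaussian_sphere hs) hf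
  refine (congrArg ENNReal.toReal (h1.trans h2)).trans ?_
  let e : ℂ → ℝ := fun z => Real.exp (-(‖z‖ ^ 2 / s))
  have he0 : ∀ z, 0 ≤ e z := fun z => (Real.exp_pos _).le
  have he1 : ∀ z, e z ≤ 1 := fun z => Real.exp_le_one_iff.mpr (neg_nonpos.mpr (by positivity))
  have hem : Measurable e := by fun_prop
  let g : ℂ → ℝ := fun z =>
    (complexGaussian s).real {w | t < ‖(√ρ : ℂ) * z + (√(1 - ρ) : ℂ) * w‖}
  have hgm : Measurable g := hf.ennreal_toReal
  have hg0 : ∀ z, 0 ≤ g z := fun z => measureReal_nonneg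
  have hg1 : ∀ z, g z ≤ 1 := fun z => measureReal_le_one
  have e1 : ∀ z : ℂ, complexGaussian s {w | ‖z‖ ≤ ‖w‖} = ENNReal.ofReal (e z) := fun z =>
    complexGaussian_norm_ge hs (norm_nonneg z)
  have e2 : ∀ z : ℂ, complexGaussian s {w | ‖z‖ ≤ ‖w‖}ᶜ = ENNReal.ofReal (1 - e z) := fun z => by
    rw [prob_compl_eq_one_sub (measurableSet_le (by fun_prop) (by fun_prop)), e1,
      ENNReal.ofReal_sub _ (he0 z), ENNReal.ofReal_one]
  have e3 : ∀ z : ℂ, complexGaussian s {w | t < ‖(√ρ : ℂ) * z + (√(1 - ρ) : ℂ) * w‖} *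
      (complexGaussian s {w | ‖z‖ ≤ ‖w‖}ᶜ ^ (i : ℕ) *
        complexGaussian s {w | ‖z‖ ≤ ‖w‖} ^ (n - i)) =
      ENNReal.ofReal (g z * ((1 - e z) ^ k * e z ^ (n - k))) := fun z => by
    rw [e1, e2, hi, ← ENNReal.ofReal_pow (he0 z), ← ENNReal.ofReal_pow (sub_nonneg.mpr (he1 z)),
      ← ENNReal.ofReal_mul (pow_nonneg (sub_nonneg.mpr (he1 z)) _), ENNReal.ofReal_mul (hg0 z)]
    simp only [g]
    rw [ofReal_measureReal]
  have hbd : ∀ u : ℂ → ℝ, Measurable u → (∀ z, 0 ≤ u z) → (∀ z, u z ≤ 1) →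
      Integrable (fun z => g z * u z) (complexGaussian s) := fun u hu h0 h1 => by
    refine Integrable.of_bound (hgm.mul hu).aestronglyMeasurable 1
      (Filter.Eventually.of_forall fun z => ?_)
    rw [Real.norm_of_nonneg (mul_nonneg (hg0 z) (h0 z))]
    exact mul_le_one₀ (hg1 z) (h0 z) (h1 z)
  have e4 : ∀ z : ℂ, g z * ((1 - e z) ^ k * e z ^ (n - k)) =
      ∑ j ∈ Finset.range (k + 1), (k.choose j * (-1) ^ j) * (g z * e z ^ (n - k + j)) := fun z => by
    rw [sub_eq_add_neg, add_comm, add_pow, Finset.sum_mul, Finset.mul_sum]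
    refine Finset.sum_congr rfl fun j _ => ?_
    rw [neg_pow, one_pow, pow_add]
    ring
  have e5 : ∀ j : ℕ, ∫ z, g z * e z ^ (n - k + j) ∂complexGaussian s =
      ((((n : ℝ) - k + j) + 1)⁻¹ * Real.exp (-(t ^ 2 *
        ((((n : ℝ) - k + j) + 1) / ((((n : ℝ) - k + j) * (1 - ρ) + 1) * s))))) := fun j => by
    have hc : ((n - k + j : ℕ) : ℝ) = (n : ℝ) - k + j := by rw [Nat.cast_add, Nat.cast_sub hk]
    rw [← hc, ← integral_complexGaussian_tail hs hρ hρ' (Nat.cast_nonneg _) ht]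
    refine integral_congr_ae (Filter.Eventually.of_forall fun z => ?_)
    simp only [g, e]
    rw [← Real.exp_nat_mul, mul_neg]
  have h0 : ∀ z, 0 ≤ g z * ((1 - e z) ^ k * e z ^ (n - k)) := fun z => mul_nonneg (hg0 z)
    (mul_nonneg (pow_nonneg (sub_nonneg.mpr (he1 z)) _) (pow_nonneg (he0 z) _))
  rw [lintegral_congr e3, ENNReal.toReal_mul, ENNReal.toReal_mul, ENNReal.toReal_natCast,
    ENNReal.toReal_natCast, ← integral_eq_lintegral_of_nonneg_ae
      (Filter.Eventually.of_forall h0) (by fun_prop : Measurable fun z =>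
        g z * ((1 - e z) ^ k * e z ^ (n - k))).aestronglyMeasurable]
  simp_rw [e4]
  rw [integral_finsetSum _ fun j _ => (hbd _ (by fun_prop) (fun z => pow_nonneg (he0 z) _)
    fun z => pow_le_one₀ (he0 z) (he1 z)).const_mul _]
  simp_rw [integral_const_mul, e5]
  rw [hi]
  push_cast
  ring

/-- The case $N=n+1$, $m=k+1$ of `prod_tail_comp_sort_succ`, with $(n+1)\binom nk=m\binom Nm$. -/
theorem prod_tail_comp_sort {N m : ℕ} (hm : 1 ≤ m) (hmN : m ≤ N) {s ρ t : ℝ} (hs : 0 < s)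
    (hρ : 0 ≤ ρ) (hρ' : ρ ≤ 1) (ht : 0 ≤ t) (i : Fin N) (hi : (i : ℕ) = m - 1) :
    ((Measure.pi fun _ : Fin N => complexGaussian s).prod (complexGaussian s)).real
      {p | t < ‖(√ρ : ℂ) * p.1 (Tuple.sort (fun i => ‖p.1 i‖) i) + (√(1 - ρ) : ℂ) * p.2‖} =
    ∑ j ∈ Finset.range m, m * N.choose m *
      ((m - 1).choose j * ((-1) ^ j / ((N : ℝ) - m + j + 1))) * Real.exp (-(t ^ 2 *
        (((N : ℝ) - m + j + 1) / ((((N : ℝ) - m + j) * (1 - ρ) + 1) * s)))) := by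
  obtain ⟨k, rfl⟩ := Nat.exists_eq_succ_of_ne_zero (by omega : m ≠ 0)
  obtain ⟨n, rfl⟩ := Nat.exists_eq_succ_of_ne_zero (by omega : N ≠ 0)
  rw [prod_tail_comp_sort_succ (k := k) (by omega) hs hρ hρ' ht i hi, Finset.mul_sum]
  refine Finset.sum_congr rfl fun j _ => ?_
  have hc : ((n : ℝ) + 1) * n.choose k = (n + 1).choose (k + 1) * (k + 1) := by
    exact_mod_cast Nat.add_one_mul_choose_eq n k
  have h1 : ((n.succ : ℕ) : ℝ) - (k.succ : ℕ) + j = (n : ℝ) - k + j := by push_cast; ring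
  rw [hc, h1]
  push_cast
  simp only [div_eq_mul_inv]
  ring

namespace Params

variable (S : Params)

theorem measurable_select : Measurable S.select := measurable_comp_sort _

/-- Weight of the `n`-th exponential in the tail of the law of the SNR of the selected link. -/
def weight (n : ℕ) : ℝ :=
  S.m * S.N.choose S.m * ((S.m - 1).choose n * ((-1) ^ n / ((S.N : ℝ) - S.m + n + 1)))

theorem prod_tail_snr {x : ℝ} (hx : 0 ≤ x) :
    ((Measure.pi fun _ : Fin S.N => complexGaussian S.σh2).prod (complexGaussian S.σh2)).real
      {p | x < ‖(√S.ρ : ℂ) * S.select p.1 + (√(1 - S.ρ) : ℂ) * p.2‖ ^ 2 * S.P₁ / S.σ02} =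
    ∑ n ∈ Finset.range S.m, S.weight n * Real.exp (-(S.β n * x)) := by
  have hP := S.P₁_pos
  have h0 := S.σ02_pos
  have hh := S.σh2_pos
  have hset : {p : (Fin S.N → ℂ) × ℂ |
      x < ‖(√S.ρ : ℂ) * S.select p.1 + (√(1 - S.ρ) : ℂ) * p.2‖ ^ 2 * S.P₁ / S.σ02} =
      {p | √(x * S.σ02 / S.P₁) < ‖(√S.ρ : ℂ) * S.select p.1 + (√(1 - S.ρ) : ℂ) * p.2‖} := by
    ext p
    simp only [Set.mem_ofPred_eq]
    have hA : 0 ≤ x * S.σ02 / S.P₁ := by positivity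
    rw [lt_div_iff₀ h0, ← div_lt_iff₀ hP, ← Real.sqrt_lt_sqrt_iff hA, Real.sqrt_sq (norm_nonneg _)]
  rw [hset]
  refine (prod_tail_comp_sort S.one_le_m S.m_le_N S.σh2_pos S.ρ_nonneg S.ρ_le_one
    (Real.sqrt_nonneg _) _ rfl).trans ?_
  refine Finset.sum_congr rfl fun n _ => ?_
  rw [Real.sq_sqrt (by positivity), weight, β, γbar₁]
  congr 3
  field_simp

end Params

/-! ### Moments of the optical link -/

theorem withDensity_ite_pos (d : ℝ → ℝ) :
    (volume.withDensity fun x => ENNReal.ofReal (if 0 < x then d x else 0)) =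
      (volume.restrict (Set.Ioi 0)).withDensity fun x => ENNReal.ofReal (d x) := by
  rw [← withDensity_indicator measurableSet_Ioi]
  congr 1
  ext x
  by_cases hx : 0 < x
  · rw [if_pos hx, Set.indicator_of_mem (by exact hx)]
  · rw [if_neg hx, Set.indicator_of_notMem (by exact hx), ENNReal.ofReal_zero]

theorem integral_withDensity_ite_pos {d : ℝ → ℝ} (hd : Measurable d) (hd0 : ∀ x, 0 < x → 0 ≤ d x)
    (f : ℝ → ℂ) :
    (∫ x, f x ∂(volume.withDensity fun x => ENNReal.ofReal (if 0 < x then d x else 0)) =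
      ∫ x in Set.Ioi 0, (d x : ℂ) * f x) ∧
    (Integrable f (volume.withDensity fun x => ENNReal.ofReal (if 0 < x then d x else 0)) ↔
      IntegrableOn (fun x => (d x : ℂ) * f x) (Set.Ioi 0)) := by
  have h : ∀ x ∈ Set.Ioi (0 : ℝ), (ENNReal.ofReal (d x)).toReal • f x = (d x : ℂ) * f x :=
    fun x hx => by rw [ENNReal.toReal_ofReal (hd0 x hx), Complex.real_smul]
  rw [withDensity_ite_pos]
  constructor
  · rw [integral_withDensity_eq_integral_toReal_smul (by fun_prop)
      (Filter.Eventually.of_forall fun x => ENNReal.ofReal_lt_top)]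
    exact setIntegral_congr_fun measurableSet_Ioi h
  · rw [integrable_withDensity_iff_integrable_smul' (by fun_prop)
      (Filter.Eventually.of_forall fun x => ENNReal.ofReal_lt_top)]
    exact integrableOn_congr_fun h measurableSet_Ioi

theorem ae_pos_withDensity_ite_pos (d : ℝ → ℝ) :
    ∀ᵐ x ∂(volume.withDensity fun x => ENNReal.ofReal (if 0 < x then d x else 0)), 0 < x := by
  rw [withDensity_ite_pos]
  exact (withDensity_absolutelyContinuous _ _).ae_le (ae_restrict_mem measurableSet_Ioi)

/-- An infinite measure is excluded because its total mass has real part $0$ under `ENNReal.toReal`.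
It lets the moment of order $0$ show that a law is normalized. -/
theorem isProbabilityMeasure_of_integral_one {X : Type*} [MeasurableSpace X] {μ : Measure X}
    (h : ∫ _, (1 : ℂ) ∂μ = 1) : IsProbabilityMeasure μ := by
  rw [integral_const, Complex.real_smul, mul_one] at h
  exact ⟨(ENNReal.toReal_eq_one_iff _).mp (by exact_mod_cast h)⟩

section genGamma

variable {α m Ω : ℝ} (hα : 0 < α) (hm : 0 < m) (hΩ : 0 < Ω)
include hα hm hΩ

/-- The substitution $y=x^\alpha$ turns the moment into a Gamma integral at $m+s/\alpha$ with rate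
$m/\Omega$; the normalization then cancels $(\Omega/m)^m$ and the Jacobian $1/\alpha$. -/
theorem integral_cpow_genGamma {s : ℂ} (hs : 0 ≤ s.re) :
    Integrable (fun x : ℝ => (x : ℂ) ^ s) (genGamma α m Ω) ∧
    ∫ x, (x : ℂ) ^ s ∂genGamma α m Ω =
      ((Ω / m : ℝ) : ℂ) ^ (s / α) * (Complex.Gamma (m + s / α) / Real.Gamma m) := by
  have hb : 0 < m / Ω := div_pos hm hΩ
  have hG := Real.Gamma_pos_of_pos hm
  set d : ℝ → ℝ := fun x =>
    α * (m / Ω) ^ m / Real.Gamma m * x ^ (α * m - 1) * Real.exp (-(m / Ω) * x ^ α) with hd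
  have hdm : Measurable d := by fun_prop
  obtain ⟨h1, h2⟩ := integral_withDensity_ite_pos hdm
    (fun x hx => by simp only [hd]; positivity) (fun x : ℝ => (x : ℂ) ^ s)
  have hre : 0 < α * m + s.re := by positivity
  have hα' : (α : ℂ) ≠ 0 := by exact_mod_cast hα.ne'
  have hval : ∀ x ∈ Set.Ioi (0 : ℝ), (d x : ℂ) * (x : ℂ) ^ s =
      ((α * (m / Ω) ^ m / Real.Gamma m : ℝ) : ℂ) *
        ((x : ℂ) ^ ((α * m + s : ℂ) - 1) • (fun y : ℝ => Complex.exp (-((m / Ω : ℝ) * y : ℂ))) (x ^ α)) :=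
    fun x hx => by
    have hx' : (x : ℂ) ≠ 0 := by exact_mod_cast (ne_of_gt hx)
    have e1 : ((x ^ (α * m - 1) : ℝ) : ℂ) = (x : ℂ) ^ ((α * m : ℂ) - 1) := by
      rw [Complex.ofReal_cpow (le_of_lt hx)]
      push_cast
      rfl
    simp only [hd]
    rw [show (α * m + s : ℂ) - 1 = ((α * m : ℂ) - 1) + s by ring, Complex.cpow_add _ _ hx',
      Complex.ofReal_mul, Complex.ofReal_mul, e1, Complex.ofReal_exp, smul_eq_mul]
    push_cast
    ring_nf
  constructor
  · refine h2.mpr ?_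
    have hr := (integrableOn_rpow_mul_exp_neg_mul_rpow (p := α) (s := α * m + s.re - 1)
      (b := m / Ω) (by linarith) hα hb).const_mul (α * (m / Ω) ^ m / Real.Gamma m)
    refine hr.mono' (Measurable.aestronglyMeasurable (by fun_prop)) ?_
    filter_upwards [ae_restrict_mem measurableSet_Ioi] with x hx
    rw [norm_mul, Complex.norm_real, Complex.norm_cpow_eq_rpow_re_of_pos hx,
      Real.norm_of_nonneg (by
        have hx : 0 < x := hx
        simp only [hd]; positivity),
      show α * m + s.re - 1 = (α * m - 1) + s.re by ring, Real.rpow_add hx]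
    simp only [hd]
    exact le_of_eq (by ring)
  · refine h1.trans ?_
    rw [setIntegral_congr_fun measurableSet_Ioi hval, integral_const_mul]
    have h3 := mellin_comp_rpow (fun y : ℝ => Complex.exp (-((m / Ω : ℝ) * y : ℂ)))
      (α * m + s : ℂ) α
    have h4 : ((α * m + s : ℂ) / α) = m + s / α := by field_simp
    have h5 : 0 < ((m : ℂ) + s / α).re := by
      rw [Complex.add_re, Complex.ofReal_re, Complex.div_ofReal_re]; positivity
    rw [mellin, h4, mellin] at h3
    simp only [smul_eq_mul] at h3 ⊢
    rw [h3, Complex.integral_cpow_mul_exp_neg_mul_Ioi h5 hb, abs_of_pos hα, Complex.real_smul]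
    have h6 : (1 / ((m / Ω : ℝ) : ℂ)) = ((Ω / m : ℝ) : ℂ) := by
      push_cast; rw [one_div_div]
    have h7 : ((Ω / m : ℝ) : ℂ) ≠ 0 := by exact_mod_cast (div_pos hΩ hm).ne'
    have h8 : (((m / Ω) ^ m : ℝ) : ℂ) * ((Ω / m : ℝ) : ℂ) ^ (m : ℂ) = 1 := by
      rw [← Complex.ofReal_cpow (div_pos hΩ hm).le, ← Complex.ofReal_mul,
        ← Real.mul_rpow hb.le (div_pos hΩ hm).le]
      rw [show m / Ω * (Ω / m) = 1 by field_simp, Real.one_rpow, Complex.ofReal_one]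
    rw [h6, Complex.cpow_add _ _ h7, Complex.ofReal_div, Complex.ofReal_mul]
    have h9 : (Real.Gamma m : ℂ) ≠ 0 := by exact_mod_cast hG.ne'
    calc _ = ((((m / Ω) ^ m : ℝ) : ℂ) * ((Ω / m : ℝ) : ℂ) ^ (m : ℂ)) * ((α : ℂ) * (α⁻¹ : ℝ)) *
          (((Ω / m : ℝ) : ℂ) ^ (s / α) * (Complex.Gamma (m + s / α) / Real.Gamma m)) := by ring
      _ = _ := by
        rw [h8, Complex.ofReal_inv, mul_inv_cancel₀ hα']
        ring

theorem isProbabilityMeasure_genGamma : IsProbabilityMeasure (genGamma α m Ω) := by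
  refine isProbabilityMeasure_of_integral_one ?_
  have h := (integral_cpow_genGamma hα hm hΩ (s := 0) le_rfl).2
  have hG : (Real.Gamma m : ℂ) ≠ 0 := by exact_mod_cast (Real.Gamma_pos_of_pos hm).ne'
  simpa [Complex.Gamma_ofReal, hG, div_self] using h

end genGamma

/-- The two exponents combine to $-bx^2$ with $b=\frac1{2\sigma^2}+\frac{2s}{w^2}$, and
$\int_0^\infty xe^{-bx^2}dx=\frac1{2b}$. -/
theorem integral_cexp_rayleigh {σ w : ℝ} (hσ : 0 < σ) (hw : 0 < w) {s : ℂ} (hs : 0 ≤ s.re) :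
    Integrable (fun x : ℝ => ((Real.exp (-2 * x ^ 2 / w ^ 2) : ℝ) : ℂ) ^ s) (rayleigh σ) ∧
    ∫ x, ((Real.exp (-2 * x ^ 2 / w ^ 2) : ℝ) : ℂ) ^ s ∂rayleigh σ =
      ((w / (2 * σ)) ^ 2 : ℝ) / (((w / (2 * σ)) ^ 2 : ℝ) + s) := by
  set d : ℝ → ℝ := fun x => x / σ ^ 2 * Real.exp (-x ^ 2 / (2 * σ ^ 2)) with hd
  have hdm : Measurable d := by fun_prop
  obtain ⟨h1, h2⟩ := integral_withDensity_ite_pos hdm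
    (fun x hx => by simp only [hd]; positivity)
    (fun x : ℝ => ((Real.exp (-2 * x ^ 2 / w ^ 2) : ℝ) : ℂ) ^ s)
  set b : ℂ := ((1 / (2 * σ ^ 2) : ℝ) : ℂ) + ((2 / w ^ 2 : ℝ) : ℂ) * s with hb
  have hbre : 0 < b.re := by
    rw [hb, Complex.add_re, Complex.re_ofReal_mul, Complex.ofReal_re]
    positivity
  have hval : ∀ x ∈ Set.Ioi (0 : ℝ),
      (d x : ℂ) * ((Real.exp (-2 * x ^ 2 / w ^ 2) : ℝ) : ℂ) ^ s =
      ((σ ^ 2 : ℝ) : ℂ)⁻¹ * ((x : ℂ) * Complex.exp (-b * (x : ℂ) ^ 2)) := fun x _ => by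
    have e1 : ((Real.exp (-2 * x ^ 2 / w ^ 2) : ℝ) : ℂ) ^ s =
        Complex.exp (((-2 * x ^ 2 / w ^ 2 : ℝ) : ℂ) * s) := by
      rw [Complex.cpow_def_of_ne_zero (by exact_mod_cast (Real.exp_pos _).ne'),
        ← Complex.ofReal_log (Real.exp_pos _).le, Real.log_exp]
    rw [e1]
    simp only [hd]
    rw [Complex.ofReal_mul, Complex.ofReal_exp, mul_assoc, ← Complex.exp_add, Complex.ofReal_div]
    have e2 : ((-x ^ 2 / (2 * σ ^ 2) : ℝ) : ℂ) + ((-2 * x ^ 2 / w ^ 2 : ℝ) : ℂ) * s =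
        -b * (x : ℂ) ^ 2 := by
      rw [hb]; push_cast; ring
    rw [e2]
    ring
  constructor
  · refine h2.mpr ((integrableOn_congr_fun hval measurableSet_Ioi).mpr ?_)
    exact ((integrable_mul_cexp_neg_mul_sq hbre).const_mul _).integrableOn
  · refine h1.trans ?_
    rw [setIntegral_congr_fun measurableSet_Ioi hval, integral_const_mul,
      integral_mul_cexp_neg_mul_sq hbre]
    have hσ' : (σ : ℂ) ≠ 0 := by exact_mod_cast hσ.ne'
    have hw' : (w : ℂ) ≠ 0 := by exact_mod_cast hw.ne'
    have hb0 : b ≠ 0 := fun h => by rw [h] at hbre; simp at hbre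
    have hk0 : (((w / (2 * σ)) ^ 2 : ℝ) : ℂ) + s ≠ 0 := fun h => by
      have := congrArg Complex.re h
      rw [Complex.add_re, Complex.ofReal_re, Complex.zero_re] at this
      have : 0 < (w / (2 * σ)) ^ 2 := by positivity
      linarith
    rw [eq_div_iff hk0, ← mul_inv, inv_mul_eq_iff_eq_mul₀ (by simp [hb0, hσ'])]
    rw [hb]
    push_cast
    field_simp

theorem isProbabilityMeasure_rayleigh {σ : ℝ} (hσ : 0 < σ) :
    IsProbabilityMeasure (rayleigh σ) := by
  refine isProbabilityMeasure_of_integral_one ?_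
  have h := (integral_cexp_rayleigh hσ hσ (s := 0) le_rfl).2
  have h0 : (((σ / (2 * σ)) ^ 2 : ℝ) : ℂ) ≠ 0 := by
    exact_mod_cast (show (σ / (2 * σ)) ^ 2 ≠ 0 by positivity)
  rw [add_zero, div_self h0] at h
  simpa using h

namespace Params

variable (S : Params)

/-- The joint law of the turbulence factors and of the radial displacement. -/
def fsoLaw : Measure (ℝ × ℝ × ℝ) :=
  (genGamma S.α₁ S.m₁ S.Ω₁).prod ((genGamma S.α₂ S.m₂ S.Ω₂).prod (rayleigh S.σs))

instance : IsProbabilityMeasure (genGamma S.α₁ S.m₁ S.Ω₁) :=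
  isProbabilityMeasure_genGamma S.α₁_pos S.m₁_pos S.Ω₁_pos

instance : IsProbabilityMeasure (genGamma S.α₂ S.m₂ S.Ω₂) :=
  isProbabilityMeasure_genGamma S.α₂_pos S.m₂_pos S.Ω₂_pos

instance : IsProbabilityMeasure (rayleigh S.σs) := isProbabilityMeasure_rayleigh S.σs_pos

instance : IsProbabilityMeasure S.fsoLaw := by
  unfold fsoLaw
  infer_instance

/-- The optical channel gain as a function of `(I_x, I_y, R)`. -/
def fsoGain (y : ℝ × ℝ × ℝ) : ℝ :=
  y.1 * y.2.1 * S.Il * (S.A₀ * Real.exp (-2 * y.2.2 ^ 2 / S.ωzeq ^ 2))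

/-- The SNR of the optical link as a function of `(I_x, I_y, R)`. -/
def fsoSnr (y : ℝ × ℝ × ℝ) : ℝ := (S.η * S.fsoGain y) ^ S.r / S.σ02

theorem measurable_fsoGain : Measurable S.fsoGain := by unfold fsoGain; fun_prop

theorem measurable_fsoSnr : Measurable S.fsoSnr := by
  have := S.measurable_fsoGain
  unfold fsoSnr; fun_prop

theorem ae_pos_fsoLaw : ∀ᵐ y ∂S.fsoLaw, 0 < y.1 ∧ 0 < y.2.1 := by
  have h1 : ∀ᵐ x ∂genGamma S.α₁ S.m₁ S.Ω₁, 0 < x := ae_pos_withDensity_ite_pos _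
  have h2 : ∀ᵐ x ∂genGamma S.α₂ S.m₂ S.Ω₂, 0 < x := ae_pos_withDensity_ite_pos _
  have h3 : ∀ᵐ y ∂S.fsoLaw, 0 < y.1 := Measure.quasiMeasurePreserving_fst.ae h1
  have h4 : ∀ᵐ y ∂S.fsoLaw, 0 < y.2.1 :=
    (Measure.quasiMeasurePreserving_fst.comp Measure.quasiMeasurePreserving_snd).ae h2
  exact h3.and h4

theorem Il_pos : 0 < S.Il := Real.exp_pos _

theorem ae_fsoGain_pos : ∀ᵐ y ∂S.fsoLaw, 0 < S.fsoGain y := by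
  filter_upwards [S.ae_pos_fsoLaw] with y hy
  have := S.Il_pos
  have := S.A₀_pos
  have h1 := hy.1
  have h2 := hy.2
  unfold fsoGain
  positivity

theorem ae_fsoSnr_pos : ∀ᵐ y ∂S.fsoLaw, 0 < S.fsoSnr y := by
  filter_upwards [S.ae_fsoGain_pos] with y hy
  have := S.η_pos
  have := S.σ02_pos
  unfold fsoSnr
  positivity

/-- Independence factors the moment. The complex power of the product splits because all factors are
almost surely positive. -/
theorem integral_cpow_fsoGain {s : ℂ} (hs : 0 ≤ s.re) :
    Integrable (fun y => (S.fsoGain y : ℂ) ^ s) S.fsoLaw ∧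
    ∫ y, (S.fsoGain y : ℂ) ^ s ∂S.fsoLaw =
      ((S.A₀ * S.Il : ℝ) : ℂ) ^ s *
      ((((S.Ω₁ / S.m₁ : ℝ) : ℂ) ^ (s / S.α₁) *
        (Complex.Gamma (S.m₁ + s / S.α₁) / Real.Gamma S.m₁)) *
      ((((S.Ω₂ / S.m₂ : ℝ) : ℂ) ^ (s / S.α₂) *
        (Complex.Gamma (S.m₂ + s / S.α₂) / Real.Gamma S.m₂)) *
      ((S.ξ ^ 2 : ℝ) / ((S.ξ ^ 2 : ℝ) + s)))) := by
  obtain ⟨i1, v1⟩ := integral_cpow_genGamma S.α₁_pos S.m₁_pos S.Ω₁_pos hs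
  obtain ⟨i2, v2⟩ := integral_cpow_genGamma S.α₂_pos S.m₂_pos S.Ω₂_pos hs
  obtain ⟨i3, v3⟩ := integral_cexp_rayleigh S.σs_pos S.ωzeq_pos hs
  have hA : 0 < S.A₀ * S.Il := mul_pos S.A₀_pos S.Il_pos
  have hval : ∀ᵐ y ∂S.fsoLaw, (S.fsoGain y : ℂ) ^ s = ((S.A₀ * S.Il : ℝ) : ℂ) ^ s *
      ((y.1 : ℂ) ^ s * ((y.2.1 : ℂ) ^ s *
        ((Real.exp (-2 * y.2.2 ^ 2 / S.ωzeq ^ 2) : ℝ) : ℂ) ^ s)) := by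
    filter_upwards [S.ae_pos_fsoLaw] with y hy
    have h1 := hy.1
    have h2 := hy.2
    rw [← Complex.mul_cpow_ofReal_nonneg h2.le (Real.exp_pos _).le, ← Complex.ofReal_mul,
      ← Complex.mul_cpow_ofReal_nonneg h1.le (by positivity), ← Complex.ofReal_mul,
      ← Complex.mul_cpow_ofReal_nonneg hA.le (by positivity), ← Complex.ofReal_mul, fsoGain]
    congr 2
    ring
  have i23 := i2.mul_prod i3
  have i123 := i1.mul_prod i23
  constructor
  · exact (i123.const_mul _).congr (hval.mono fun y hy => hy.symm)
  · rw [integral_congr_ae hval, integral_const_mul]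
    congr 1
    have e1 := integral_prod_mul (μ := genGamma S.α₁ S.m₁ S.Ω₁)
      (ν := (genGamma S.α₂ S.m₂ S.Ω₂).prod (rayleigh S.σs)) (fun x : ℝ => (x : ℂ) ^ s)
      (fun y : ℝ × ℝ => (y.1 : ℂ) ^ s * ((Real.exp (-2 * y.2 ^ 2 / S.ωzeq ^ 2) : ℝ) : ℂ) ^ s)
    have e2 := integral_prod_mul (μ := genGamma S.α₂ S.m₂ S.Ω₂)
      (ν := rayleigh S.σs) (fun x : ℝ => (x : ℂ) ^ s)
      (fun x : ℝ => ((Real.exp (-2 * x ^ 2 / S.ωzeq ^ 2) : ℝ) : ℂ) ^ s)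
    rw [v2, v3] at e2
    rw [e2, v1] at e1
    exact e1

theorem integral_fsoGain_pos : 0 < ∫ y, S.fsoGain y ∂S.fsoLaw := by
  have h := (S.integral_cpow_fsoGain (s := 1) (by simp)).1
  simp only [Complex.cpow_one] at h
  have hi : Integrable S.fsoGain S.fsoLaw := h.re
  rw [integral_pos_iff_support_of_nonneg_ae (S.ae_fsoGain_pos.mono fun y hy => hy.le) hi]
  have : ∀ᵐ y ∂S.fsoLaw, y ∈ Function.support S.fsoGain :=
    S.ae_fsoGain_pos.mono fun y hy => hy.ne'
  have h1 : Function.support S.fsoGain =ᵐ[S.fsoLaw] Set.univ := Filter.eventuallyEq_univ.mpr this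
  rw [measure_congr h1]
  simp

/-- Scale of the complex moments of the optical SNR. -/
theorem cpow_fsoSnr {y : ℝ × ℝ × ℝ} (hy : 0 < S.fsoGain y) (s : ℂ) :
    (S.fsoSnr y : ℂ) ^ s =
      ((S.η ^ S.r / S.σ02 : ℝ) : ℂ) ^ s * (S.fsoGain y : ℂ) ^ (S.r * s) := by
  have h1 := S.η_pos
  have h2 := S.σ02_pos
  have e : S.fsoSnr y = (S.η ^ S.r / S.σ02) * S.fsoGain y ^ S.r := by
    unfold fsoSnr; ring
  rw [e, Complex.ofReal_mul, Complex.mul_cpow_ofReal_nonneg (by positivity) (by positivity)]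
  congr 1
  have h3 : (S.fsoGain y : ℂ) ≠ 0 := by exact_mod_cast hy.ne'
  have h4 : ((S.fsoGain y ^ S.r : ℝ) : ℂ) ≠ 0 := by exact_mod_cast (pow_pos hy _).ne'
  rw [Complex.cpow_def_of_ne_zero h3, Complex.cpow_def_of_ne_zero h4,
    ← Complex.ofReal_log hy.le, ← Complex.ofReal_log (pow_pos hy _).le, Real.log_pow]
  push_cast
  ring_nf

theorem integral_cpow_fsoSnr {s : ℂ} (hs : 0 ≤ s.re) :
    Integrable (fun y => (S.fsoSnr y : ℂ) ^ s) S.fsoLaw ∧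
    ∫ y, (S.fsoSnr y : ℂ) ^ s ∂S.fsoLaw = ((S.η ^ S.r / S.σ02 : ℝ) : ℂ) ^ s *
      ∫ y, (S.fsoGain y : ℂ) ^ (S.r * s) ∂S.fsoLaw := by
  have h : ∀ᵐ y ∂S.fsoLaw, (S.fsoSnr y : ℂ) ^ s =
      ((S.η ^ S.r / S.σ02 : ℝ) : ℂ) ^ s * (S.fsoGain y : ℂ) ^ (S.r * s) := by
    filter_upwards [S.ae_fsoGain_pos] with y hy
    exact S.cpow_fsoSnr hy s
  have hi := (S.integral_cpow_fsoGain (s := S.r * s) (by simp; positivity)).1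
  refine ⟨(hi.const_mul _).congr (h.mono fun y hy => hy.symm), ?_⟩
  rw [integral_congr_ae h, integral_const_mul]

end Params

/-! ### Integrals against probability measures -/

theorem integrableOn_rpow_mul_exp_neg {a b : ℝ} (ha : 0 < a) (hb : 0 < b) :
    IntegrableOn (fun x : ℝ => x ^ (a - 1) * Real.exp (-b * x)) (Set.Ioi 0) := by
  simpa only [neg_mul] using integrableOn_rpow_mul_exp_neg_mul ha hb

theorem integral_rpow_mul_exp_neg {a b : ℝ} (ha : 0 < a) (hb : 0 < b) :
    ∫ x in Set.Ioi (0 : ℝ), x ^ (a - 1) * Real.exp (-b * x) = b ^ (-a) * Real.Gamma a := by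
  have := Real.integral_rpow_mul_exp_neg_mul_Ioi ha hb
  simp only [neg_mul]
  rw [this, one_div, Real.inv_rpow hb.le, Real.rpow_neg hb.le]

theorem upperGamma_mul {τ q x : ℝ} (hq : 0 < q) (hx : 0 ≤ x) :
    upperGamma τ (q * x) =
      q ^ τ * ∫ t in Set.Ioi x, t ^ (τ - 1) * Real.exp (-q * t) := by
  have h := integral_comp_mul_left_Ioi (fun t : ℝ => t ^ (τ - 1) * Real.exp (-t)) x hq
  have e : ∫ t in Set.Ioi x, (q * t) ^ (τ - 1) * Real.exp (-(q * t)) =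
      q ^ (τ - 1) * ∫ t in Set.Ioi x, t ^ (τ - 1) * Real.exp (-q * t) := by
    rw [← integral_const_mul]
    refine setIntegral_congr_fun measurableSet_Ioi fun t ht => ?_
    rw [Real.mul_rpow hq.le (hx.trans (le_of_lt ht)), neg_mul, mul_assoc]
  simp only [smul_eq_mul] at h
  have e2 : q ^ τ = q * q ^ (τ - 1) := by
    rw [Real.rpow_sub_one hq.ne']; field_simp
  rw [upperGamma, e2, mul_assoc, ← e, h, mul_inv_cancel_left₀ hq.ne']

theorem integrableOn_mul_cdf {τ q : ℝ} (hτ : 0 < τ) (hq : 0 < q) (Q : Measure ℝ) :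
    IntegrableOn (fun γ : ℝ => γ ^ (τ - 1) * Real.exp (-q * γ) * cdf Q γ) (Set.Ioi 0) := by
  refine (integrableOn_rpow_mul_exp_neg hτ hq).mono'
    ((by fun_prop : Measurable fun x : ℝ => x ^ (τ - 1) * Real.exp (-q * x)).mul
      (monotone_cdf Q).measurable).aestronglyMeasurable ?_
  filter_upwards [ae_restrict_mem measurableSet_Ioi] with x hx
  have hx : 0 < x := hx
  rw [Real.norm_of_nonneg (mul_nonneg (by positivity) (cdf_nonneg Q x))]
  exact mul_le_of_le_one_right (by positivity) (cdf_le_one Q x)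

/-- After rescaling, $\Gamma(\tau,qx)$ is $q^\tau$ times an integral over $\gamma>x$. Exchanging the
integrals leaves, for each $\gamma$, the mass of $\{x\le\gamma\}$. -/
theorem integral_upperGamma {τ q : ℝ} (hτ : 0 < τ) (hq : 0 < q) (Q : Measure ℝ)
    [IsProbabilityMeasure Q] (hQ : ∀ᵐ x ∂Q, 0 ≤ x) :
    ∫ x, upperGamma τ (q * x) ∂Q =
      q ^ τ * ∫ γ in Set.Ioi (0 : ℝ), γ ^ (τ - 1) * Real.exp (-q * γ) * cdf Q γ := by
  set g : ℝ → ℝ := fun γ => γ ^ (τ - 1) * Real.exp (-q * γ) with hg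
  have hgi : IntegrableOn g (Set.Ioi 0) := integrableOn_rpow_mul_exp_neg hτ hq
  have hgm : Measurable g := by fun_prop
  let F : ℝ → ℝ → ℝ := fun x γ => {p : ℝ × ℝ | p.1 ≤ p.2}.indicator (fun p => g p.2) (x, γ)
  have hS : MeasurableSet {p : ℝ × ℝ | p.1 ≤ p.2} := measurableSet_le measurable_fst measurable_snd
  have hF : Integrable (Function.uncurry F) (Q.prod (volume.restrict (Set.Ioi 0))) := by
    have : Integrable (fun p : ℝ × ℝ => (1 : ℝ) * g p.2)
        (Q.prod (volume.restrict (Set.Ioi 0))) := (integrable_const (1 : ℝ)).mul_prod hgi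
    simp only [one_mul] at this
    exact this.indicator hS
  have h1 : ∫ x, upperGamma τ (q * x) ∂Q = ∫ x, q ^ τ * (∫ γ in Set.Ioi 0, F x γ) ∂Q := by
    refine integral_congr_ae ?_
    filter_upwards [hQ] with x hx
    rw [upperGamma_mul hq hx]
    congr 1
    have : ∀ γ, F x γ = (Set.Ici x).indicator g γ := fun γ => rfl
    simp_rw [this]
    -- Closed half-lines match the condition $x\le\gamma$ of the CDF; the end points are Lebesgue
    -- null.
    rw [← integral_Ici_eq_integral_Ioi, ← integral_Ici_eq_integral_Ioi,
      setIntegral_indicator measurableSet_Ici,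
      Set.inter_eq_right.mpr (Set.Ici_subset_Ici.mpr hx)]
  rw [h1, integral_const_mul, integral_integral_swap hF]
  congr 1
  refine integral_congr_ae (Filter.Eventually.of_forall fun γ => ?_)
  have : ∀ x, F x γ = (Set.Iic γ).indicator (fun _ => g γ) x := fun x => rfl
  simp_rw [this]
  rw [integral_indicator measurableSet_Iic, setIntegral_const, smul_eq_mul, cdf_eq_real, mul_comm]

/-- For fixed $y$ the integral in $\gamma$ is a Gamma integral with rate $q+Z(y)$; since $Z\ge0$,
the integrand is dominated by $\gamma^{\tau-1}e^{-q\gamma}$ and Fubini applies. -/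
theorem integral_rpow_mul_integral_exp {X : Type*} [MeasurableSpace X] (ν : Measure X)
    [IsProbabilityMeasure ν] {Z : X → ℝ} (hZ : Measurable Z) (hZ0 : ∀ᵐ y ∂ν, 0 ≤ Z y) {τ q : ℝ}
    (hτ : 0 < τ) (hq : 0 < q) :
    IntegrableOn (fun γ : ℝ => γ ^ (τ - 1) * Real.exp (-q * γ) * ∫ y, Real.exp (-(Z y * γ)) ∂ν)
      (Set.Ioi 0) ∧
    ∫ γ in Set.Ioi (0 : ℝ), γ ^ (τ - 1) * Real.exp (-q * γ) * ∫ y, Real.exp (-(Z y * γ)) ∂ν =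
      Real.Gamma τ * ∫ y, (q + Z y) ^ (-τ) ∂ν := by
  let F : ℝ → X → ℝ := fun γ y => γ ^ (τ - 1) * Real.exp (-q * γ) * Real.exp (-(Z y * γ))
  have hF : Integrable (Function.uncurry F) ((volume.restrict (Set.Ioi 0)).prod ν) := by
    have : Integrable (fun p : ℝ × X => (p.1 ^ (τ - 1) * Real.exp (-q * p.1)) * (1 : ℝ))
        ((volume.restrict (Set.Ioi 0)).prod ν) :=
      (integrableOn_rpow_mul_exp_neg hτ hq).mul_prod (integrable_const (1 : ℝ))
    refine this.mono' (Measurable.aestronglyMeasurable (by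
      simp only [F, Function.uncurry_def]; fun_prop)) ?_
    have h1 : ∀ᵐ p ∂((volume.restrict (Set.Ioi (0 : ℝ))).prod ν), 0 < p.1 :=
      Measure.quasiMeasurePreserving_fst.ae (ae_restrict_mem measurableSet_Ioi)
    have h2 : ∀ᵐ p ∂((volume.restrict (Set.Ioi (0 : ℝ))).prod ν), 0 ≤ Z p.2 :=
      Measure.quasiMeasurePreserving_snd.ae hZ0
    filter_upwards [h1, h2] with p h1 h2
    simp only [F, Function.uncurry_def]
    rw [Real.norm_of_nonneg (by positivity)]
    gcongr
    exact Real.exp_le_one_iff.mpr (neg_nonpos.mpr (by positivity))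
  have e1 : ∀ γ, γ ^ (τ - 1) * Real.exp (-q * γ) * ∫ y, Real.exp (-(Z y * γ)) ∂ν =
      ∫ y, F γ y ∂ν := fun γ => (integral_const_mul _ _).symm
  simp_rw [e1]
  refine ⟨hF.integral_prod_left, ?_⟩
  rw [integral_integral_swap hF, ← integral_const_mul]
  refine integral_congr_ae ?_
  filter_upwards [hZ0] with y hy
  have e2 : ∀ γ : ℝ, F γ y = γ ^ (τ - 1) * Real.exp (-(q + Z y) * γ) := fun γ => by
    simp only [F]
    rw [mul_assoc, ← Real.exp_add]
    ring_nf
  simp_rw [e2]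
  rw [integral_rpow_mul_exp_neg hτ (by linarith), mul_comm]

/-- The Mellin–Barnes formula at $x=B/Y$, averaged over $Y$. Fubini applies because
$|Y^{\sigma+it}|=Y^\sigma$ is free of $t$, so the norm of the integrand is a function of $t$ times a
function of $y$. -/
theorem integral_Gamma_mul_moment {X : Type*} [MeasurableSpace X] (ν : Measure X)
    [IsProbabilityMeasure ν] {Y : X → ℝ} (hY : Measurable Y) (hY0 : ∀ᵐ y ∂ν, 0 < Y y)
    {τ σ B : ℝ} (h0 : 0 < σ) (h1 : σ < τ) (hB : 0 < B)
    (hint : Integrable (fun y => (Y y : ℂ) ^ (σ : ℂ)) ν) :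
    Integrable (fun t : ℝ => Complex.Gamma ((σ : ℂ) + t * Complex.I) *
      Complex.Gamma (τ - ((σ : ℂ) + t * Complex.I)) * ((B : ℂ) ^ (-((σ : ℂ) + t * Complex.I)) *
        ∫ y, (Y y : ℂ) ^ ((σ : ℂ) + t * Complex.I) ∂ν)) ∧
    (1 / (2 * (Real.pi : ℂ))) * ∫ t : ℝ, Complex.Gamma ((σ : ℂ) + t * Complex.I) *
      Complex.Gamma (τ - ((σ : ℂ) + t * Complex.I)) * ((B : ℂ) ^ (-((σ : ℂ) + t * Complex.I)) *
        ∫ y, (Y y : ℂ) ^ ((σ : ℂ) + t * Complex.I) ∂ν) =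
    ((Real.Gamma τ * ∫ y, (1 + B / Y y) ^ (-τ) ∂ν : ℝ) : ℂ) := by
  have hτ : 0 < τ := h0.trans h1
  let F : ℝ → X → ℂ := fun t y => Complex.Gamma ((σ : ℂ) + t * Complex.I) *
      Complex.Gamma (τ - ((σ : ℂ) + t * Complex.I)) * ((B : ℂ) ^ (-((σ : ℂ) + t * Complex.I)) *
        (Y y : ℂ) ^ ((σ : ℂ) + t * Complex.I))
  have hG := integrable_Gamma_mul_Gamma h0 h1
  have hB' : (B : ℂ) ≠ 0 := by exact_mod_cast hB.ne'
  have hm : Measurable fun p : ℝ × X => (B : ℂ) ^ (-((σ : ℂ) + p.1 * Complex.I)) *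
      (Y p.2 : ℂ) ^ ((σ : ℂ) + p.1 * Complex.I) := by fun_prop
  have hF : Integrable (Function.uncurry F) (volume.prod ν) := by
    have hi := (hG.norm.const_mul (B ^ (-σ))).mul_prod hint.norm
    refine hi.mono' (hG.aestronglyMeasurable.comp_fst.mul hm.aestronglyMeasurable) ?_
    have h2 : ∀ᵐ p ∂((volume : Measure ℝ).prod ν), 0 < Y p.2 :=
      Measure.quasiMeasurePreserving_snd.ae hY0
    filter_upwards [h2] with p hp
    simp only [F, Function.uncurry_def]
    rw [norm_mul, norm_mul ((B : ℂ) ^ _), Complex.norm_cpow_eq_rpow_re_of_pos hB,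
      Complex.norm_cpow_eq_rpow_re_of_pos hp, Complex.norm_cpow_eq_rpow_re_of_pos hp]
    simp only [Complex.neg_re, Complex.add_re, Complex.ofReal_re, Complex.mul_re, Complex.I_re,
      Complex.I_im, Complex.ofReal_im, mul_zero, zero_mul, sub_zero, add_zero]
    exact le_of_eq (by ring)
  have e1 : ∀ t : ℝ, ∫ y, F t y ∂ν = Complex.Gamma ((σ : ℂ) + t * Complex.I) *
      Complex.Gamma (τ - ((σ : ℂ) + t * Complex.I)) * ((B : ℂ) ^ (-((σ : ℂ) + t * Complex.I)) *
        ∫ y, (Y y : ℂ) ^ ((σ : ℂ) + t * Complex.I) ∂ν) := fun t => by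
    simp only [F]
    rw [integral_const_mul, integral_const_mul]
  simp_rw [← e1]
  refine ⟨hF.integral_prod_left, ?_⟩
  rw [integral_integral_swap hF, ← integral_const_mul, ← integral_const_mul,
    ← integral_complex_ofReal]
  refine integral_congr_ae ?_
  filter_upwards [hY0] with y hy
  rw [← integral_Gamma_mul_Gamma_mul_cpow h0 h1 (div_pos hB hy)]
  congr 1
  refine integral_congr_ae (Filter.Eventually.of_forall fun t => ?_)
  simp only [F]
  congr 1
  have hy' : (Y y : ℂ) ≠ 0 := by exact_mod_cast hy.ne'
  have e2 : B = (B / Y y) * Y y := by field_simp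
  conv_lhs => rw [e2, Complex.ofReal_mul,
    Complex.mul_cpow_ofReal_nonneg (div_pos hB hy).le hy.le, mul_assoc, Complex.cpow_neg (Y y : ℂ),
    inv_mul_cancel₀ (by simp [Complex.cpow_eq_zero_iff, hy']), mul_one]

/-! ### The law of the end-to-end SNDR -/

namespace Params

variable (S : Params)

/-- The joint law of all random quantities of the system. -/
def jointLaw : Measure ((Fin S.N → ℂ) × ℂ × ℝ × ℝ × ℝ) :=
  (Measure.pi fun _ : Fin S.N => complexGaussian S.σh2).prod <|
    (complexGaussian S.σh2).prod S.fsoLaw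

/-- The SNR of the selected radio link as a function of the channel coefficients. -/
def rfSnr (p : (Fin S.N → ℂ) × ℂ) : ℝ :=
  ‖(√S.ρ : ℂ) * S.select p.1 + (√(1 - S.ρ) : ℂ) * p.2‖ ^ 2 * S.P₁ / S.σ02

theorem measurable_rfSnr : Measurable S.rfSnr := by
  have := S.measurable_select
  unfold rfSnr
  fun_prop

theorem rfSnr_nonneg (p : (Fin S.N → ℂ) × ℂ) : 0 ≤ S.rfSnr p := by
  have := S.P₁_pos
  have := S.σ02_pos
  unfold rfSnr
  positivity

/-- Slice at a fixed optical state $y$: the slice is a tail event of the radio link alone, to which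
`prod_tail_snr` applies. -/
theorem jointLaw_snd_apply {κ c γ : ℝ} (hγ : 0 ≤ γ) (hκ : 0 ≤ κ) (hc : 0 ≤ c) :
    S.jointLaw {x | γ * (κ + c / S.fsoSnr x.2.2) < S.rfSnr (x.1, x.2.1)} =
    ∫⁻ y, ENNReal.ofReal (∑ n ∈ Finset.range S.m, S.weight n *
      Real.exp (-(S.β n * (γ * (κ + c / S.fsoSnr y))))) ∂S.fsoLaw := by
  have hm1 := S.measurable_rfSnr
  have hm2 := S.measurable_fsoSnr
  have hmp := measurePreserving_prodAssoc (Measure.pi fun _ : Fin S.N => complexGaussian S.σh2)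
    (complexGaussian S.σh2) S.fsoLaw
  have hA : MeasurableSet {x : (Fin S.N → ℂ) × ℂ × ℝ × ℝ × ℝ |
      γ * (κ + c / S.fsoSnr x.2.2) < S.rfSnr (x.1, x.2.1)} :=
    measurableSet_lt (by fun_prop) (by fun_prop)
  rw [jointLaw, ← hmp.measure_preimage hA.nullMeasurableSet,
    Measure.prod_apply_symm (hmp.measurable hA)]
  refine lintegral_congr_ae ?_
  filter_upwards [S.ae_fsoSnr_pos] with y hy
  exact (ofReal_measureReal (measure_ne_top _ _)).symm.trans
    (congrArg ENNReal.ofReal (S.prod_tail_snr (x := γ * (κ + c / S.fsoSnr y)) (by positivity)))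

end Params

namespace Channel

variable {S : Params} {Ω : Type*} [MeasurableSpace Ω] {P : Measure Ω} (C : Channel S P)

theorem hasLaw' : HasLaw (fun ω => (C.hhat ω, C.w ω, C.Ix ω, C.Iy ω, C.R ω)) S.jointLaw P :=
  C.hasLaw

theorem one_le_κ : 1 ≤ C.κ := by
  have := S.σς2_nonneg
  have := S.σ02_pos
  unfold κ
  have : 0 ≤ S.σς2 / (S.ΩHPA ^ 2 * C.gain ^ 2 * S.σ02) := by positivity
  linarith

theorem c_pos : 0 < C.c := by
  have h1 := C.one_le_κ
  have h2 : 0 ≤ ∫ ω, C.γ₁ ω ∂P := integral_nonneg fun ω => S.rfSnr_nonneg (C.hhat ω, C.w ω)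
  unfold c
  linarith

theorem γe2e_eq (ω : Ω) : C.γe2e ω =
    (fun x : (Fin S.N → ℂ) × ℂ × ℝ × ℝ × ℝ =>
      S.rfSnr (x.1, x.2.1) * S.fsoSnr x.2.2 / (C.κ * S.fsoSnr x.2.2 + C.c))
      (C.hhat ω, C.w ω, C.Ix ω, C.Iy ω, C.R ω) := by
  simp only [γe2e, c, add_assoc]
  rfl

theorem measurable_sndr : Measurable (fun x : (Fin S.N → ℂ) × ℂ × ℝ × ℝ × ℝ =>
      S.rfSnr (x.1, x.2.1) * S.fsoSnr x.2.2 / (C.κ * S.fsoSnr x.2.2 + C.c)) := by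
  have hm1 := S.measurable_rfSnr
  have hm2 := S.measurable_fsoSnr
  fun_prop

theorem map_γe2e : P.map C.γe2e = S.jointLaw.map (fun x =>
      S.rfSnr (x.1, x.2.1) * S.fsoSnr x.2.2 / (C.κ * S.fsoSnr x.2.2 + C.c)) := by
  rw [← C.hasLaw'.map_eq, AEMeasurable.map_map_of_aemeasurable
    C.measurable_sndr.aemeasurable C.hasLaw'.aemeasurable]
  congr 1
  ext ω
  exact C.γe2e_eq ω

theorem aemeasurable_γe2e : AEMeasurable C.γe2e P :=
  (C.measurable_sndr.comp_aemeasurable C.hasLaw'.aemeasurable).congr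
    (Filter.Eventually.of_forall fun ω => (C.γe2e_eq ω).symm)

theorem ae_fsoSnr_pos_jointLaw : ∀ᵐ x ∂S.jointLaw, 0 < S.fsoSnr x.2.2 :=
  (Measure.quasiMeasurePreserving_snd.comp Measure.quasiMeasurePreserving_snd).ae S.ae_fsoSnr_pos

theorem ae_nonneg_map_γe2e : ∀ᵐ x ∂(P.map C.γe2e), 0 ≤ x := by
  rw [C.map_γe2e, ae_map_iff C.measurable_sndr.aemeasurable measurableSet_Ici]
  filter_upwards [ae_fsoSnr_pos_jointLaw] with x hx
  have h1 := C.one_le_κ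
  have h2 := C.c_pos
  have h3 := S.rfSnr_nonneg (x.1, x.2.1)
  positivity

/-- For $Y>0$, $\gamma<\gamma_1Y/(\kappa Y+c)$ is equivalent to $\gamma(\kappa+c/Y)<\gamma_1$. -/
theorem map_γe2e_Ioi {γ : ℝ} (hγ : 0 ≤ γ) :
    P.map C.γe2e (Set.Ioi γ) = ∫⁻ y, ENNReal.ofReal (∑ n ∈ Finset.range S.m, S.weight n *
      Real.exp (-(S.β n * (γ * (C.κ + C.c / S.fsoSnr y))))) ∂S.fsoLaw := by
  have h1 := C.one_le_κ
  have h2 := C.c_pos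
  rw [C.map_γe2e, Measure.map_apply C.measurable_sndr measurableSet_Ioi,
    ← S.jointLaw_snd_apply hγ (by linarith) h2.le]
  refine measure_congr ?_
  filter_upwards [ae_fsoSnr_pos_jointLaw] with x hx
  refine propext ?_
  change γ < _ / _ ↔ γ * _ < _
  have e : γ * (C.κ + C.c / S.fsoSnr x.2.2) =
      γ * (C.κ * S.fsoSnr x.2.2 + C.c) / S.fsoSnr x.2.2 := by
    field_simp
  rw [lt_div_iff₀ (by positivity), e, div_lt_iff₀ hx]

end Channel

/-! ### The Meijer G-function of the closed form -/

theorem cpow_eq_cexp_log {x : ℝ} (hx : 0 < x) (w : ℂ) :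
    (x : ℂ) ^ w = Complex.exp ((Real.log x : ℝ) * w) := by
  rw [Complex.cpow_def_of_ne_zero (by exact_mod_cast hx.ne'), ← Complex.ofReal_log hx.le]

/-- Isolates the constant $j^{1/2-y}$ from the part that varies along the contour. -/
theorem natCast_cpow_eq {j : ℕ} (hj : 0 < j) (y : ℝ) (w : ℂ) :
    (j : ℂ) ^ (1 / 2 - (y + w)) = (((j : ℝ) ^ (1 / 2 - y) : ℝ) : ℂ) * (j : ℂ) ^ (-w) := by
  have hj' : (j : ℂ) ≠ 0 := by exact_mod_cast hj.ne'
  rw [show (1 / 2 - (y + w) : ℂ) = ((1 / 2 - y : ℝ) : ℂ) + -w by push_cast; ring,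
    Complex.cpow_add _ _ hj', Complex.ofReal_cpow j.cast_nonneg, Complex.ofReal_natCast]

theorem mem_delta {j : ℕ} {x z : ℝ} : z ∈ delta j x ↔ ∃ i < j, (x + i) / j = z := by
  simp [delta]

theorem le_one_of_mem_delta {j : ℕ} {x z : ℝ} (hx : x ≤ 1) (hz : z ∈ delta j x) : z ≤ 1 := by
  obtain ⟨i, hi, rfl⟩ := mem_delta.mp hz
  have hj : (0 : ℝ) < j := by exact_mod_cast (Nat.zero_le i).trans_lt hi
  have : (i : ℝ) + 1 ≤ j := by exact_mod_cast hi
  rw [div_le_one hj]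
  linarith

theorem le_one_of_mem_delta₃ {r j : ℕ} {x z : ℝ} (hx : x ≤ 1) (hz : z ∈ delta₃ r j x) : z ≤ 1 := by
  obtain ⟨y, hy, hz⟩ := List.mem_flatMap.mp hz
  exact le_one_of_mem_delta (le_one_of_mem_delta hx hy) hz

namespace Params

variable (S : Params) (M : Modulation)

theorem r_pos : 0 < S.r := by rcases S.r_eq with h | h <;> omega

theorem l_pos : 0 < S.l := by
  have h : (0 : ℝ) < S.l := by
    rw [S.l_eq]
    exact mul_pos S.α₂_pos (by exact_mod_cast S.p_pos)
  exact_mod_cast h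

theorem l_div_α₂ : (S.l : ℝ) / S.α₂ = S.p := by
  have := S.α₂_pos
  rw [S.l_eq]; field_simp

theorem l_div_α₁ : (S.l : ℝ) / S.α₁ = S.q := by
  have h1 := S.α₁_pos
  have h2 := S.α₂_pos
  have hq : (0 : ℝ) < S.q := by exact_mod_cast S.q_pos
  have h := S.p_div_q
  rw [div_eq_div_iff hq.ne' h2.ne'] at h
  rw [S.l_eq, div_eq_iff h1.ne', mul_comm, h]
  ring

theorem ξ_pos : 0 < S.ξ := div_pos S.ωzeq_pos (mul_pos two_pos S.σs_pos)

theorem length_κ₅ : S.κ₅.length = S.r * (S.p + S.q + S.l) + S.l := by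
  simp only [κ₅, List.length_append, length_delta, length_delta₃]
  ring

theorem take_lowerList : S.lowerList.take (S.r * (S.p + S.q + S.l) + S.l) = S.lowerList :=
  List.take_of_length_le (by rw [lowerList, List.length_map, length_κ₅])

theorem drop_lowerList : S.lowerList.drop (S.r * (S.p + S.q + S.l) + S.l) = [] :=
  List.drop_eq_nil_of_le (by rw [lowerList, List.length_map, length_κ₅])

theorem take_upperList : (S.upperList M).take S.l = delta S.l (1 - M.τ) :=
  List.take_left' (length_delta _ _)

theorem drop_upperList : (S.upperList M).drop S.l = S.κ₆.map fun x => 1 - x :=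
  List.drop_left' (length_delta _ _)

/-- Only two parameters bind: the last entry $1$ of $\Delta(l:1)$ puts a pole at $s=0$, and the last
entry $1-\tau/l$ of $\Delta(l:1-\tau)$ puts one at $s=\tau/l$. All other entries of `κ₅` are at most
$1$, so their poles are no further right than $0$. -/
theorem meijerSeparates_iff {c : ℝ} :
    MeijerSeparates (S.r * (S.p + S.q + S.l) + S.l) S.l (S.upperList M) S.lowerList c ↔
      0 < c ∧ c < M.τ / S.l := by
  have hl := S.l_pos
  have hl' : (0 : ℝ) < S.l := by exact_mod_cast hl
  have hcast : ((S.l - 1 : ℕ) : ℝ) = S.l - 1 := by rw [Nat.cast_sub hl, Nat.cast_one]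
  rw [MeijerSeparates, take_lowerList, take_upperList]
  refine and_congr ⟨fun h => ?_, fun h x hx => ?_⟩ ⟨fun h => ?_, fun h x hx => ?_⟩
  · have h1 : (1 : ℝ) ∈ delta S.l 1 := mem_delta.mpr ⟨S.l - 1, by omega, by
      rw [hcast]; field_simp; ring⟩
    have := h (1 - 1) (List.mem_map.mpr ⟨1, by simp [κ₅, h1], rfl⟩)
    simpa using this
  · obtain ⟨y, hy, rfl⟩ := List.mem_map.mp hx
    have hy1 : y ≤ 1 := by
      simp only [κ₅, List.mem_append] at hy
      rcases hy with ((hy | hy) | hy) | hy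
      · exact le_one_of_mem_delta le_rfl hy
      · exact le_one_of_mem_delta₃ (by nlinarith [sq_nonneg S.ξ]) hy
      · exact le_one_of_mem_delta₃ (by linarith [S.m₁_pos]) hy
      · exact le_one_of_mem_delta₃ (by linarith [S.m₂_pos]) hy
    linarith
  · have h1 : 1 - M.τ / S.l ∈ delta S.l (1 - M.τ) := mem_delta.mpr ⟨S.l - 1, by omega, by
      rw [hcast]; field_simp; ring⟩
    have := h _ h1
    linarith
  · obtain ⟨i, hi, rfl⟩ := mem_delta.mp hx
    have : (i : ℝ) + 1 ≤ S.l := by exact_mod_cast hi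
    have h2 : (1 - M.τ + i) / S.l ≤ 1 - M.τ / S.l := by
      rw [div_le_iff₀ hl', sub_mul, div_mul_cancel₀ _ hl'.ne']
      linarith
    linarith

/-- The numerator uses up the whole lower list, so the second product of the denominator is empty.
-/
theorem meijerIntegrand_eq (z : ℝ) (s : ℂ) :
    meijerIntegrand (S.r * (S.p + S.q + S.l) + S.l) S.l (S.upperList M) S.lowerList z s =
      gammaProd S.κ₅ s * gammaProd (delta S.l (1 - M.τ)) (-s) / gammaProd S.κ₆ s *
        (z : ℂ) ^ (-s) := by
  rw [meijerIntegrand, take_lowerList, take_upperList, drop_lowerList, drop_upperList]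
  simp only [lowerList, gammaProd, List.map_map, List.map_nil, List.prod_nil, mul_one]
  congr 3
  congr 1
  refine List.map_congr_left fun x _ => ?_
  push_cast
  ring_nf

/-- The constant factor between the Meijer integrand and the Mellin–Barnes integrand of the
end-to-end performance. -/
def meijerConst : ℝ :=
  (2 * Real.pi) ^ ((2 * (S.l : ℝ) + S.r * (S.p + S.q) - 4) / 2) *
    (S.l : ℝ) ^ (2 - M.τ) * (S.r : ℝ) ^ (2 - S.m₁ - S.m₂) * (S.q : ℝ) ^ (1 / 2 - S.m₁) *
    (S.p : ℝ) ^ (1 / 2 - S.m₂) * Real.Gamma S.m₁ * Real.Gamma S.m₂ / S.ξ ^ 2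

/-- The cancellation in `gammaProd_ratio` with every power and Gamma value made an atom. `X` stands
for $\xi^2+lrs$ and `Γ₀` for $\Gamma(\xi^2+lrs)$, so that `X * Γ₀` is the shifted Gamma value from
`κ₆`. -/
theorem ratio_algebra {c₁ c₃ c₄ c₅ l₀ l₁ u₁ r l u₂ u₃ u₄ u₅ r₁ r₂ r₃ r₄ q₁ q₂ p₁ p₂ G₁ G₂ G₃ G₄
    Γ₀ X ξ₂ g₁ g₂ : ℂ} (h₃ : c₃ ≠ 0) (h₁ : u₁ ≠ 0) (hu₂ : u₂ ≠ 0) (hu₃ : u₃ ≠ 0) (hu₄ : u₄ ≠ 0)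
    (hu₅ : u₅ ≠ 0) (hΓ : Γ₀ ≠ 0) (hX : X ≠ 0) (hξ : ξ₂ ≠ 0) (hg₁ : g₁ ≠ 0) (hg₂ : g₂ ≠ 0) :
    (c₁ * (l₀ * u₁) * G₁) * (c₃ * (r * u₅ * u₃) * (l * u₄ * u₂) * Γ₀) *
        (c₄ * (r₁ * r₃) * (q₁ * q₂) * G₃) * (c₅ * (r₂ * r₄) * (p₁ * p₂) * G₄) *
        (c₁ * (l₁ * u₁⁻¹) * G₂) / (c₃ * (u₅ * u₃) * (u₄ * u₂) * (X * Γ₀)) =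
      (c₁ * c₁ * c₄ * c₅ * (l₀ * l₁ * l) * (r * r₁ * r₂) * q₁ * p₁ * g₁ * g₂ / ξ₂) * (G₁ * G₂) *
        (r₃ * r₄ * q₂ * p₂) * (G₃ / g₁ * (G₄ / g₂ * (ξ₂ / X))) := by
  have e1 : (c₃ * (u₅ * u₃) * (u₄ * u₂) * Γ₀) ≠ 0 :=
    mul_ne_zero (mul_ne_zero (mul_ne_zero h₃ (mul_ne_zero hu₅ hu₃)) (mul_ne_zero hu₄ hu₂)) hΓ
  set K := c₁ * c₁ * c₄ * c₅ * (l₀ * l₁ * l) * (r * r₁ * r₂) * q₁ * p₁ with hK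
  set D := c₃ * (u₅ * u₃) * (u₄ * u₂) * Γ₀ with hD
  have e2 : c₃ * (u₅ * u₃) * (u₄ * u₂) * (X * Γ₀) = D * X := by rw [hD]; ring
  have e3 : (c₁ * (l₀ * u₁) * G₁) * (c₃ * (r * u₅ * u₃) * (l * u₄ * u₂) * Γ₀) *
      (c₄ * (r₁ * r₃) * (q₁ * q₂) * G₃) * (c₅ * (r₂ * r₄) * (p₁ * p₂) * G₄) *
      (c₁ * (l₁ * u₁⁻¹) * G₂) = K * ((G₁ * G₂) * (r₃ * r₄ * q₂ * p₂) * (G₃ * G₄)) * D := by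
    rw [← mul_inv_cancel_right₀ h₁ (K * ((G₁ * G₂) * (r₃ * r₄ * q₂ * p₂) * (G₃ * G₄)) * D), hK, hD]
    ring
  rw [e2, e3]
  field_simp

/-- Gauss' formula collapses each block to one Gamma value. The blocks $\Delta(l:1)$ and
$\Delta(l:1-\tau)$ give $\Gamma(ls)\Gamma(\tau-ls)$, the $m_1$ and $m_2$ blocks give the turbulence
moments, and the $\xi$ block of `κ₅` over `κ₆` gives
$\Gamma(\xi^2+lrs)/\Gamma(1+\xi^2+lrs)=1/(\xi^2+lrs)$. -/
theorem gammaProd_ratio {s : ℂ} (hs : 0 < s.re) (hs' : s.re < M.τ / S.l) :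
    gammaProd S.κ₅ s * gammaProd (delta S.l (1 - M.τ)) (-s) / gammaProd S.κ₆ s =
      S.meijerConst M * (Complex.Gamma (S.l * s) * Complex.Gamma (M.τ - S.l * s)) *
      ((S.r : ℂ) ^ (-(S.q * (S.r * s))) * (S.r : ℂ) ^ (-(S.p * (S.r * s))) *
        (S.q : ℂ) ^ (-(S.q * (S.r * s))) * (S.p : ℂ) ^ (-(S.p * (S.r * s)))) *
      ((Complex.Gamma (S.m₁ + S.q * (S.r * s)) / Real.Gamma S.m₁) *
        ((Complex.Gamma (S.m₂ + S.p * (S.r * s)) / Real.Gamma S.m₂) *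
          ((S.ξ ^ 2 : ℝ) / ((S.ξ ^ 2 : ℝ) + S.l * (S.r * s))))) := by
  have hl := S.l_pos
  have hr := S.r_pos
  have hl' : (0 : ℝ) < S.l := by exact_mod_cast hl
  have hr' : (0 : ℝ) < S.r := by exact_mod_cast hr
  have hlc : (S.l : ℂ) ≠ 0 := by exact_mod_cast hl.ne'
  have hrc : (S.r : ℂ) ≠ 0 := by exact_mod_cast hr.ne'
  have hξ : 0 < S.ξ ^ 2 := pow_pos S.ξ_pos 2
  have hξc : ((S.ξ ^ 2 : ℝ) : ℂ) ≠ 0 := by exact_mod_cast hξ.ne'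
  have hm1 : (Real.Gamma S.m₁ : ℂ) ≠ 0 := by exact_mod_cast (Real.Gamma_pos_of_pos S.m₁_pos).ne'
  have hm2 : (Real.Gamma S.m₂ : ℂ) ≠ 0 := by exact_mod_cast (Real.Gamma_pos_of_pos S.m₂_pos).ne'
  have g1 := gammaProd_delta hl 0 (s := s) (by simp; positivity)
  have g2 := gammaProd_delta hl M.τ (s := -s) (by
    rw [lt_div_iff₀ hl'] at hs'
    simp only [Complex.neg_re]
    linarith)
  have g3 := gammaProd_delta₃ hr hl (S.ξ ^ 2) hξ.le hs
  have g4 := gammaProd_delta₃ hr S.q_pos S.m₁ S.m₁_pos.le hs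
  have g5 := gammaProd_delta₃ hr S.p_pos S.m₂ S.m₂_pos.le hs
  have g6 := gammaProd_delta₃ hr hl (1 + S.ξ ^ 2) (by positivity) hs
  rw [sub_zero] at g1
  rw [show (1 : ℝ) - (1 + S.ξ ^ 2) = -S.ξ ^ 2 by ring] at g6
  rw [natCast_cpow_eq hl] at g1 g2
  rw [natCast_cpow_eq hr, natCast_cpow_eq hl] at g3 g6
  rw [natCast_cpow_eq hr, natCast_cpow_eq S.q_pos] at g4
  rw [natCast_cpow_eq hr, natCast_cpow_eq S.p_pos] at g5
  have hne : ((S.ξ ^ 2 : ℝ) : ℂ) + S.l * (S.r * s) ≠ 0 := fun h => by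
    have h1 : (((S.ξ ^ 2 : ℝ) : ℂ) + S.l * (S.r * s)).re = S.ξ ^ 2 + S.l * (S.r * s.re) := by
      rw [Complex.add_re, Complex.ofReal_re]; simp
    rw [h, Complex.zero_re] at h1
    have : 0 < S.ξ ^ 2 + S.l * (S.r * s.re) := by positivity
    linarith
  have hΓ : Complex.Gamma ((1 + S.ξ ^ 2 : ℝ) + S.l * (S.r * s)) =
      ((S.ξ ^ 2 : ℝ) + S.l * (S.r * s)) * Complex.Gamma ((S.ξ ^ 2 : ℝ) + S.l * (S.r * s)) := by
    rw [← Complex.Gamma_add_one _ hne]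
    congr 1
    push_cast
    ring
  have hΓne : Complex.Gamma ((S.ξ ^ 2 : ℝ) + S.l * (S.r * s)) ≠ 0 := by
    refine Complex.Gamma_ne_zero_of_re_pos ?_
    have h1 : (((S.ξ ^ 2 : ℝ) : ℂ) + S.l * (S.r * s)).re = S.ξ ^ 2 + S.l * (S.r * s.re) := by
      rw [Complex.add_re, Complex.ofReal_re]; simp
    rw [h1]
    positivity
  -- The $\xi$ blocks of `κ₅` and `κ₆` differ by a unit shift, so their powers of $r$ and $l$ cancel
  -- up to one factor $r$ and one factor $l$.
  have hshift : ∀ x : ℝ, 0 < x → x ^ (1 / 2 - S.ξ ^ 2) = x * x ^ (1 / 2 - (1 + S.ξ ^ 2)) :=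
    fun x hx => by
      rw [mul_comm, ← Real.rpow_add_one hx.ne']
      congr 1
      ring
  have hl2 : (S.l : ℂ) ^ (-(S.l * s : ℂ)) * (S.l : ℂ) ^ (-(S.l * -s : ℂ)) = 1 := by
    rw [← Complex.cpow_add _ _ hlc]
    simp
  have hC : (S.meijerConst M : ℂ) =
      ((2 * Real.pi) ^ (((S.l : ℝ) - 1) / 2) : ℝ) * ((2 * Real.pi) ^ (((S.l : ℝ) - 1) / 2) : ℝ) *
      ((2 * Real.pi) ^ (((S.r : ℝ) * S.q - 1) / 2) : ℝ) *
      ((2 * Real.pi) ^ (((S.r : ℝ) * S.p - 1) / 2) : ℝ) *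
      (((S.l : ℝ) ^ (1 / 2 - 0 : ℝ) : ℝ) * ((S.l : ℝ) ^ (1 / 2 - M.τ) : ℝ) * S.l) *
      (S.r * ((S.r : ℝ) ^ (1 / 2 - S.m₁) : ℝ) * ((S.r : ℝ) ^ (1 / 2 - S.m₂) : ℝ)) *
      ((S.q : ℝ) ^ (1 / 2 - S.m₁) : ℝ) * ((S.p : ℝ) ^ (1 / 2 - S.m₂) : ℝ) *
      Real.Gamma S.m₁ * Real.Gamma S.m₂ / (S.ξ ^ 2 : ℝ) := by
    rw [meijerConst]
    have e1 : (2 * Real.pi) ^ ((2 * (S.l : ℝ) + S.r * (S.p + S.q) - 4) / 2) =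
      (2 * Real.pi) ^ (((S.l : ℝ) - 1) / 2) * (2 * Real.pi) ^ (((S.l : ℝ) - 1) / 2) *
      (2 * Real.pi) ^ (((S.r : ℝ) * S.q - 1) / 2) *
      (2 * Real.pi) ^ (((S.r : ℝ) * S.p - 1) / 2) := by
      have := Real.pi_pos
      rw [← Real.rpow_add (by positivity), ← Real.rpow_add (by positivity),
        ← Real.rpow_add (by positivity)]
      congr 1
      ring
    have e2 : (S.l : ℝ) ^ (2 - M.τ) =
        (S.l : ℝ) ^ (1 / 2 - 0 : ℝ) * (S.l : ℝ) ^ (1 / 2 - M.τ) * S.l := by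
      rw [← Real.rpow_add hl', ← Real.rpow_add_one hl'.ne']
      congr 1
      ring
    have e3 : (S.r : ℝ) ^ (2 - S.m₁ - S.m₂) =
        S.r * (S.r : ℝ) ^ (1 / 2 - S.m₁) * (S.r : ℝ) ^ (1 / 2 - S.m₂) := by
      rw [mul_assoc, ← Real.rpow_add hr', mul_comm, ← Real.rpow_add_one hr'.ne']
      congr 1
      ring
    rw [e1, e2, e3]
    push_cast
    rfl
  have hv := eq_inv_of_mul_eq_one_right hl2
  have n1 : (S.l : ℂ) ^ (-(S.l * s : ℂ)) ≠ 0 := by simp [Complex.cpow_eq_zero_iff, hlc]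
  have n2 : (S.l : ℂ) ^ (-(S.l * (S.r * s) : ℂ)) ≠ 0 := by simp [Complex.cpow_eq_zero_iff, hlc]
  have n3 : (S.r : ℂ) ^ (-(S.l * (S.r * s) : ℂ)) ≠ 0 := by simp [Complex.cpow_eq_zero_iff, hrc]
  have n4 : (((S.l : ℝ) ^ (1 / 2 - (1 + S.ξ ^ 2)) : ℝ) : ℂ) ≠ 0 := by
    exact_mod_cast (Real.rpow_pos_of_pos hl' _).ne'
  have n5 : (((S.r : ℝ) ^ (1 / 2 - (1 + S.ξ ^ 2)) : ℝ) : ℂ) ≠ 0 := by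
    exact_mod_cast (Real.rpow_pos_of_pos hr' _).ne'
  have n6 : (((2 * Real.pi) ^ (((S.r : ℝ) * S.l - 1) / 2) : ℝ) : ℂ) ≠ 0 := by
    exact_mod_cast (Real.rpow_pos_of_pos (mul_pos two_pos Real.pi_pos) _).ne'
  rw [hshift _ hr', hshift _ hl', Complex.ofReal_mul, Complex.ofReal_mul, Complex.ofReal_natCast,
    Complex.ofReal_natCast] at g3
  rw [hΓ] at g6
  rw [hv, mul_neg, ← sub_eq_add_neg] at g2
  rw [Complex.ofReal_zero, zero_add] at g1
  rw [κ₅, κ₆, gammaProd_append, gammaProd_append, gammaProd_append, g1, g2, g3, g4, g5, g6, hC]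
  exact ratio_algebra n6 n1 n2 n3 n4 n5 hΓne hne hξc hm1 hm2

/-- The prefactor of the closed form undoes the constant of the Mellin–Barnes integrand. It rests on
$\mu-1=m_1+m_2-2$ and $l=\alpha_2p$. -/
theorem meijerConst_mul :
    S.ξ ^ 2 * (S.p : ℝ) ^ (M.τ + S.m₂ - 3 / 2) * (S.q : ℝ) ^ (S.m₁ - 1 / 2) *
      S.α₂ ^ (M.τ - 1) * (S.r : ℝ) ^ (S.μ - 1) /
      ((2 * Real.pi) ^ ((2 * (S.l : ℝ) + S.r * (S.p + S.q) - 4) / 2) *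
        Real.Gamma S.m₁ * Real.Gamma S.m₂) * (S.meijerConst M / S.l) = 1 := by
  have hl' : (0 : ℝ) < S.l := by exact_mod_cast S.l_pos
  have hr' : (0 : ℝ) < S.r := by exact_mod_cast S.r_pos
  have hp' : (0 : ℝ) < S.p := by exact_mod_cast S.p_pos
  have hq' : (0 : ℝ) < S.q := by exact_mod_cast S.q_pos
  have hα := S.α₂_pos
  have hξ := S.ξ_pos
  have hm1 := Real.Gamma_pos_of_pos S.m₁_pos
  have hm2 := Real.Gamma_pos_of_pos S.m₂_pos
  have hπ : 0 < (2 * Real.pi) ^ ((2 * (S.l : ℝ) + S.r * (S.p + S.q) - 4) / 2) :=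
    Real.rpow_pos_of_pos (mul_pos two_pos Real.pi_pos) _
  have hμ : S.μ - 1 = -(2 - S.m₁ - S.m₂) := by
    rw [μ, κ₁, κ₂, List.sum_append, List.sum_append, sum_delta S.l_pos, sum_delta S.l_pos,
      sum_delta S.q_pos, sum_delta S.p_pos]
    ring
  have e1 : (S.r : ℝ) ^ (S.μ - 1) * (S.r : ℝ) ^ (2 - S.m₁ - S.m₂) = 1 := by
    rw [hμ, ← Real.rpow_add hr', neg_add_cancel, Real.rpow_zero]
  have e2 : (S.q : ℝ) ^ (S.m₁ - 1 / 2) * (S.q : ℝ) ^ (1 / 2 - S.m₁) = 1 := by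
    rw [← Real.rpow_add hq', show S.m₁ - 1 / 2 + (1 / 2 - S.m₁) = 0 by ring, Real.rpow_zero]
  have e3 : (S.p : ℝ) ^ (M.τ + S.m₂ - 3 / 2) * (S.p : ℝ) ^ (1 / 2 - S.m₂) * S.α₂ ^ (M.τ - 1) *
      (S.l : ℝ) ^ (2 - M.τ) = S.l := by
    rw [← Real.rpow_add hp', show M.τ + S.m₂ - 3 / 2 + (1 / 2 - S.m₂) = M.τ - 1 by ring,
      ← Real.mul_rpow hp'.le hα.le, mul_comm (S.p : ℝ), ← S.l_eq, ← Real.rpow_add hl',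
      show M.τ - 1 + (2 - M.τ) = 1 by ring, Real.rpow_one]
  rw [meijerConst, div_mul_div_comm, div_eq_one_iff_eq (by positivity)]
  calc _ = (2 * Real.pi) ^ ((2 * (S.l : ℝ) + S.r * (S.p + S.q) - 4) / 2) * Real.Gamma S.m₁ *
        Real.Gamma S.m₂ * (S.ξ ^ 2 / S.ξ ^ 2) * ((S.r : ℝ) ^ (S.μ - 1) *
          (S.r : ℝ) ^ (2 - S.m₁ - S.m₂)) * ((S.q : ℝ) ^ (S.m₁ - 1 / 2) *
          (S.q : ℝ) ^ (1 / 2 - S.m₁)) * ((S.p : ℝ) ^ (M.τ + S.m₂ - 3 / 2) *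
          (S.p : ℝ) ^ (1 / 2 - S.m₂) * S.α₂ ^ (M.τ - 1) * (S.l : ℝ) ^ (2 - M.τ)) := by ring
    _ = _ := by
      rw [e1, e2, e3, div_self (by positivity)]
      ring

theorem β_pos (n : ℕ) : 0 < S.β n := by
  have h1 : (0 : ℝ) ≤ (S.N : ℝ) - S.m := sub_nonneg.mpr (by exact_mod_cast S.m_le_N)
  have h2 : 0 ≤ 1 - S.ρ := sub_nonneg.mpr S.ρ_le_one
  have h3 := S.P₁_pos
  have h4 := S.σh2_pos
  have h5 := S.σ02_pos
  unfold β γbar₁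
  positivity

end Params

namespace Channel

variable {S : Params} {Ω : Type*} [MeasurableSpace Ω] {P : Measure Ω} (C : Channel S P)
  (M : Modulation)

theorem integral_I : ∫ ω, C.I ω ∂P = ∫ y, S.fsoGain y ∂S.fsoLaw := by
  have hm : Measurable fun x : (Fin S.N → ℂ) × ℂ × ℝ × ℝ × ℝ => S.fsoGain x.2.2 :=
    S.measurable_fsoGain.comp (measurable_snd.comp measurable_snd)
  have h1 := C.hasLaw'.integral_comp hm.aestronglyMeasurable
  have h2 : MeasurePreserving (fun x : (Fin S.N → ℂ) × ℂ × ℝ × ℝ × ℝ => x.2.2) S.jointLaw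
      S.fsoLaw := measurePreserving_snd.comp measurePreserving_snd
  have h3 := integral_map (μ := S.jointLaw) h2.measurable.aemeasurable
    (f := S.fsoGain) S.measurable_fsoGain.aestronglyMeasurable
  rw [h2.map_eq] at h3
  rw [h3, ← h1]
  rfl

theorem integral_I_pos : 0 < ∫ ω, C.I ω ∂P := by
  rw [C.integral_I]
  exact S.integral_fsoGain_pos

theorem μr_pos : 0 < C.μr := by
  have h1 := C.integral_I_pos
  have h2 := S.η_pos
  have h3 := S.σ02_pos
  unfold μr
  positivity

/-- The mean $\mathbb E[I]$ drops out: $\mu_r^{l/r}$ contains $\mathbb E[I]^l$, which cancels the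
denominator in `ζ`. -/
theorem log_ζ : Real.log C.ζ =
    S.p * (Real.log S.p + Real.log (S.Ω₂ / S.m₂)) +
    S.q * (Real.log S.q + Real.log (S.Ω₁ / S.m₁)) + S.l * Real.log (S.A₀ * S.Il) +
    S.l / S.r * Real.log (S.η ^ S.r / S.σ02) := by
  have hI := C.integral_I_pos
  have hμ := C.μr_pos
  have hA : 0 < S.A₀ * S.Il := mul_pos S.A₀_pos S.Il_pos
  have hp : (0 : ℝ) < S.p := by exact_mod_cast S.p_pos
  have hq : (0 : ℝ) < S.q := by exact_mod_cast S.q_pos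
  have hr : (0 : ℝ) < S.r := by exact_mod_cast S.r_pos
  have h1 : 0 < S.Ω₁ / S.m₁ := div_pos S.Ω₁_pos S.m₁_pos
  have h2 : 0 < S.Ω₂ / S.m₂ := div_pos S.Ω₂_pos S.m₂_pos
  have hη : 0 < S.η ^ S.r / S.σ02 := div_pos (pow_pos S.η_pos _) S.σ02_pos
  have e : C.μr = (S.η ^ S.r / S.σ02) * (∫ ω, C.I ω ∂P) ^ S.r := by unfold μr; ring
  have eμ : Real.log C.μr = Real.log (S.η ^ S.r / S.σ02) + S.r * Real.log (∫ ω, C.I ω ∂P) := by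
    rw [e, Real.log_mul hη.ne' (pow_pos hI _).ne', Real.log_pow]
  rw [ζ, mul_div_assoc, mul_div_assoc, Real.log_mul (by positivity) (by positivity),
    Real.log_mul (by positivity) (by positivity), Real.log_mul (by positivity) (by positivity),
    Real.log_pow, Real.log_pow, Real.log_pow, Real.log_rpow hμ, eμ, Real.log_div hA.ne' hI.ne',
    Real.log_mul hp.ne' h2.ne', Real.log_mul hq.ne' h1.ne']
  field_simp
  ring

theorem ζ_pos : 0 < C.ζ := by
  have hI := C.integral_I_pos
  have hμ := C.μr_pos
  have hA : 0 < S.A₀ * S.Il := mul_pos S.A₀_pos S.Il_pos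
  have hp : (0 : ℝ) < S.p := by exact_mod_cast S.p_pos
  have hq : (0 : ℝ) < S.q := by exact_mod_cast S.q_pos
  have h1 := S.Ω₁_pos
  have h2 := S.Ω₂_pos
  have h3 := S.m₁_pos
  have h4 := S.m₂_pos
  unfold ζ
  positivity

/-- The scale of the inverse optical SNR in the conditional error probability. -/
def scale (n k : ℕ) : ℝ := S.β n * C.c / (S.β n * C.κ + M.qk k)

/-- All bases are positive, so in terms of logarithms this becomes a linear identity. -/
theorem arg_cpow {n k : ℕ} (hB : 0 < C.scale M n k) (s : ℂ) :
    (C.arg M n k : ℂ) ^ (-s) =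
      ((C.scale M n k : ℂ) ^ (-(S.l * s)) * (((S.η ^ S.r / S.σ02 : ℝ) : ℂ) ^ (S.l * s) *
        (((S.A₀ * S.Il : ℝ) : ℂ) ^ (S.r * (S.l * s)) *
        (((S.Ω₁ / S.m₁ : ℝ) : ℂ) ^ (S.q * (S.r * s)) *
          ((S.Ω₂ / S.m₂ : ℝ) : ℂ) ^ (S.p * (S.r * s)))))) *
      ((S.r : ℂ) ^ (S.q * (S.r * s)) * (S.r : ℂ) ^ (S.p * (S.r * s)) *
        (S.q : ℂ) ^ (S.q * (S.r * s)) * (S.p : ℂ) ^ (S.p * (S.r * s))) := by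
  have hA : 0 < S.A₀ * S.Il := mul_pos S.A₀_pos S.Il_pos
  have hp : (0 : ℝ) < S.p := by exact_mod_cast S.p_pos
  have hq : (0 : ℝ) < S.q := by exact_mod_cast S.q_pos
  have hr : (0 : ℝ) < S.r := by exact_mod_cast S.r_pos
  have h1 : 0 < S.Ω₁ / S.m₁ := div_pos S.Ω₁_pos S.m₁_pos
  have h2 : 0 < S.Ω₂ / S.m₂ := div_pos S.Ω₂_pos S.m₂_pos
  have hη : 0 < S.η ^ S.r / S.σ02 := div_pos (pow_pos S.η_pos _) S.σ02_pos
  have hζ := C.ζ_pos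
  have e : C.arg M n k = C.scale M n k ^ S.l * ((C.ζ * (S.r : ℝ) ^ (S.p + S.q)) ^ S.r)⁻¹ := rfl
  have harg : 0 < C.arg M n k := by rw [e]; positivity
  have hlog : Real.log (C.arg M n k) = S.l * Real.log (C.scale M n k) - S.r *
      (S.p * (Real.log S.p + Real.log (S.Ω₂ / S.m₂)) +
      S.q * (Real.log S.q + Real.log (S.Ω₁ / S.m₁)) + S.l * Real.log (S.A₀ * S.Il) +
      (S.p + S.q) * Real.log S.r) - S.l * Real.log (S.η ^ S.r / S.σ02) := by
    rw [e, Real.log_mul (by positivity) (by positivity), Real.log_inv, Real.log_pow, Real.log_pow,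
      Real.log_mul (by positivity) (by positivity), Real.log_pow, C.log_ζ]
    push_cast
    field_simp
    ring
  rw [← Complex.ofReal_natCast S.p, ← Complex.ofReal_natCast S.q, ← Complex.ofReal_natCast S.r]
  simp only [cpow_eq_cexp_log harg, cpow_eq_cexp_log hB, cpow_eq_cexp_log hη, cpow_eq_cexp_log hA,
    cpow_eq_cexp_log h1, cpow_eq_cexp_log h2, cpow_eq_cexp_log hp, cpow_eq_cexp_log hq,
    cpow_eq_cexp_log hr, ← Complex.exp_add, hlog]
  congr 1
  push_cast
  ring

/-- Because $l/\alpha_1=q$ and $l/\alpha_2=p$, the optical moment of order $ls$ has exactly the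
Gamma factors of `gammaProd_ratio`. The powers of $p,q,r$ left by Gauss' formula cancel those built
into the argument. -/
theorem meijerIntegrand_arg {n k : ℕ} (hB : 0 < C.scale M n k) {s : ℂ} (hs : 0 < s.re)
    (hs' : s.re < M.τ / S.l) :
    meijerIntegrand (S.r * (S.p + S.q + S.l) + S.l) S.l (S.upperList M) S.lowerList
      (C.arg M n k) s =
    S.meijerConst M * (Complex.Gamma (S.l * s) * Complex.Gamma (M.τ - S.l * s) *
      ((C.scale M n k : ℂ) ^ (-(S.l * s)) * ∫ y, (S.fsoSnr y : ℂ) ^ (S.l * s) ∂S.fsoLaw)) := by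
  have hrc : (S.r : ℂ) ≠ 0 := by exact_mod_cast S.r_pos.ne'
  have hqc : (S.q : ℂ) ≠ 0 := by exact_mod_cast S.q_pos.ne'
  have hpc : (S.p : ℂ) ≠ 0 := by exact_mod_cast S.p_pos.ne'
  have hls : 0 ≤ (S.l * s : ℂ).re := by simp; positivity
  have hrls : 0 ≤ (S.r * (S.l * s) : ℂ).re := by simp; positivity
  have q1 : (S.r * (S.l * s) : ℂ) / S.α₁ = S.q * (S.r * s) := by
    have : (S.l : ℂ) / S.α₁ = S.q := by exact_mod_cast congrArg Complex.ofReal S.l_div_α₁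
    rw [← this]; ring
  have q2 : (S.r * (S.l * s) : ℂ) / S.α₂ = S.p * (S.r * s) := by
    have : (S.l : ℂ) / S.α₂ = S.p := by exact_mod_cast congrArg Complex.ofReal S.l_div_α₂
    rw [← this]; ring
  rw [S.meijerIntegrand_eq M, S.gammaProd_ratio M hs hs', C.arg_cpow M hB,
    (S.integral_cpow_fsoSnr hls).2, (S.integral_cpow_fsoGain hrls).2, q1, q2,
    mul_left_comm (S.r : ℂ) (S.l : ℂ)]
  have c1 : ∀ {x : ℂ} (w : ℂ), x ≠ 0 → x ^ w ≠ 0 := fun w hx => by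
    simp [Complex.cpow_eq_zero_iff, hx]
  have n1 := c1 (S.q * (S.r * s)) hrc
  have n2 := c1 (S.p * (S.r * s)) hrc
  have n3 := c1 (S.q * (S.r * s)) hqc
  have n4 := c1 (S.p * (S.r * s)) hpc
  have e : ((S.r : ℂ) ^ (-(S.q * (S.r * s) : ℂ)) * (S.r : ℂ) ^ (-(S.p * (S.r * s) : ℂ)) *
        (S.q : ℂ) ^ (-(S.q * (S.r * s) : ℂ)) * (S.p : ℂ) ^ (-(S.p * (S.r * s) : ℂ))) *
      ((S.r : ℂ) ^ (S.q * (S.r * s) : ℂ) * (S.r : ℂ) ^ (S.p * (S.r * s) : ℂ) *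
        (S.q : ℂ) ^ (S.q * (S.r * s) : ℂ) * (S.p : ℂ) ^ (S.p * (S.r * s) : ℂ)) = 1 := by
    simp only [Complex.cpow_neg]
    rw [← mul_inv, ← mul_inv, ← mul_inv]
    exact inv_mul_cancel₀ (mul_ne_zero (mul_ne_zero (mul_ne_zero n1 n2) n3) n4)
  linear_combination (S.meijerConst M * (Complex.Gamma (S.l * s) * Complex.Gamma (M.τ - S.l * s)) *
    ((Complex.Gamma (S.m₁ + S.q * (S.r * s)) / Real.Gamma S.m₁) *
        ((Complex.Gamma (S.m₂ + S.p * (S.r * s)) / Real.Gamma S.m₂) *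
          ((S.ξ ^ 2 : ℝ) / ((S.ξ ^ 2 : ℝ) + S.l * (S.r * s))))) *
    ((C.scale M n k : ℂ) ^ (-(S.l * s)) * (((S.η ^ S.r / S.σ02 : ℝ) : ℂ) ^ (S.l * s) *
        (((S.A₀ * S.Il : ℝ) : ℂ) ^ (S.l * (S.r * s)) *
        (((S.Ω₁ / S.m₁ : ℝ) : ℂ) ^ (S.q * (S.r * s)) *
          ((S.Ω₂ / S.m₂ : ℝ) : ℂ) ^ (S.p * (S.r * s))))))) * e

/-- The substitution $s\mapsto ls$ carries the line at $c$ to the line at $lc\in(0,\tau)$, with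
Jacobian $1/l$. The value does not involve $c$. -/
theorem meijerLine {n k : ℕ} (hB : 0 < C.scale M n k) {c : ℝ} (hc : 0 < c)
    (hc' : c < M.τ / S.l) :
    Integrable (fun t : ℝ => meijerIntegrand (S.r * (S.p + S.q + S.l) + S.l) S.l (S.upperList M)
      S.lowerList (C.arg M n k) ((c : ℂ) + (t : ℂ) * Complex.I)) ∧
    meijerLineIntegral (S.r * (S.p + S.q + S.l) + S.l) S.l (S.upperList M) S.lowerList
      (C.arg M n k) c = ((S.meijerConst M / S.l * (Real.Gamma M.τ *
        ∫ y, (1 + C.scale M n k / S.fsoSnr y) ^ (-M.τ) ∂S.fsoLaw) : ℝ) : ℂ) := by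
  have hl : (0 : ℝ) < S.l := by exact_mod_cast S.l_pos
  have hlc : (S.l : ℂ) ≠ 0 := by exact_mod_cast S.l_pos.ne'
  have hσ : 0 < S.l * c := mul_pos hl hc
  have hσ' : S.l * c < M.τ := by rwa [lt_div_iff₀ hl, mul_comm] at hc'
  obtain ⟨hi, hv⟩ := integral_Gamma_mul_moment S.fsoLaw S.measurable_fsoSnr S.ae_fsoSnr_pos hσ hσ'
    hB (S.integral_cpow_fsoSnr (s := ((S.l * c : ℝ) : ℂ)) (by rw [Complex.ofReal_re]; exact hσ.le)).1
  set h : ℝ → ℂ := fun t => Complex.Gamma (((S.l * c : ℝ) : ℂ) + t * Complex.I) *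
      Complex.Gamma (M.τ - (((S.l * c : ℝ) : ℂ) + t * Complex.I)) *
      ((C.scale M n k : ℂ) ^ (-(((S.l * c : ℝ) : ℂ) + t * Complex.I)) *
        ∫ y, (S.fsoSnr y : ℂ) ^ (((S.l * c : ℝ) : ℂ) + t * Complex.I) ∂S.fsoLaw) with hh
  have key : ∀ t : ℝ, meijerIntegrand (S.r * (S.p + S.q + S.l) + S.l) S.l (S.upperList M)
      S.lowerList (C.arg M n k) ((c : ℂ) + (t : ℂ) * Complex.I) =
      S.meijerConst M * h (S.l * t) := fun t => by
    have e : (S.l : ℂ) * ((c : ℂ) + (t : ℂ) * Complex.I) =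
        ((S.l * c : ℝ) : ℂ) + ((S.l * t : ℝ) : ℂ) * Complex.I := by push_cast; ring
    rw [C.meijerIntegrand_arg M hB (by simpa using hc) (by simpa using hc'), e]
  constructor
  · simp_rw [key]
    exact (hi.comp_mul_left' hl.ne').const_mul _
  · rw [meijerLineIntegral]
    simp_rw [key]
    rw [integral_const_mul, Measure.integral_comp_mul_left, abs_of_pos (inv_pos.mpr hl),
      Complex.real_smul]
    rw [Complex.ofReal_mul, ← hv]
    push_cast
    ring

/-! ### The error probability as a sum of expectations over the optical link -/

theorem scale_pos (n : ℕ) {k : ℕ} (hk : k ∈ Finset.Icc 1 M.v) : 0 < C.scale M n k := by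
  have h1 := S.β_pos n
  have h2 := C.c_pos
  have h3 := C.one_le_κ
  have h4 := M.qk_pos k hk
  unfold scale
  positivity

/-- The rate at which the complementary CDF decays, given the state of the optical link. -/
def decayRate (n : ℕ) (y : ℝ × ℝ × ℝ) : ℝ := S.β n * (C.κ + C.c / S.fsoSnr y)

theorem measurable_decayRate (n : ℕ) : Measurable (C.decayRate n) := by
  have := S.measurable_fsoSnr
  unfold decayRate
  fun_prop

theorem ae_decayRate_nonneg (n : ℕ) : ∀ᵐ y ∂S.fsoLaw, 0 ≤ C.decayRate n y := by
  filter_upwards [S.ae_fsoSnr_pos] with y hy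
  have h1 := S.β_pos n
  have h2 := C.c_pos
  have h3 := C.one_le_κ
  unfold decayRate
  positivity

theorem cdf_γe2e [IsProbabilityMeasure P] {γ : ℝ} (hγ : 0 ≤ γ) :
    cdf (P.map C.γe2e) γ = 1 - ∑ n ∈ Finset.range S.m, S.weight n *
      ∫ y, Real.exp (-(C.decayRate n y * γ)) ∂S.fsoLaw := by
  have : IsProbabilityMeasure (P.map C.γe2e) :=
    Measure.isProbabilityMeasure_map C.aemeasurable_γe2e
  have hint : ∀ n, Integrable (fun y => Real.exp (-(C.decayRate n y * γ))) S.fsoLaw := fun n => by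
    have := C.measurable_decayRate n
    refine Integrable.mono' (integrable_const 1) (by fun_prop) ?_
    filter_upwards [C.ae_decayRate_nonneg n] with y hy
    rw [Real.norm_eq_abs, Real.abs_exp]
    exact Real.exp_le_one_iff.mpr (neg_nonpos.mpr (mul_nonneg hy hγ))
  have hsum := integrable_finsetSum (Finset.range S.m) fun n _ => (hint n).const_mul (S.weight n)
  have e : ∀ n y, Real.exp (-(S.β n * (γ * (C.κ + C.c / S.fsoSnr y)))) =
      Real.exp (-(C.decayRate n y * γ)) := fun n y => by
    unfold decayRate; ring_nf
  have h1 : (P.map C.γe2e).real (Set.Ioi γ) = ∑ n ∈ Finset.range S.m, S.weight n *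
      ∫ y, Real.exp (-(C.decayRate n y * γ)) ∂S.fsoLaw := by
    rw [measureReal_def, C.map_γe2e_Ioi hγ]
    simp_rw [e]
    rw [← integral_eq_lintegral_of_nonneg_ae _ hsum.aestronglyMeasurable,
      integral_finsetSum _ fun n _ => (hint n).const_mul _]
    · simp_rw [integral_const_mul]
    -- The weights alternate in sign, so nonnegativity cannot be checked term by term; the sum is
    -- nonnegative because it is a conditional probability.
    · filter_upwards [S.ae_fsoSnr_pos] with y hy
      have h2 := C.c_pos
      have h3 := C.one_le_κ
      have h4 := S.prod_tail_snr (x := γ * (C.κ + C.c / S.fsoSnr y)) (by positivity)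
      simp_rw [e] at h4
      exact h4 ▸ measureReal_nonneg
  rw [cdf_eq_real, ← Set.compl_Ioi, probReal_compl_eq_one_sub measurableSet_Ioi, h1]

/-- Factor $q+\beta(\kappa+c/Y)=(\beta\kappa+q)(1+B/Y)$ with $B$ the `scale`. -/
theorem integral_rpow_add_decayRate (n : ℕ) {k : ℕ} (hk : k ∈ Finset.Icc 1 M.v) :
    M.qk k ^ M.τ * ∫ y, (M.qk k + C.decayRate n y) ^ (-M.τ) ∂S.fsoLaw =
      (M.qk k / (S.β n * C.κ + M.qk k)) ^ M.τ *
        ∫ y, (1 + C.scale M n k / S.fsoSnr y) ^ (-M.τ) ∂S.fsoLaw := by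
  have h1 := S.β_pos n
  have h2 := C.scale_pos M n hk
  have h3 := C.one_le_κ
  have h4 := M.qk_pos k hk
  have hd : 0 < S.β n * C.κ + M.qk k := by positivity
  rw [← integral_const_mul, ← integral_const_mul]
  refine integral_congr_ae ?_
  filter_upwards [S.ae_fsoSnr_pos] with y hy
  have e : M.qk k + C.decayRate n y =
      (S.β n * C.κ + M.qk k) * (1 + C.scale M n k / S.fsoSnr y) := by
    unfold decayRate scale
    field_simp
    ring
  rw [e, Real.mul_rpow hd.le (by positivity), Real.div_rpow h4.le hd.le, Real.rpow_neg hd.le]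
  ring

theorem integral_mul_cdf_γe2e [IsProbabilityMeasure P] {k : ℕ} (hk : k ∈ Finset.Icc 1 M.v) :
    M.qk k ^ M.τ * ∫ γ in Set.Ioi (0 : ℝ), γ ^ (M.τ - 1) * Real.exp (-M.qk k * γ) *
        cdf (P.map C.γe2e) γ =
      Real.Gamma M.τ * (1 - ∑ n ∈ Finset.range S.m, S.weight n *
        ((M.qk k / (S.β n * C.κ + M.qk k)) ^ M.τ *
          ∫ y, (1 + C.scale M n k / S.fsoSnr y) ^ (-M.τ) ∂S.fsoLaw)) := by
  have hq := M.qk_pos k hk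
  have h := fun n => integral_rpow_mul_integral_exp S.fsoLaw (C.measurable_decayRate n)
    (C.ae_decayRate_nonneg n) M.τ_pos hq
  have e : ∀ γ ∈ Set.Ioi (0 : ℝ), γ ^ (M.τ - 1) * Real.exp (-M.qk k * γ) *
        cdf (P.map C.γe2e) γ = γ ^ (M.τ - 1) * Real.exp (-M.qk k * γ) -
      ∑ n ∈ Finset.range S.m, S.weight n * (γ ^ (M.τ - 1) * Real.exp (-M.qk k * γ) *
        ∫ y, Real.exp (-(C.decayRate n y * γ)) ∂S.fsoLaw) := fun γ hγ => by
    rw [C.cdf_γe2e (le_of_lt hγ), mul_sub, mul_one, Finset.mul_sum]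
    congr 1
    exact Finset.sum_congr rfl fun n _ => by ring
  rw [setIntegral_congr_fun measurableSet_Ioi e,
    integral_sub (integrableOn_rpow_mul_exp_neg M.τ_pos hq)
      (integrable_finsetSum _ fun n _ => (h n).1.const_mul _),
    integral_finsetSum _ fun n _ => (h n).1.const_mul _, integral_rpow_mul_exp_neg M.τ_pos hq,
    mul_sub, mul_sub, ← mul_assoc, ← Real.rpow_add hq, add_neg_cancel, Real.rpow_zero, one_mul,
    mul_one, Finset.mul_sum, Finset.mul_sum]
  congr 1
  refine Finset.sum_congr rfl fun n _ => ?_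
  rw [integral_const_mul, (h n).2, ← C.integral_rpow_add_decayRate M n hk]
  ring

/-- No contour is shifted: by `meijerLine`, the integrals along any two separating lines equal the
same expectation. -/
theorem meijerConverges_arg (n : ℕ) {k : ℕ} (hk : k ∈ Finset.Icc 1 M.v) :
    MeijerConverges (S.r * (S.p + S.q + S.l) + S.l) S.l (S.upperList M) S.lowerList
      (C.arg M n k) := by
  have hl : (0 : ℝ) < S.l := by exact_mod_cast S.l_pos
  have hτ := M.τ_pos
  have hB := C.scale_pos M n hk
  refine ⟨⟨M.τ / S.l / 2, (S.meijerSeparates_iff M).mpr ⟨by positivity, half_lt_self (by positivity)⟩⟩,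
    fun c hc => ?_, fun c c' hc hc' => ?_⟩
  · obtain ⟨h1, h2⟩ := (S.meijerSeparates_iff M).mp hc
    exact (C.meijerLine M hB h1 h2).1
  · obtain ⟨h1, h2⟩ := (S.meijerSeparates_iff M).mp hc
    obtain ⟨h3, h4⟩ := (S.meijerSeparates_iff M).mp hc'
    rw [(C.meijerLine M hB h1 h2).2, (C.meijerLine M hB h3 h4).2]

theorem meijerG_arg (n : ℕ) {k : ℕ} (hk : k ∈ Finset.Icc 1 M.v) :
    meijerG (S.r * (S.p + S.q + S.l) + S.l) S.l (S.upperList M) S.lowerList (C.arg M n k) =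
      ((S.meijerConst M / S.l * (Real.Gamma M.τ *
        ∫ y, (1 + C.scale M n k / S.fsoSnr y) ^ (-M.τ) ∂S.fsoLaw) : ℝ) : ℂ) := by
  have h := (C.meijerConverges_arg M n hk).1
  obtain ⟨h1, h2⟩ := (S.meijerSeparates_iff M).mp h.choose_spec
  rw [meijerG, dif_pos h]
  exact (C.meijerLine M (C.scale_pos M n hk) h1 h2).2

theorem averageBEP_eq_cdf [IsProbabilityMeasure P] :
    C.averageBEP M = M.δ / (2 * Real.Gamma M.τ) *
      ∑ k ∈ Finset.Icc 1 M.v, M.qk k ^ M.τ *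
        ∫ γ in Set.Ioi (0 : ℝ), γ ^ (M.τ - 1) * Real.exp (-M.qk k * γ) *
          cdf (P.map C.γe2e) γ := by
  have : IsProbabilityMeasure (P.map C.γe2e) :=
    Measure.isProbabilityMeasure_map C.aemeasurable_γe2e
  rw [averageBEP]
  congr 1
  exact Finset.sum_congr rfl fun k hk =>
    integral_upperGamma M.τ_pos (M.qk_pos k hk) _ C.ae_nonneg_map_γe2e

theorem averageBEP_eq_sum [IsProbabilityMeasure P] :
    C.averageBEP M = M.δ * M.v / 2 - M.δ / 2 * ∑ n ∈ Finset.range S.m,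
      ∑ k ∈ Finset.Icc 1 M.v, S.weight n * ((M.qk k / (S.β n * C.κ + M.qk k)) ^ M.τ *
          ∫ y, (1 + C.scale M n k / S.fsoSnr y) ^ (-M.τ) ∂S.fsoLaw) := by
  have hΓ := Real.Gamma_pos_of_pos M.τ_pos
  rw [C.averageBEP_eq_cdf M, Finset.sum_congr rfl fun k hk => C.integral_mul_cdf_γe2e M hk,
    ← Finset.mul_sum, Finset.sum_sub_distrib, Finset.sum_const, Nat.card_Icc, Finset.sum_comm]
  simp only [nsmul_eq_mul, mul_one, add_tsub_cancel_right]
  have e : ∀ T : ℝ, M.δ / (2 * Real.Gamma M.τ) * (Real.Gamma M.τ * (M.v - T)) =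
      M.δ * M.v / 2 - M.δ / 2 * T := fun T => by field_simp
  exact e _

end Channel

end Relay

end

/-! ### The closed form -/

theorem mainTheorem2 (S : Relay.Params) (M : Relay.Modulation) {Ω : Type*} [MeasurableSpace Ω]
    (P : Measure Ω) [IsProbabilityMeasure P] (C : Relay.Channel S P) :
    -- the Meijer G-functions in the closed form are well defined
    (∀ n ∈ Finset.range S.m, ∀ k ∈ Finset.Icc 1 M.v,
      Relay.MeijerConverges (S.r * (S.p + S.q + S.l) + S.l) S.l
        (S.upperList M) S.lowerList (C.arg M n k)) ∧
    -- the average bit error probability in terms of the CDF of the end-to-end SNDR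
    (∀ k ∈ Finset.Icc 1 M.v,
      IntegrableOn (fun γ : ℝ => γ ^ (M.τ - 1) * Real.exp (-M.qk k * γ) *
        cdf (P.map C.γe2e) γ) (Set.Ioi 0)) ∧
    C.averageBEP M = M.δ / (2 * Real.Gamma M.τ) *
      ∑ k ∈ Finset.Icc 1 M.v, M.qk k ^ M.τ *
        ∫ γ in Set.Ioi (0 : ℝ), γ ^ (M.τ - 1) * Real.exp (-M.qk k * γ) *
          cdf (P.map C.γe2e) γ ∧
    -- the closed form
    (C.averageBEP M : ℂ) =
      ((M.δ * M.v / 2 : ℝ) : ℂ) -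
      ((S.m * M.δ * S.ξ ^ 2 * (S.p : ℝ) ^ (M.τ + S.m₂ - 3 / 2) * (S.q : ℝ) ^ (S.m₁ - 1 / 2) *
          S.α₂ ^ (M.τ - 1) * (S.r : ℝ) ^ (S.μ - 1) /
        (2 * (2 * Real.pi) ^ ((2 * (S.l : ℝ) + S.r * (S.p + S.q) - 4) / 2) *
          Real.Gamma S.m₁ * Real.Gamma S.m₂ * Real.Gamma M.τ) * (S.N.choose S.m : ℝ) : ℝ) : ℂ) *
      ∑ n ∈ Finset.range S.m, ∑ k ∈ Finset.Icc 1 M.v,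
        ((((S.m - 1).choose n : ℝ) * ((-1) ^ n / ((S.N : ℝ) - S.m + n + 1)) *
          (M.qk k / (S.β n * C.κ + M.qk k)) ^ M.τ : ℝ) : ℂ) *
        Relay.meijerG (S.r * (S.p + S.q + S.l) + S.l) S.l
          (S.upperList M) S.lowerList (C.arg M n k) := by
  refine ⟨fun n _ k hk => C.meijerConverges_arg M n hk,
    fun k hk => Relay.integrableOn_mul_cdf M.τ_pos (M.qk_pos k hk) _, C.averageBEP_eq_cdf M, ?_⟩
  have hΓ := (Real.Gamma_pos_of_pos M.τ_pos).ne'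
  have e : ∑ n ∈ Finset.range S.m, ∑ k ∈ Finset.Icc 1 M.v,
        ((((S.m - 1).choose n : ℝ) * ((-1) ^ n / ((S.N : ℝ) - S.m + n + 1)) *
          (M.qk k / (S.β n * C.κ + M.qk k)) ^ M.τ : ℝ) : ℂ) *
        Relay.meijerG (S.r * (S.p + S.q + S.l) + S.l) S.l
          (S.upperList M) S.lowerList (C.arg M n k) =
      ((∑ n ∈ Finset.range S.m, ∑ k ∈ Finset.Icc 1 M.v,
        ((S.m - 1).choose n : ℝ) * ((-1) ^ n / ((S.N : ℝ) - S.m + n + 1)) *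
          (M.qk k / (S.β n * C.κ + M.qk k)) ^ M.τ * (S.meijerConst M / S.l * (Real.Gamma M.τ *
            ∫ y, (1 + C.scale M n k / S.fsoSnr y) ^ (-M.τ) ∂S.fsoLaw)) : ℝ) : ℂ) := by
    rw [Complex.ofReal_sum]
    refine Finset.sum_congr rfl fun n _ => ?_
    rw [Complex.ofReal_sum]
    refine Finset.sum_congr rfl fun k hk => ?_
    rw [C.meijerG_arg M n hk, ← Complex.ofReal_mul]
  rw [e, ← Complex.ofReal_mul, ← Complex.ofReal_sub, C.averageBEP_eq_sum M]
  congr 2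
  simp_rw [Finset.mul_sum]
  refine Finset.sum_congr rfl fun n _ => Finset.sum_congr rfl fun k _ => ?_
  rw [Relay.Params.weight]
  -- With the expectation and the powers frozen, the two summands differ only by the constant that
  -- `meijerConst_mul` evaluates to $1$ and by $\Gamma(\tau)/\Gamma(\tau)$.
  generalize (∫ y, (1 + C.scale M n k / S.fsoSnr y) ^ (-M.τ) ∂S.fsoLaw) = E
  generalize (M.qk k / (S.β n * C.κ + M.qk k)) ^ M.τ = A
  generalize ((-1 : ℝ) ^ n / ((S.N : ℝ) - S.m + n + 1)) = W
  have hc := S.meijerConst_mul M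
  set X := S.ξ ^ 2 * (S.p : ℝ) ^ (M.τ + S.m₂ - 3 / 2) * (S.q : ℝ) ^ (S.m₁ - 1 / 2) *
      S.α₂ ^ (M.τ - 1) * (S.r : ℝ) ^ (S.μ - 1) with hX
  set D := (2 * Real.pi) ^ ((2 * (S.l : ℝ) + S.r * (S.p + S.q) - 4) / 2) *
        Real.Gamma S.m₁ * Real.Gamma S.m₂ with hD
  set Q := S.meijerConst M / S.l with hQ
  have e2 : S.m * M.δ * S.ξ ^ 2 * (S.p : ℝ) ^ (M.τ + S.m₂ - 3 / 2) * (S.q : ℝ) ^ (S.m₁ - 1 / 2) *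
          S.α₂ ^ (M.τ - 1) * (S.r : ℝ) ^ (S.μ - 1) /
        (2 * (2 * Real.pi) ^ ((2 * (S.l : ℝ) + S.r * (S.p + S.q) - 4) / 2) *
          Real.Gamma S.m₁ * Real.Gamma S.m₂ * Real.Gamma M.τ) =
      S.m * M.δ / (2 * Real.Gamma M.τ) * (X / D) := by
    rw [div_mul_div_comm]
    congr 1
    · rw [hX]; ring
    · rw [hD]; ring
  rw [e2]
  have e3 : S.m * M.δ / (2 * Real.Gamma M.τ) * (X / D) * (S.N.choose S.m : ℝ) *
      (((S.m - 1).choose n : ℝ) * W * A * (Q * (Real.Gamma M.τ * E))) =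
      S.m * M.δ / 2 * (S.N.choose S.m : ℝ) * (((S.m - 1).choose n : ℝ) * W * A * E) *
        (X / D * Q) * (Real.Gamma M.τ / Real.Gamma M.τ) := by
    ring
  rw [e3, hc, div_self hΓ]
  ring
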